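/- Let $n\ge 1$. Let $\Theta=(\xi_1,\dots,\xi_N)$ be a finite collection of frequencies in $\mathbb R^n$ and let $A$ be a constant. A bounded linear operator $T$ on $L^2(\mathbb R^n;\mathbb C)$ with $\|T\|_{L^2\to L^2}\le A$ is called a *Calderón–Zygmund operator relatively to $\Theta$ (with constant $A$)* if there are linear operators $T_1,\dots,T_N$ from $L^2$ to the measurable functions, and kernels $K_1,\dots,K_N$, such that - $T=\sum_{j=1}^N T_j$; - for every compactly supported $f\in L^2$ and almost every $x\notin\operatorname{supp} f$, $T_jf(x)=\int K_j(x,y)f(y)\,dy$; - the kernels $\widetilde K_j(x,y):=e^{-i\xi_j\cdot(x-y)}K_j(x,y)$ are differentiable off the diagonal and $\sum_{j=1}^N|\nabla_{(x,y)}\widetilde K_j(x,y)|\le A\,|x-y|^{-n-1}$ for all $x\ne y$. Let $1<s<\infty$ and let $E$ be the linear span of the functions $e^{i\xi_j\cdot x}$, $1\le j\le N$. For a ball $Q$ and $f\in L^s(3Q)$ let $\pi_{\Theta,Q}f\in E$ be the projection of $f$ on $E$ in $L^s(3Q)$, that is, the element with $\|f-\pi_{\Theta,Q}f\|_{L^s(3Q)}=\min_{\phi\in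 E}\|f-\phi\|_{L^s(3Q)}$. Over all balls $Q$ containing $x$, set $$M^\sharp_{s,\Theta}f(x)=\sup_{Q\ni x}\Big(\frac1{|Q|}\int_Q|f-\pi_{\Theta,Q}f|^s\Big)^{1/s},\qquad M_sf(x)=\sup_{Q\ni x}\Big(\frac1{|Q|}\int_Q|f|^s\Big)^{1/s}.$$ Then there is a constant $C$ depending only on $n$, $s$ and $A$ (not on $N$, $\Theta$, $T$) such that, for every Calderón–Zygmund operator $T$ relatively to $\Theta$ with constant $A$, $$M^\sharp_{s,\Theta}(Tf)(x)\le C\,N^{\left|\frac1s-\frac12\right|}\,M_sf(x)\qquad\text{for all }x\in\mathbb R^n,$$ for every $f\in L^2(\mathbb R^n)$, and also for every $f\in L^s(\mathbb R^n)$, where $Tf$ then denotes the value at $f$ of the continuous extension of $T$ from $L^2\cap L^s$ to $L^s$ (this extension exists). -/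

import Mathlib

open MeasureTheory Filter Topology Metric
open scoped ENNReal NNReal

namespace MultiFreq

noncomputable section

/-- Euclidean space of dimension `n`. -/
abbrev Rn (n : ℕ) : Type := EuclideanSpace ℝ (Fin n)

/-- The complex Hilbert space of square integrable functions on `Rn n`. -/
abbrev L2 (n : ℕ) : Type := Lp ℂ 2 (volume : Measure (Rn n))

/-- The exponential `x ↦ exp (i ξ · x)`. -/
def character {n : ℕ} (ξ : Rn n) (x : Rn n) : ℂ :=
  Complex.exp (Complex.I * (inner ℝ ξ x : ℝ))

/-- The linear span of the exponentials with frequencies in `Θ`. -/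
def expSpan {n N : ℕ} (Θ : Fin N → Rn n) : Submodule ℂ (Rn n → ℂ) :=
  Submodule.span ℂ (Set.range fun j => character (Θ j))

/-- The kernel `exp (-i ξ · (x - y)) K (x, y)`, demodulated at the frequency `ξ`,
as a function of the pair `(x, y)`. -/
def demodulated {n : ℕ} (ξ : Rn n) (K : Rn n → Rn n → ℂ) (z : Rn n × Rn n) : ℂ :=
  Complex.exp (-(Complex.I * (inner ℝ ξ (z.1 - z.2) : ℝ))) * K z.1 z.2

/-- `T` is a Calderón-Zygmund operator relatively to the frequencies `Θ`, with the constant `A`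
in both quantitative conditions: the `L²` bound, and the gradient bound for the kernels.
The pieces `S j` are linear operators with values in the (classes of) measurable functions;
no boundedness is required of them. -/
structure IsCalderonZygmund {n N : ℕ} (Θ : Fin N → Rn n) (A : ℝ)
    (T : L2 n →L[ℂ] L2 n) : Prop where
  norm_le : ‖T‖ ≤ A
  exists_decomposition :
    ∃ (S : Fin N → L2 n →ₗ[ℂ] (Rn n →ₘ[volume] ℂ)) (K : Fin N → Rn n → Rn n → ℂ),
      (∀ f : L2 n, (T f : Rn n →ₘ[volume] ℂ) = ∑ j, S j f) ∧
      (∀ (j : Fin N) (f : Rn n → ℂ) (hf : MemLp f 2 volume), HasCompactSupport f →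
        ∀ᵐ x ∂(volume : Measure (Rn n)), x ∉ tsupport f →
          S j (hf.toLp f) x = ∫ y, K j x y * f y) ∧
      (∀ (j : Fin N) (x y : Rn n), x ≠ y →
        DifferentiableAt ℝ (demodulated (Θ j) (K j)) (x, y)) ∧
      (∀ x y : Rn n, x ≠ y →
        ∑ j, ‖fderiv ℝ (demodulated (Θ j) (K j)) (x, y)‖ ≤ A / ‖x - y‖ ^ (n + 1))

/-- The maximal function `M_s f (x) = sup_{Q ∋ x} (⨍_Q |f|^s)^(1/s)`, over all balls `Q`
containing `x`. -/
def maximal {n : ℕ} (s : ℝ) (f : Rn n → ℂ) (x : Rn n) : ℝ≥0∞ :=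
  (⨆ (c : Rn n) (r : ℝ) (_ : 0 < r) (_ : x ∈ ball c r),
    ⨍⁻ y in ball c r, ‖f y‖ₑ ^ s ∂volume) ^ (1 / s)

/-- `v` is a projection of `f` on the span of the exponentials, in the sense of the norm of
`L^s (3Q)`, where `Q = ball c r`. If `f` is not in `L^s (3Q)` all distances are infinite, and
every `v` of the span qualifies. -/
def IsProjection {n N : ℕ} (s : ℝ) (Θ : Fin N → Rn n) (c : Rn n) (r : ℝ)
    (f v : Rn n → ℂ) : Prop :=
  v ∈ expSpan Θ ∧ ∀ φ ∈ expSpan Θ,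
    eLpNorm (f - v) (ENNReal.ofReal s) (volume.restrict (ball c (3 * r))) ≤
      eLpNorm (f - φ) (ENNReal.ofReal s) (volume.restrict (ball c (3 * r)))

/-- The multi-frequency maximal sharp function
`sup_{Q ∋ x} (⨍_Q |f - v_Q|^s)^(1/s)`, where `v_Q` is the projection of `f` in `L^s (3Q)`
(unique for `f ∈ L^s (3Q)` and `1 < s`; in general the supremum is over all of them). -/
def sharpMaximal {n N : ℕ} (s : ℝ) (Θ : Fin N → Rn n) (f : Rn n → ℂ) (x : Rn n) : ℝ≥0∞ :=
  ⨆ (c : Rn n) (r : ℝ) (_ : 0 < r) (_ : x ∈ ball c r)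
    (v : Rn n → ℂ) (_ : IsProjection s Θ c r f v),
    (⨍⁻ y in ball c r, ‖f y - v y‖ₑ ^ s ∂volume) ^ (1 / s)

/-- `g ∈ L^s` is the value at `f ∈ L^s` of the continuous extension of `T` from `L² ∩ L^s`
to `L^s`: whenever functions `u k` of `L²` converge to `f` in the norm of `L^s`,
their images converge to `g` in the norm of `L^s`. -/
def IsExtensionValue {n : ℕ} (T : L2 n →L[ℂ] L2 n) (s : ℝ) (f g : Rn n → ℂ) : Prop :=
  MemLp g (ENNReal.ofReal s) volume ∧
  ∀ u : ℕ → L2 n,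
    Tendsto (fun k => eLpNorm (⇑(u k) - f) (ENNReal.ofReal s) volume) atTop (𝓝 0) →
    Tendsto (fun k => eLpNorm (⇑(T (u k)) - g) (ENNReal.ofReal s) volume) atTop (𝓝 0)

end

end MultiFreq

namespace MultiFreq

/-! ### Balls of Euclidean space -/

/-! Fix a ball Q of centre c and radius r containing x. The projection minimises the distance to E
in L^s(3Q), so it suffices to find one element of E whose L^s(3Q) distance to Tf is at most C
N^|1/s-1/2| M_s f(x) |Q|^(1/s). Split f into its parts inside and outside 6Q.

Far part (`exists_expSpan_far`). For z in 3Q, freeze the demodulated kernel in e^{iξ_j·(z-y)}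
K̃_j(z,y) at z = c. What is left is, as a function of z, a multiple of e^{iξ_j·z}, so integration in
y gives an element of E. The error is governed by the gradient bound, which is already summed over j
and so costs no power of N; dyadic summation bounds it by a multiple of M_s f(x).

Near part (`exists_strong_type`). Here the norm of T on L^s is needed, with growth N^|1/s-1/2|. The
L² bound carries no N. A weak type (1,1) bound with constant √N (`weak_type`) interpolates with it
to give 1 < s < 2, and duality gives s > 2, because the adjoint has a kernel of the same kind
(`adjoint`).

The weak type bound uses a Calderón–Zygmund decomposition whose bad pieces are orthogonal to all N
exponentials instead of having mean zero. A piece f_i carried by a ball B is replaced by its L²(3B)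
projection g_i on E. Since ‖g_i‖₂² = ⟨g_i, f_i⟩, the Nikolskii inequality sup_B |φ| ≤ (N/|B|)^(1/2)
‖φ‖_{L²(3B)} on E (`enorm_sq_mul_volume_le`) yields ‖g_i‖₂² ≤ N ‖f_i‖₁² / |B|. Decomposing at height
λ/√N balances the loss N in the good part against the loss √N in the others.

The Nikolskii inequality holds for arbitrary frequencies: the reproducing kernel of E in L²(B) has
trace dim E ≤ N, so its diagonal is at most N/|B| at some point of B, and E is translation
invariant, so this point can be moved anywhere in B at the price of enlarging B to 3B.

For f in L^s, truncations of f lie in L² and are dominated by |f|, so M_s does not increase and the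
distance estimate passes to the limit. -/

instance {n : ℕ} [NeZero n] : Nontrivial (Rn n) :=
  Module.nontrivial_of_finrank_pos (R := ℝ) (by simpa using Nat.pos_of_neZero n)

/-- The volume of the unit ball of `Rn n`. -/
noncomputable def unitVol (n : ℕ) : ℝ≥0∞ := volume (ball (0 : Rn n) 1)

section Balls

variable {n : ℕ}

theorem unitVol_pos : unitVol n ≠ 0 := (measure_ball_pos volume _ one_pos).ne'

theorem unitVol_ne_top : unitVol n ≠ ∞ := measure_ball_lt_top.ne

theorem volume_ball_eq [NeZero n] (c : Rn n) {r : ℝ} (hr : 0 ≤ r) :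
    volume (ball c r) = ENNReal.ofReal (r ^ n) * unitVol n := by
  rw [Measure.addHaar_ball volume c hr, finrank_euclideanSpace_fin, unitVol]

theorem volume_ball_mul [NeZero n] (c c' : Rn n) {a r : ℝ} (ha : 0 ≤ a) (hr : 0 ≤ r) :
    volume (ball c (a * r)) = ENNReal.ofReal (a ^ n) * volume (ball c' r) := by
  rw [volume_ball_eq c (by positivity), volume_ball_eq c' hr, mul_pow,
    ENNReal.ofReal_mul (by positivity), mul_assoc]

theorem volume_ball_ne_zero (c : Rn n) {r : ℝ} (hr : 0 < r) : volume (ball c r) ≠ 0 :=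
  (measure_ball_pos volume c hr).ne'

theorem volume_ball_ne_top (c : Rn n) (r : ℝ) : volume (ball c r) ≠ ∞ := measure_ball_lt_top.ne

/-- A set of finite volume contains only balls of bounded radius. -/
theorem exists_radius_bound [NeZero n] {I : ℝ≥0∞} (hI : I ≠ ∞) :
    ∃ R : ℝ, ∀ (c : Rn n) (r : ℝ), volume (ball c r) ≤ I → r ≤ R := by
  refine ⟨max 1 (I / unitVol n).toReal, fun c r h => ?_⟩
  by_contra! hlt
  have h1 : 1 < r := lt_of_le_of_lt (le_max_left _ _) hlt
  have h2 : (I / unitVol n).toReal < r := lt_of_le_of_lt (le_max_right _ _) hlt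
  rw [volume_ball_eq c (by linarith), ← ENNReal.le_div_iff_mul_le (Or.inl unitVol_pos)
    (Or.inl unitVol_ne_top), ENNReal.ofReal_le_iff_le_toReal
      (ENNReal.div_ne_top hI unitVol_pos)] at h
  have h3 : r ≤ r ^ n := le_self_pow₀ h1.le (NeZero.ne n)
  linarith

/-- Summation over dyadic annuli: the kernel `ρ / |y - c| ^ (n + 1)` away from the ball of radius
`ρ` is controlled by averages over larger concentric balls. -/
theorem lintegral_tail_le [NeZero n] (h : Rn n → ℝ≥0∞) (c : Rn n) {ρ : ℝ} (hρ : 0 < ρ)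
    {M : ℝ≥0∞} (hM : ∀ R, ρ ≤ R → ∫⁻ y in ball c R, h y ≤ M * volume (ball c R)) :
    ∫⁻ y in (ball c ρ)ᶜ, ENNReal.ofReal (ρ / dist y c ^ (n + 1)) * h y ≤
      ENNReal.ofReal (2 ^ (n + 1)) * unitVol n * M := by
  have hcover : (ball c ρ)ᶜ ⊆ ⋃ k : ℕ, ball c (2 ^ (k + 1) * ρ) \ ball c (2 ^ k * ρ) := by
    intro y hy
    have hy' : ρ ≤ dist y c := by simpa using hy
    obtain ⟨k, hk1, hk2⟩ := exists_nat_pow_near (y := (2 : ℝ)) ((one_le_div hρ).2 hy') one_lt_two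
    refine Set.mem_iUnion.2 ⟨k, ?_, ?_⟩
    · rw [mem_ball]; exact (div_lt_iff₀ hρ).1 hk2
    · rw [mem_ball, not_lt]; exact (le_div_iff₀ hρ).1 hk1
  calc ∫⁻ y in (ball c ρ)ᶜ, ENNReal.ofReal (ρ / dist y c ^ (n + 1)) * h y
      ≤ ∑' k : ℕ, ∫⁻ y in ball c (2 ^ (k + 1) * ρ) \ ball c (2 ^ k * ρ),
          ENNReal.ofReal (ρ / dist y c ^ (n + 1)) * h y :=
        (lintegral_mono_set hcover).trans (lintegral_iUnion_le _ _)
    _ ≤ ∑' k : ℕ, ENNReal.ofReal (2 ^ n) * unitVol n * M * (2⁻¹ : ℝ≥0∞) ^ k := by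
        refine ENNReal.tsum_le_tsum fun k => ?_
        have hk : 0 < 2 ^ k * ρ := by positivity
        calc ∫⁻ y in ball c (2 ^ (k + 1) * ρ) \ ball c (2 ^ k * ρ),
              ENNReal.ofReal (ρ / dist y c ^ (n + 1)) * h y
            ≤ ∫⁻ y in ball c (2 ^ (k + 1) * ρ) \ ball c (2 ^ k * ρ),
              ENNReal.ofReal (ρ / (2 ^ k * ρ) ^ (n + 1)) * h y := by
              refine setLIntegral_mono' (measurableSet_ball.diff measurableSet_ball) fun y hy => ?_
              have : 2 ^ k * ρ ≤ dist y c := by simpa using hy.2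
              gcongr
          _ = ENNReal.ofReal (ρ / (2 ^ k * ρ) ^ (n + 1)) *
                ∫⁻ y in ball c (2 ^ (k + 1) * ρ) \ ball c (2 ^ k * ρ), h y :=
              lintegral_const_mul' _ _ ENNReal.ofReal_ne_top
          _ ≤ ENNReal.ofReal (ρ / (2 ^ k * ρ) ^ (n + 1)) *
                (M * volume (ball c (2 ^ (k + 1) * ρ))) := by
              gcongr
              refine (lintegral_mono_set Set.sdiff_subset).trans (hM _ ?_)
              have : (1 : ℝ) ≤ 2 ^ (k + 1) := one_le_pow₀ one_le_two
              nlinarith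
          _ = ENNReal.ofReal (2 ^ n) * unitVol n * M * (2⁻¹ : ℝ≥0∞) ^ k := by
              -- The kernel has one more power of the radius than the volume of the ball; this
              -- surplus gives the geometric factor 2^(-k).
              have e : ENNReal.ofReal (ρ / (2 ^ k * ρ) ^ (n + 1)) *
                  ENNReal.ofReal ((2 ^ (k + 1) * ρ) ^ n) =
                  ENNReal.ofReal (2 ^ n) * (2⁻¹ : ℝ≥0∞) ^ k := by
                have : (2⁻¹ : ℝ≥0∞) = ENNReal.ofReal 2⁻¹ := by
                  rw [ENNReal.ofReal_inv_of_pos two_pos]; simp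
                rw [this, ← ENNReal.ofReal_pow (by norm_num), ← ENNReal.ofReal_mul (by positivity),
                  ← ENNReal.ofReal_mul (by positivity)]
                congr 1
                rw [inv_pow, pow_succ (2 ^ k * ρ) n, pow_succ (2 : ℝ) k,
                  show (2 : ℝ) ^ k * 2 * ρ = 2 * (2 ^ k * ρ) by ring, mul_pow 2 (2 ^ k * ρ)]
                field_simp
              rw [volume_ball_eq c (by positivity)]
              calc _ = ENNReal.ofReal (ρ / (2 ^ k * ρ) ^ (n + 1)) *
                  ENNReal.ofReal ((2 ^ (k + 1) * ρ) ^ n) * unitVol n * M := by ring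
                _ = _ := by rw [e]; ring
    _ = ENNReal.ofReal (2 ^ (n + 1)) * unitVol n * M := by
        rw [ENNReal.tsum_mul_left, ENNReal.tsum_geometric, ENNReal.one_sub_inv_two, inv_inv,
          pow_succ (2 : ℝ) n, ENNReal.ofReal_mul (by positivity)]
        simp; ring

/-! ### The set where some average exceeds a level -/

/-- The union of all balls on which the average of `h` exceeds `α`. -/
def largeAverage (h : Rn n → ℝ≥0∞) (α : ℝ≥0∞) : Set (Rn n) :=
  ⋃ p ∈ {p : Rn n × ℝ | 0 < p.2 ∧ α * volume (ball p.1 p.2) < ∫⁻ y in ball p.1 p.2, h y},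
    ball p.1 p.2

theorem isOpen_largeAverage (h : Rn n → ℝ≥0∞) (α : ℝ≥0∞) : IsOpen (largeAverage h α) :=
  isOpen_biUnion fun _ _ => isOpen_ball

/-- This is how points outside the exceptional set are used: every ball through such a point,
centred there or not, has average at most α. -/
theorem lintegral_ball_le_of_notMem {h : Rn n → ℝ≥0∞} {α : ℝ≥0∞} {z : Rn n}
    (hz : z ∉ largeAverage h α) {c : Rn n} {r : ℝ} (hc : z ∈ ball c r) :
    ∫⁻ y in ball c r, h y ≤ α * volume (ball c r) := by
  by_contra! hlt
  exact hz (Set.mem_biUnion (x := (c, r)) ⟨pos_of_mem_ball hc, hlt⟩ hc)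

/-- The weak type inequality for the maximal function, by Vitali covering. -/
theorem mul_volume_largeAverage_le [NeZero n] {h : Rn n → ℝ≥0∞} {α : ℝ≥0∞} (hα : α ≠ 0)
    (hα' : α ≠ ∞) (hh : ∫⁻ y, h y ≠ ∞) :
    α * volume (largeAverage h α) ≤ ENNReal.ofReal (5 ^ n) * ∫⁻ y, h y := by
  set t := {p : Rn n × ℝ | 0 < p.2 ∧ α * volume (ball p.1 p.2) < ∫⁻ y in ball p.1 p.2, h y}
  -- Vitali covering needs bounded radii: a ball on which the average exceeds α has volume at most ∫
  -- h / α.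
  obtain ⟨R, hR⟩ := exists_radius_bound (n := n) (ENNReal.div_ne_top hh hα)
  have hbd : ∀ p ∈ t, p.2 ≤ R := by
    intro p hp
    refine hR p.1 p.2 ((ENNReal.le_div_iff_mul_le (Or.inl hα) (Or.inl hα')).2 ?_)
    rw [mul_comm]
    exact hp.2.le.trans (setLIntegral_le_lintegral _ _)
  obtain ⟨u, hut, hdisj, hu⟩ := Vitali.exists_disjoint_subfamily_covering_enlargement_ball t
    (fun p => p.1) (fun p => p.2) R hbd 5 (by norm_num)
  have hcount : u.Countable := hdisj.countable_of_isOpen (fun _ _ => isOpen_ball)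
    fun p hp => nonempty_ball.2 (hut hp).1
  have := hcount.to_subtype
  have hsub : largeAverage h α ⊆ ⋃ p : u, ball p.1.1 (5 * p.1.2) := by
    refine Set.iUnion₂_subset fun p hp => ?_
    obtain ⟨q, hq, hpq⟩ := hu p hp
    exact hpq.trans (Set.subset_iUnion (fun p : u => ball p.1.1 (5 * p.1.2)) ⟨q, hq⟩)
  calc α * volume (largeAverage h α)
      ≤ α * ∑' p : u, volume (ball p.1.1 (5 * p.1.2)) := by
        gcongr; exact (measure_mono hsub).trans (measure_iUnion_le _)
    _ = ∑' p : u, ENNReal.ofReal (5 ^ n) * (α * volume (ball p.1.1 p.1.2)) := by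
        rw [← ENNReal.tsum_mul_left]
        refine tsum_congr fun p => ?_
        rw [volume_ball_mul p.1.1 p.1.1 (by norm_num) (hut p.2).1.le]; ring
    _ ≤ ∑' p : u, ENNReal.ofReal (5 ^ n) * ∫⁻ y in ball p.1.1 p.1.2, h y :=
        ENNReal.tsum_le_tsum fun p => mul_le_mul_right (hut p.2).2.le _
    _ = ENNReal.ofReal (5 ^ n) * ∫⁻ y in ⋃ p : u, ball p.1.1 p.1.2, h y := by
        rw [ENNReal.tsum_mul_left, lintegral_iUnion (fun _ => measurableSet_ball)]
        intro p q hpq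
        exact hdisj p.2 q.2 (fun h => hpq (Subtype.ext h))
    _ ≤ _ := mul_le_mul_right (setLIntegral_le_lintegral _ _) _

/-- Lebesgue differentiation: off the set of large averages the function is small. -/
theorem ae_le_of_notMem_largeAverage [NeZero n] {h : Rn n → ℝ≥0∞} {α : ℝ≥0∞}
    (hm : AEMeasurable h) (hh : ∫⁻ y, h y ≠ ∞) :
    ∀ᵐ x, x ∉ largeAverage h α → h x ≤ α := by
  filter_upwards [(Besicovitch.vitaliFamily (volume : Measure (Rn n))).ae_tendsto_lintegral_div
    hm hh] with x hx hxΩ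
  have h1 := hx.comp (Besicovitch.tendsto_filterAt volume x)
  refine le_of_tendsto h1 ?_
  filter_upwards [self_mem_nhdsWithin] with r hr
  have hr : 0 < r := hr
  have e : ∫⁻ y in closedBall x r, h y = ∫⁻ y in ball x r, h y := by
    refine setLIntegral_congr ?_
    rw [← ball_union_sphere]
    exact union_ae_eq_left_of_ae_eq_empty (ae_eq_empty.2 (Measure.addHaar_sphere volume x r))
  simp only [Function.comp]
  rw [e, Measure.addHaar_closedBall_eq_addHaar_ball]
  exact ENNReal.div_le_of_le_mul (lintegral_ball_le_of_notMem hxΩ (mem_ball_self hr))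

/-! ### Whitney balls -/

/-- A Whitney covering of an open set by countably many balls (of which some may be empty). -/
theorem exists_whitney_balls [NeZero n] {Ω : Set (Rn n)} (hΩ : IsOpen Ω) (hvol : volume Ω ≠ ∞) :
    ∃ (x : ℕ → Rn n) (r : ℕ → ℝ), (∀ i, 0 ≤ r i) ∧
      (∀ i, 0 < r i → ball (x i) (100 * r i) ⊆ Ω) ∧
      (∀ i, 0 < r i → ∃ z ∉ Ω, dist z (x i) = 100 * r i) ∧
      Ω ⊆ ⋃ i, ball (x i) (5 * r i) ∧
      ∀ (y : Rn n) (F : Finset ℕ), (∀ i ∈ F, y ∈ ball (x i) (15 * r i)) → F.card ≤ 22 ^ n := by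
  have hne : (Ωᶜ).Nonempty := by
    rw [Set.nonempty_compl]
    rintro rfl
    exact hvol (measure_univ_of_isAddLeftInvariant _)
  have hcl : IsClosed Ωᶜ := hΩ.isClosed_compl
  set δ : Rn n → ℝ := fun x => infDist x Ωᶜ with hδ
  have hδpos : ∀ x ∈ Ω, 0 < δ x := fun x hx =>
    (hcl.notMem_iff_infDist_pos hne).1 (by simpa using hx)
  have hδball : ∀ x, ball x (δ x) ⊆ Ω := by
    intro x y hy
    by_contra hyΩ
    have := infDist_le_dist_of_mem (x := x) (s := Ωᶜ) hyΩ
    rw [mem_ball, dist_comm] at hy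
    exact absurd hy (not_lt.2 this)
  obtain ⟨R, hR⟩ := exists_radius_bound (n := n) hvol
  have hbd : ∀ x ∈ Ω, δ x / 100 ≤ R / 100 := fun x _ => by
    have := hR x (δ x) (measure_mono (hδball x)); linarith
  -- The radius is a hundredth of the distance δ to the complement. This leaves room for the dilates
  -- by 15 and 30 needed by the replacement of the bad pieces.
  obtain ⟨u, hut, hdisj, hu⟩ := Vitali.exists_disjoint_subfamily_covering_enlargement_ball Ω
    (fun p => p) (fun p => δ p / 100) (R / 100) hbd 5 (by norm_num)
  have hcount : u.Countable := hdisj.countable_of_isOpen (fun _ _ => isOpen_ball)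
    fun p hp => nonempty_ball.2 (by have := hδpos p (hut hp); positivity)
  have := hcount.to_subtype
  let _ := Encodable.ofCountable u
  -- Indices that code no ball of the family get radius 0, hence an empty ball.
  let x : ℕ → Rn n := fun i => (Encodable.decode₂ u i).elim 0 (fun a => a.1)
  let r : ℕ → ℝ := fun i => (Encodable.decode₂ u i).elim 0 (fun a => δ a.1 / 100)
  have key : ∀ i, 0 < r i → ∃ a : u, Encodable.encode a = i ∧ x i = a.1 ∧ r i = δ a.1 / 100 := by
    intro i hi
    rcases h : Encodable.decode₂ u i with _ | a
    · simp [r, h] at hi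
    · exact ⟨a, Encodable.mem_decode₂.1 h, by simp [x, h], by simp [r, h]⟩
  have key' : ∀ a : u, x (Encodable.encode a) = a.1 ∧ r (Encodable.encode a) = δ a.1 / 100 := by
    intro a
    have h : Encodable.decode₂ u (Encodable.encode a) = some a := Encodable.mem_decode₂.2 rfl
    exact ⟨by simp [x, h], by simp [r, h]⟩
  refine ⟨x, r, ?_, ?_, ?_, ?_, ?_⟩
  · intro i
    rcases h : Encodable.decode₂ u i with _ | a
    · simp [r, h]
    · have := (hδpos a (hut a.2)).le
      simp only [r, h, Option.elim]; positivity
  · intro i hi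
    obtain ⟨a, -, hx, hr⟩ := key i hi
    rw [hx, hr, mul_div_cancel₀ _ (by norm_num)]
    exact hδball a
  · intro i hi
    obtain ⟨a, -, hx, hr⟩ := key i hi
    obtain ⟨z, hz, hz'⟩ := hcl.exists_infDist_eq_dist hne a.1
    refine ⟨z, hz, ?_⟩
    rw [hx, hr, mul_div_cancel₀ _ (by norm_num), dist_comm, ← hz']
  · intro y hy
    obtain ⟨b, hb, hyb⟩ := hu y hy
    refine Set.mem_iUnion.2 ⟨Encodable.encode (⟨b, hb⟩ : u), ?_⟩
    rw [(key' ⟨b, hb⟩).1, (key' ⟨b, hb⟩).2]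
    exact hyb (mem_ball_self (by have := hδpos y hy; positivity))
  · intro y F hF
    have hrpos : ∀ i ∈ F, 0 < r i := fun i hi => by
      have := pos_of_mem_ball (hF i hi); linarith
    -- Since δ is 1-Lipschitz and equals 100 r_i at x_i, all balls whose 15-fold dilate contains y
    -- have radius comparable to δ(y).
    have hlip : ∀ i ∈ F, 85 * r i ≤ δ y ∧ δ y ≤ 115 * r i := by
      intro i hi
      obtain ⟨a, -, hx, hr⟩ := key i (hrpos i hi)
      have h1 := mem_ball.1 (hF i hi)
      have h2 : δ (x i) ≤ δ y + dist (x i) y := infDist_le_infDist_add_dist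
      have h3 : δ y ≤ δ (x i) + dist y (x i) := infDist_le_infDist_add_dist
      rw [dist_comm] at h2
      rw [hx] at h1 h2 h3
      constructor <;> linarith
    rcases F.eq_empty_or_nonempty with rfl | ⟨i₀, hi₀⟩
    · simp
    have hδy : 0 < δ y := by have := (hlip i₀ hi₀).1; have := hrpos i₀ hi₀; linarith
    have hd : (F : Set ℕ).PairwiseDisjoint fun i => ball (x i) (r i) := by
      intro i hi j hj hij
      obtain ⟨a, ha, hx, hr⟩ := key i (hrpos i hi)
      obtain ⟨b, hb, hx', hr'⟩ := key j (hrpos j hj)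
      simp only [Function.onFun, hx, hr, hx', hr']
      refine hdisj a.2 b.2 fun h => hij ?_
      rw [← ha, ← hb, Subtype.ext h]
    have hsub : (⋃ i ∈ F, ball (x i) (r i)) ⊆ ball y (16 * (δ y / 85)) := by
      refine Set.iUnion₂_subset fun i hi => ball_subset_ball' ?_
      have h1 := mem_ball.1 (hF i hi)
      have := (hlip i hi).1
      rw [dist_comm] at h1
      linarith
    have hm : (F.card : ℝ≥0∞) * ENNReal.ofReal ((δ y / 115) ^ n) ≤
        ENNReal.ofReal ((16 * (δ y / 85)) ^ n) := by
      rw [← ENNReal.mul_le_mul_iff_left (unitVol_pos (n := n)) unitVol_ne_top,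
        ← volume_ball_eq y (by positivity), mul_assoc, ← volume_ball_eq y (by positivity)]
      calc (F.card : ℝ≥0∞) * volume (ball y (δ y / 115))
          = ∑ i ∈ F, volume (ball y (δ y / 115)) := by simp
        _ ≤ ∑ i ∈ F, volume (ball (x i) (r i)) := by
            refine Finset.sum_le_sum fun i hi => ?_
            rw [volume_ball_eq y (by positivity), volume_ball_eq _ (hrpos i hi).le]
            have := (hlip i hi).2
            gcongr
            linarith
        _ = volume (⋃ i ∈ F, ball (x i) (r i)) :=
            (measure_biUnion_finset hd fun _ _ => measurableSet_ball).symm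
        _ ≤ _ := measure_mono hsub
    rw [← ENNReal.ofReal_natCast, ← ENNReal.ofReal_mul (by positivity),
      ENNReal.ofReal_le_ofReal_iff (by positivity)] at hm
    -- The disjoint balls have radius at least δ(y)/115 and lie in a ball about y of radius 16
    -- δ(y)/85, where 16 = 15 + 1. The ratio 16 · 115 / 85 is below 22.
    have h4 : (16 * (δ y / 85)) ^ n ≤ 22 ^ n * (δ y / 115) ^ n := by
      rw [← mul_pow]; exact pow_le_pow_left₀ (by positivity) (by linarith) _
    have h5 : (F.card : ℝ) ≤ 22 ^ n :=
      le_of_mul_le_mul_right (hm.trans h4) (by positivity)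
    exact_mod_cast h5

end Balls

/-! ### Spans of exponentials -/

section ExpSpan

variable {n N : ℕ}

theorem continuous_character (ξ : Rn n) : Continuous (character ξ) := by
  unfold character; fun_prop

theorem norm_character (ξ x : Rn n) : ‖character ξ x‖ = 1 := by
  rw [character, mul_comm]; exact Complex.norm_exp_ofReal_mul_I _

theorem character_add (ξ x y : Rn n) : character ξ (x + y) = character ξ x * character ξ y := by
  rw [character, character, character, ← Complex.exp_add, inner_add_right]
  push_cast; ring_nf

theorem character_neg (ξ x : Rn n) : character ξ (-x) = (starRingEnd ℂ) (character ξ x) := by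
  rw [character, character, ← Complex.exp_conj]
  simp

theorem character_mem_expSpan (Θ : Fin N → Rn n) (j : Fin N) : character (Θ j) ∈ expSpan Θ :=
  Submodule.subset_span ⟨j, rfl⟩

theorem continuous_of_mem_expSpan {Θ : Fin N → Rn n} {φ : Rn n → ℂ} (hφ : φ ∈ expSpan Θ) :
    Continuous φ := by
  induction hφ using Submodule.span_induction with
  | mem x hx => obtain ⟨j, rfl⟩ := hx; exact continuous_character _
  | zero => exact continuous_const
  | add x y _ _ hx hy => exact hx.add hy
  | smul a x _ hx => exact hx.const_smul a

/-- A translation multiplies each exponential by a constant. This invariance carries the evaluation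
bound from one point of a ball to all its points. -/
theorem translate_mem_expSpan {Θ : Fin N → Rn n} {φ : Rn n → ℂ} (hφ : φ ∈ expSpan Θ) (a : Rn n) :
    (fun x => φ (x + a)) ∈ expSpan Θ := by
  induction hφ using Submodule.span_induction with
  | mem x hx =>
    obtain ⟨j, rfl⟩ := hx
    have : (fun x => character (Θ j) (x + a)) = character (Θ j) a • character (Θ j) := by
      ext x; simp [character_add, mul_comm]
    rw [this]
    exact Submodule.smul_mem _ _ (character_mem_expSpan Θ j)
  | zero => exact Submodule.zero_mem _
  | add x y _ _ hx hy => exact Submodule.add_mem _ hx hy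
  | smul b x _ hx => exact Submodule.smul_mem _ b hx

theorem memLp_of_mem_expSpan {Θ : Fin N → Rn n} {φ : Rn n → ℂ} (hφ : φ ∈ expSpan Θ) (p : ℝ≥0∞)
    (c : Rn n) (r : ℝ) : MemLp φ p (volume.restrict (ball c r)) := by
  have hc := continuous_of_mem_expSpan hφ
  have : IsFiniteMeasure (volume.restrict (ball c r)) :=
    isFiniteMeasure_restrict.2 (volume_ball_ne_top c r)
  obtain ⟨M, hM⟩ := (isCompact_closedBall c r).exists_bound_of_continuousOn hc.continuousOn
  refine MemLp.of_bound hc.aestronglyMeasurable M ?_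
  filter_upwards [ae_restrict_mem measurableSet_ball] with x hx
  exact hM x (ball_subset_closedBall hx)

/-- Restriction of exponential sums to a ball, as elements of `L²`. -/
noncomputable def restrictL2 (Θ : Fin N → Rn n) (c : Rn n) (r : ℝ) :
    expSpan Θ →ₗ[ℂ] Lp ℂ 2 (volume.restrict (ball c r)) where
  toFun φ := (memLp_of_mem_expSpan φ.2 2 c r).toLp φ.1
  map_add' _ _ := rfl
  map_smul' _ _ := rfl

theorem coeFn_restrictL2 (Θ : Fin N → Rn n) (c : Rn n) (r : ℝ) (φ : expSpan Θ) :
    restrictL2 Θ c r φ =ᵐ[volume.restrict (ball c r)] φ.1 :=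
  (memLp_of_mem_expSpan φ.2 2 c r).coeFn_toLp

instance (Θ : Fin N → Rn n) : FiniteDimensional ℂ (expSpan Θ) :=
  FiniteDimensional.span_of_finite ℂ (Set.finite_range _)

theorem finrank_expSpan_le (Θ : Fin N → Rn n) : Module.finrank ℂ (expSpan Θ) ≤ N :=
  (finrank_range_le_card (R := ℂ) (fun j => character (Θ j))).trans (by simp)

theorem eLpNorm_two_sq {α : Type*} [MeasurableSpace α] (f : α → ℂ) (μ : Measure α) :
    eLpNorm f 2 μ ^ 2 = ∫⁻ x, ‖f x‖ₑ ^ 2 ∂μ := by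
  simpa using eLpNorm_nnreal_pow_eq_lintegral (f := f) (μ := μ) (p := 2) two_ne_zero

theorem enorm_sq_eq_lintegral {α : Type*} [MeasurableSpace α] {μ : Measure α} (g : Lp ℂ 2 μ) :
    ‖g‖ₑ ^ 2 = ∫⁻ x, ‖g x‖ₑ ^ 2 ∂μ := by
  rw [Lp.enorm_def, eLpNorm_two_sq]

theorem enorm_restrictL2_sq (Θ : Fin N → Rn n) (c : Rn n) (r : ℝ) (φ : expSpan Θ) :
    ‖restrictL2 Θ c r φ‖ₑ ^ 2 = ∫⁻ x in ball c r, ‖φ.1 x‖ₑ ^ 2 := by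
  rw [enorm_sq_eq_lintegral]
  refine lintegral_congr_ae ?_
  filter_upwards [coeFn_restrictL2 Θ c r φ] with x hx
  rw [hx]

/-- A linear map with finite dimensional source has an orthonormal basis of its range. -/
theorem exists_orthonormal_range {V H : Type*} [AddCommGroup V] [Module ℂ V]
    [FiniteDimensional ℂ V] [NormedAddCommGroup H] [InnerProductSpace ℂ H] (L : V →ₗ[ℂ] H) :
    ∃ (d : ℕ) (φ : Fin d → V), d ≤ Module.finrank ℂ V ∧ (∀ k, ‖L (φ k)‖ = 1) ∧
      ∀ v, ∃ a : Fin d → ℂ, L v = L (∑ k, a k • φ k) ∧ ∑ k, ‖a k‖ ^ 2 = ‖L v‖ ^ 2 := by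
  -- The basis is taken in the range and lifted, so the injectivity of L, here that of restriction
  -- to a ball, is never needed.
  let b := stdOrthonormalBasis ℂ (LinearMap.range L)
  choose φ hφ using fun k => (b k).2
  refine ⟨_, φ, LinearMap.finrank_range_le L, fun k => ?_, fun v => ?_⟩
  · rw [hφ k]; exact b.norm_eq_one k
  · let w : LinearMap.range L := ⟨L v, ⟨v, rfl⟩⟩
    refine ⟨fun k => inner ℂ (b k) w, ?_, b.sum_sq_norm_inner_right w⟩
    have h1 := congrArg (LinearMap.range L).subtype (b.sum_repr' w)
    rw [map_sum] at h1
    rw [map_sum]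
    refine h1.symm.trans (Finset.sum_congr rfl fun k _ => ?_)
    rw [map_smul, map_smul, hφ k]
    rfl

/-- At some point of a ball, the evaluation of exponential sums is bounded with the optimal
constant. -/
theorem exists_point_evaluation_le (Θ : Fin N → Rn n) (c : Rn n) {r : ℝ} (hr : 0 < r) :
    ∃ x₀ ∈ ball c r, ∀ ψ ∈ expSpan Θ,
      ‖ψ x₀‖ₑ ^ 2 * volume (ball c r) ≤ N * ∫⁻ y in ball c r, ‖ψ y‖ₑ ^ 2 := by
  obtain ⟨d, φ, hd, hφ, hspan⟩ := exists_orthonormal_range (restrictL2 Θ c r)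
  have hK : ∫⁻ x in ball c r, ∑ k, ‖(φ k).1 x‖ₑ ^ 2 ≤ N := by
    rw [lintegral_finsetSum' _ fun k _ => by
      have := (continuous_of_mem_expSpan (φ k).2).measurable; fun_prop]
    calc _ = ∑ k : Fin d, (1 : ℝ≥0∞) := by
          refine Finset.sum_congr rfl fun k _ => ?_
          rw [← enorm_restrictL2_sq, ← ofReal_norm, hφ k]; simp
      _ ≤ N := by simpa using hd.trans (finrank_expSpan_le Θ)
  -- The sum of |φ_k|² is the diagonal of the reproducing kernel. Its integral is the dimension of
  -- the range, at most N, so at some point it is at most N / |B|.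
  obtain ⟨x₀, hx₀, hle⟩ := exists_le_setLAverage (μ := volume) (volume_ball_ne_zero c hr)
    (volume_ball_ne_top c r) (f := fun x => ∑ k, ‖(φ k).1 x‖ₑ ^ 2) (by
      refine (Finset.measurable_fun_sum _ fun k _ => ?_).aemeasurable
      have := (continuous_of_mem_expSpan (φ k).2).measurable; fun_prop)
  have hle' : (∑ k, ‖(φ k).1 x₀‖ₑ ^ 2) * volume (ball c r) ≤ N := by
    rw [setLAverage_eq] at hle
    exact (ENNReal.le_div_iff_mul_le (Or.inl (volume_ball_ne_zero c hr))
      (Or.inl (volume_ball_ne_top c r))).1 hle |>.trans hK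
  refine ⟨x₀, hx₀, fun ψ hψ => ?_⟩
  obtain ⟨a, e, ha'⟩ := hspan ⟨ψ, hψ⟩
  -- The expansion in the basis holds almost everywhere on the ball; continuity of both sides makes
  -- it valid at x₀ itself.
  have heq : ψ x₀ = ∑ k, a k * (φ k).1 x₀ := by
    have h2 := coeFn_restrictL2 Θ c r (∑ k, a k • φ k)
    rw [← e] at h2
    have h1 := Measure.eqOn_open_of_ae_eq
      ((coeFn_restrictL2 Θ c r ⟨ψ, hψ⟩).symm.trans h2) isOpen_ball
      (continuous_of_mem_expSpan hψ).continuousOn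
      (continuous_of_mem_expSpan (Subtype.property _)).continuousOn hx₀
    have h3 : ((∑ k, a k • φ k : expSpan Θ) : Rn n → ℂ) = ∑ k, a k • (φ k).1 := by
      rw [AddSubmonoidClass.coe_finsetSum]; rfl
    refine h1.trans ?_
    rw [h3, Finset.sum_apply]
    rfl
  have hcs : ‖ψ x₀‖ₑ ^ 2 ≤ (∑ k, ‖a k‖ₑ ^ 2) * ∑ k, ‖(φ k).1 x₀‖ₑ ^ 2 := by
    have h1 : ‖ψ x₀‖ ^ 2 ≤ (∑ k, ‖a k‖ ^ 2) * ∑ k, ‖(φ k).1 x₀‖ ^ 2 := by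
      rw [heq]
      refine le_trans ?_ (Finset.sum_mul_sq_le_sq_mul_sq _ _ _)
      gcongr
      exact (norm_sum_le _ _).trans (Finset.sum_le_sum fun k _ => (norm_mul _ _).le)
    simp only [← ofReal_norm, ← ENNReal.ofReal_pow (norm_nonneg _)]
    rw [← ENNReal.ofReal_sum_of_nonneg (fun _ _ => by positivity),
      ← ENNReal.ofReal_sum_of_nonneg (fun _ _ => by positivity),
      ← ENNReal.ofReal_mul (by positivity)]
    exact ENNReal.ofReal_le_ofReal h1
  have ha : ∑ k, ‖a k‖ₑ ^ 2 = ∫⁻ y in ball c r, ‖ψ y‖ₑ ^ 2 := by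
    rw [← enorm_restrictL2_sq Θ c r ⟨ψ, hψ⟩]
    simp only [← ofReal_norm, ← ENNReal.ofReal_pow (norm_nonneg _)]
    rw [← ENNReal.ofReal_sum_of_nonneg (fun _ _ => by positivity), ha']
  calc ‖ψ x₀‖ₑ ^ 2 * volume (ball c r)
      ≤ (∑ k, ‖a k‖ₑ ^ 2) * ((∑ k, ‖(φ k).1 x₀‖ₑ ^ 2) * volume (ball c r)) := by
        rw [← mul_assoc]; gcongr
    _ ≤ (∑ k, ‖a k‖ₑ ^ 2) * N := by gcongr
    _ = _ := by rw [ha, mul_comm]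

/-- A Nikolskii inequality for sums of `N` exponentials, with constant `√N`. -/
theorem enorm_sq_mul_volume_le {Θ : Fin N → Rn n} {φ : Rn n → ℂ} (hφ : φ ∈ expSpan Θ)
    {c x : Rn n} {r : ℝ} (hx : x ∈ ball c r) :
    ‖φ x‖ₑ ^ 2 * volume (ball c r) ≤ N * ∫⁻ y in ball c (3 * r), ‖φ y‖ₑ ^ 2 := by
  obtain ⟨x₀, hx₀, h⟩ := exists_point_evaluation_le Θ c (pos_of_mem_ball hx)
  -- The translate of φ by x - x₀ takes at x₀ the value φ(x), and its integral is over a ball moved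
  -- by less than 2r, which stays inside the triple ball.
  have h1 := h _ (translate_mem_expSpan hφ (x - x₀))
  simp only [add_sub_cancel] at h1
  refine h1.trans (mul_le_mul_right ?_ _)
  have h2 : ∫⁻ y in ball c r, ‖φ (y + (x - x₀))‖ₑ ^ 2 =
      ∫⁻ y in ball (c + (x - x₀)) r, ‖φ y‖ₑ ^ 2 := by
    rw [← (measurePreserving_add_right volume (x - x₀)).setLIntegral_comp_preimage
      (s := ball (c + (x - x₀)) r) (f := fun y => ‖φ y‖ₑ ^ 2)
      measurableSet_ball (by have := (continuous_of_mem_expSpan hφ).measurable; fun_prop)]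
    congr 2
    ext y; simp [mem_ball, dist_eq_norm]
  rw [h2]
  refine lintegral_mono_set (ball_subset_ball' ?_)
  have h3 : dist (c + (x - x₀)) c = dist x x₀ := by simp [dist_eq_norm]
  have h4 := dist_triangle_right x x₀ c
  have h5 := mem_ball.1 hx
  have h6 := mem_ball.1 hx₀
  rw [h3]; linarith

/-- A function supported in a ball coincides, as a functional on exponential sums, with an
exponential sum on the triple ball whose `L²` norm is controlled by the `L¹` norm. -/
theorem exists_expSpan_orthogonal (Θ : Fin N → Rn n) {c : Rn n} {r : ℝ} (hr : 0 < r)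
    {f : Rn n → ℂ} (hf : MemLp f 2 volume) (hsupp : ∀ y ∉ ball c r, f y = 0) :
    ∃ φ ∈ expSpan Θ,
      (∀ ψ ∈ expSpan Θ, ∫ y in ball c (3 * r), (starRingEnd ℂ) (ψ y) * (f y - φ y) = 0) ∧
      (∫⁻ y in ball c (3 * r), ‖φ y‖ₑ ^ 2) * volume (ball c r) ≤ N * (∫⁻ y, ‖f y‖ₑ) ^ 2 := by
  set W := LinearMap.range (restrictL2 Θ c (3 * r)) with hW
  have hf' : MemLp f 2 (volume.restrict (ball c (3 * r))) := hf.restrict _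
  set F := hf'.toLp f with hF
  obtain ⟨φ, hφ⟩ := (W.orthogonalProjectionOnto F).2
  have horth : ∀ ψ ∈ expSpan Θ,
      ∫ y in ball c (3 * r), (starRingEnd ℂ) (ψ y) * (f y - φ.1 y) = 0 := by
    intro ψ hψ
    have h1 : inner ℂ (restrictL2 Θ c (3 * r) ⟨ψ, hψ⟩) (F - restrictL2 Θ c (3 * r) φ) = 0 := by
      rw [hφ]
      exact Submodule.inner_right_of_mem_orthogonal (K := W) ⟨_, rfl⟩
        (Submodule.sub_starProjection_mem_orthogonal F)
    rw [L2.inner_def] at h1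
    rw [← h1]
    refine integral_congr_ae ?_
    filter_upwards [coeFn_restrictL2 Θ c (3 * r) ⟨ψ, hψ⟩, coeFn_restrictL2 Θ c (3 * r) φ,
      hf'.coeFn_toLp, Lp.coeFn_sub F (restrictL2 Θ c (3 * r) φ)] with y h2 h3 h4 h5
    rw [h2, h5, Pi.sub_apply, h3, hF, h4, RCLike.inner_apply, mul_comm]
  refine ⟨φ.1, φ.2, horth, ?_⟩
  set I := ∫⁻ y in ball c (3 * r), ‖φ.1 y‖ₑ ^ 2 with hI
  set V := volume (ball c r) with hV
  have hV0 : V ≠ 0 := volume_ball_ne_zero c hr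
  have hVt : V ≠ ∞ := volume_ball_ne_top c r
  have hIt : I ≠ ∞ := by
    rw [hI, ← enorm_restrictL2_sq]; simp
  have hpt : ∀ x ∈ ball c r, ‖φ.1 x‖ₑ ≤ (N * I / V) ^ (1 / 2 : ℝ) := by
    intro x hx
    have h := (ENNReal.le_div_iff_mul_le (Or.inl hV0) (Or.inl hVt)).2
      (enorm_sq_mul_volume_le φ.2 hx)
    calc ‖φ.1 x‖ₑ = (‖φ.1 x‖ₑ ^ 2) ^ (1 / 2 : ℝ) := by
          rw [← ENNReal.rpow_natCast, ← ENNReal.rpow_mul]; simp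
      _ ≤ _ := by gcongr
  -- By orthogonality ‖φ‖² is the pairing of φ with f, which only sees φ on the small ball where the
  -- Nikolskii bound applies. Squaring and dividing by I then gives the claim.
  have hle : I ≤ (N * I / V) ^ (1 / 2 : ℝ) * ∫⁻ y, ‖f y‖ₑ := by
    have h1 := horth φ.1 φ.2
    have hint1 : IntegrableOn (fun y => (starRingEnd ℂ) (φ.1 y) * f y) (ball c (3 * r)) :=
      MemLp.integrable_mul (memLp_of_mem_expSpan φ.2 2 c (3 * r)).star hf'
    have hint2 : IntegrableOn (fun y => (starRingEnd ℂ) (φ.1 y) * φ.1 y) (ball c (3 * r)) :=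
      MemLp.integrable_mul (memLp_of_mem_expSpan φ.2 2 c (3 * r)).star
        (memLp_of_mem_expSpan φ.2 2 c (3 * r))
    simp only [mul_sub] at h1
    rw [integral_sub hint1 hint2, sub_eq_zero] at h1
    have h2 : I = ‖∫ y in ball c (3 * r), (starRingEnd ℂ) (φ.1 y) * φ.1 y‖ₑ := by
      have h3 : ∫ y in ball c (3 * r), (starRingEnd ℂ) (φ.1 y) * φ.1 y =
          ((∫ y in ball c (3 * r), ‖φ.1 y‖ ^ 2 : ℝ) : ℂ) := by
        rw [← integral_complex_ofReal]
        refine integral_congr_ae (ae_of_all _ fun y => ?_)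
        simp [Complex.conj_mul']
      rw [h3, hI, ← ofReal_norm, Complex.norm_real, Real.norm_of_nonneg
        (integral_nonneg fun _ => by positivity), ofReal_integral_eq_lintegral_ofReal]
      · simp [ENNReal.ofReal_pow]
      · exact (memLp_of_mem_expSpan φ.2 2 c (3 * r)).integrable_norm_pow two_ne_zero
      · exact ae_of_all _ fun _ => by positivity
    refine (h2.trans (congrArg _ h1.symm)).le.trans ?_
    refine (enorm_integral_le_lintegral_enorm _).trans ?_
    rw [← lintegral_const_mul']
    · refine (setLIntegral_le_lintegral _ _).trans (lintegral_mono fun y => ?_)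
      by_cases hy : y ∈ ball c r
      · rw [enorm_mul, RCLike.enorm_conj]
        gcongr
        exact hpt y hy
      · simp [hsupp y hy]
    · exact ENNReal.rpow_ne_top_of_nonneg (by positivity)
        (ENNReal.div_ne_top (ENNReal.mul_ne_top (by simp) hIt) hV0)
  rcases eq_or_ne I 0 with h0 | h0
  · simp [h0]
  have hsq : I ^ 2 ≤ N * I / V * (∫⁻ y, ‖f y‖ₑ) ^ 2 := by
    calc I ^ 2 ≤ ((N * I / V) ^ (1 / 2 : ℝ) * ∫⁻ y, ‖f y‖ₑ) ^ 2 := by gcongr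
      _ = _ := by
        rw [mul_pow, ← ENNReal.rpow_natCast, ← ENNReal.rpow_mul]; simp
  rw [← ENNReal.mul_le_mul_iff_right h0 hIt]
  calc I * (I * V) = I ^ 2 * V := by ring
    _ ≤ N * I / V * (∫⁻ y, ‖f y‖ₑ) ^ 2 * V := by gcongr
    _ = (N * I / V * V) * (∫⁻ y, ‖f y‖ₑ) ^ 2 := by ring
    _ = _ := by rw [ENNReal.div_mul_cancel hV0 hVt]; ring

end ExpSpan

/-! ### Kernels -/

section Kernels

variable {n N : ℕ}

/-- The sum of the kernels `k j`, modulated at the frequencies `Θ j`. -/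
noncomputable def combinedKernel (Θ : Fin N → Rn n) (k : Fin N → Rn n × Rn n → ℂ) (x y : Rn n) :
    ℂ :=
  ∑ j, character (Θ j) (x - y) * k j (x, y)

/-- `T` is represented off the diagonal by the sum of the modulations at the frequencies `Θ` of
the standard kernels `k j`. -/
structure HasModulatedKernel (Θ : Fin N → Rn n) (A : ℝ) (T : L2 n →L[ℂ] L2 n)
    (k : Fin N → Rn n × Rn n → ℂ) : Prop where
  norm_le : ‖T‖ ≤ A
  differentiableAt : ∀ (j : Fin N) (x y : Rn n), x ≠ y → DifferentiableAt ℝ (k j) (x, y)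
  fderiv_le : ∀ x y : Rn n, x ≠ y → ∑ j, ‖fderiv ℝ (k j) (x, y)‖ ≤ A / ‖x - y‖ ^ (n + 1)
  off_diag : ∀ (f : Rn n → ℂ) (hf : MemLp f 2 volume), HasCompactSupport f →
    ∀ᵐ x ∂(volume : Measure (Rn n)), x ∉ tsupport f →
      T (hf.toLp f) x = ∫ y, combinedKernel Θ k x y * f y

theorem integrable_of_hasCompactSupport {f : Rn n → ℂ} (hf : MemLp f 2 volume)
    (hc : HasCompactSupport f) : Integrable f :=
  (integrableOn_iff_integrable_of_support_subset (subset_tsupport f)).1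
    ((hf.locallyIntegrable one_le_two).integrableOn_isCompact hc)

theorem integrable_mul_of_continuousOn {f g : Rn n → ℂ} (hf : MemLp f 2 volume)
    (hc : HasCompactSupport f) (hg : ContinuousOn g (tsupport f)) :
    Integrable fun y => g y * f y :=
  (integrableOn_iff_integrable_of_support_subset
    ((Function.support_mul_subset_right g f).trans (subset_tsupport f))).1
    (((hf.locallyIntegrable one_le_two).integrableOn_isCompact hc).continuousOn_mul hg hc)

theorem character_mul_demodulated (ξ : Rn n) (K : Rn n → Rn n → ℂ) (x y : Rn n) :
    character ξ (x - y) * demodulated ξ K (x, y) = K x y := by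
  rw [character, demodulated, ← mul_assoc, ← Complex.exp_add]
  simp

theorem coeFn_sum_aeEqFun {ι : Type*} (s : Finset ι) (F : ι → (Rn n →ₘ[volume] ℂ)) :
    ⇑(∑ j ∈ s, F j) =ᵐ[volume] fun x => ∑ j ∈ s, F j x := by
  classical
  induction s using Finset.induction_on with
  | empty =>
    rw [Finset.sum_empty]
    filter_upwards [AEEqFun.coeFn_zero (α := Rn n) (β := ℂ) (μ := volume)] with x hx
    simpa only [Finset.sum_empty, Pi.zero_apply] using hx
  | insert a s ha ih =>
    rw [Finset.sum_insert ha]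
    filter_upwards [AEEqFun.coeFn_add (F a) (∑ j ∈ s, F j), ih] with x h1 h2
    rw [h1, Pi.add_apply, h2, Finset.sum_insert ha]

/-- The pieces T_j need not be bounded, so they have no adjoints. Only the kernel of their sum is
retained, a form of the hypothesis that is stable under adjoints. -/
theorem IsCalderonZygmund.exists_hasModulatedKernel {Θ : Fin N → Rn n} {A : ℝ}
    {T : L2 n →L[ℂ] L2 n} (h : IsCalderonZygmund Θ A T) : ∃ k, HasModulatedKernel Θ A T k := by
  obtain ⟨hA, S, K, hS, hK, hd, hb⟩ := h
  refine ⟨fun j => demodulated (Θ j) (K j), hA, hd, hb, fun f hf hc => ?_⟩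
  have h1 : ∀ᵐ x, T (hf.toLp f) x = ∑ j, S j (hf.toLp f) x := by
    have := coeFn_sum_aeEqFun Finset.univ (fun j => S j (hf.toLp f))
    rw [← hS] at this
    exact this
  filter_upwards [h1, ae_all_iff.2 fun j => hK j f hf hc] with x h2 h3 hx
  simp only [combinedKernel, character_mul_demodulated, Finset.sum_mul]
  have hcont : ∀ j, ContinuousOn (K j x) (tsupport f) := by
    intro j y hy
    have hxy : x ≠ y := fun e => hx (e ▸ hy)
    have h4 : ContinuousAt (fun y => demodulated (Θ j) (K j) (x, y)) y :=
      (hd j x y hxy).continuousAt.comp (f := fun y => (x, y)) (by fun_prop)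
    have h5 : K j x = fun y => character (Θ j) (x - y) * demodulated (Θ j) (K j) (x, y) := by
      ext y; rw [character_mul_demodulated]
    rw [h5]
    exact (((continuous_character _).comp (continuous_const.sub continuous_id)).continuousAt.mul
      h4).continuousWithinAt
  rw [h2, integral_finsetSum _ fun j _ => integrable_mul_of_continuousOn hf hc (hcont j)]
  exact Finset.sum_congr rfl fun j _ => h3 j hx

/-- A function with zero integral on all compact subsets of an open set vanishes there. -/
theorem ae_eq_zero_of_setIntegral_isCompact {U : Set (Rn n)} (hU : IsOpen U) {f : Rn n → ℂ}
    (hf : ∀ F ⊆ U, IsCompact F → IntegrableOn f F ∧ ∫ x in F, f x = 0) :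
    ∀ᵐ x ∂(volume : Measure (Rn n)), x ∈ U → f x = 0 := by
  have hF : ∀ F ⊆ U, IsCompact F → ∀ᵐ x ∂volume.restrict F, f x = 0 := fun F hFU hF => by
    refine ae_eq_zero_of_forall_setIntegral_isCompact_eq_zero (hf F hFU hF).1 fun s hs => ?_
    rw [Measure.restrict_restrict' hF.measurableSet]
    exact (hf _ (Set.inter_subset_right.trans hFU) (hs.inter_right hF.isClosed)).2
  rw [ae_iff]
  refine measure_null_of_locally_null _ fun x hx => ?_
  simp only [Classical.not_imp, Set.mem_ofPred_eq] at hx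
  obtain ⟨ε, hε, hεU⟩ := Metric.nhds_basis_closedBall.mem_iff.1 (hU.mem_nhds hx.1)
  refine ⟨closedBall x ε ∩ {x | ¬(x ∈ U → f x = 0)}, ?_, ?_⟩
  · rw [Set.inter_comm]
    exact inter_mem self_mem_nhdsWithin (mem_nhdsWithin_of_mem_nhds (closedBall_mem_nhds x hε))
  · have h1 := hF _ hεU (isCompact_closedBall x ε)
    rw [ae_restrict_iff' measurableSet_closedBall, ae_iff] at h1
    refine measure_mono_null ?_ h1
    rintro y ⟨hy, hy'⟩
    simp only [Classical.not_imp, Set.mem_ofPred_eq] at hy' ⊢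
    exact ⟨hy, hy'.2⟩

namespace HasModulatedKernel

variable {Θ : Fin N → Rn n} {A : ℝ} {T : L2 n →L[ℂ] L2 n} {k : Fin N → Rn n × Rn n → ℂ}

theorem nonneg (h : HasModulatedKernel Θ A T k) : 0 ≤ A := (norm_nonneg _).trans h.norm_le

/-- The mean value inequality is applied to the whole sum Σ a_j k_j at once. The gradient bound is
summed over j, so no power of N is lost. -/
theorem norm_sum_sub_le (h : HasModulatedKernel Θ A T k) {a : Fin N → ℂ} (ha : ∀ j, ‖a j‖ ≤ 1)
    {z z' : Rn n × Rn n} {d : ℝ} (hd : 0 < d) (hz : ∀ w ∈ segment ℝ z' z, d ≤ ‖w.1 - w.2‖) :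
    ‖∑ j, a j * (k j z - k j z')‖ ≤ A / d ^ (n + 1) * ‖z - z'‖ := by
  have hne : ∀ w ∈ segment ℝ z' z, w.1 ≠ w.2 := fun w hw e => by
    have := hz w hw; rw [e, sub_self, norm_zero] at this; linarith
  have hdf : ∀ w ∈ segment ℝ z' z, ∀ j, DifferentiableAt ℝ (k j) w := fun w hw j =>
    h.differentiableAt j w.1 w.2 (hne w hw)
  have hF : ∀ w ∈ segment ℝ z' z, HasFDerivAt (fun w => ∑ j, a j * k j w)
      (∑ j, a j • fderiv ℝ (k j) w) w := fun w hw =>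
    HasFDerivAt.fun_sum fun j _ => (hdf w hw j).hasFDerivAt.const_mul (a j)
  have key := (convex_segment (𝕜 := ℝ) z' z).norm_image_sub_le_of_norm_hasFDerivWithin_le
    (fun w hw => (hF w hw).hasFDerivWithinAt) (C := A / d ^ (n + 1)) (fun w hw => ?_)
    (left_mem_segment ℝ z' z) (right_mem_segment ℝ z' z)
  · simpa only [mul_sub, Finset.sum_sub_distrib] using key
  · calc ‖∑ j, a j • fderiv ℝ (k j) w‖ ≤ ∑ j, ‖fderiv ℝ (k j) w‖ := by
          refine (norm_sum_le _ _).trans (Finset.sum_le_sum fun j _ => ?_)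
          rw [norm_smul]
          exact mul_le_of_le_one_left (norm_nonneg _) (ha j)
      _ ≤ A / ‖w.1 - w.2‖ ^ (n + 1) := h.fderiv_le w.1 w.2 (hne w hw)
      _ ≤ A / d ^ (n + 1) := by
          have := h.nonneg
          have := hz w hw
          gcongr

/-- Smoothness of the demodulated kernels in the first variable. -/
theorem norm_sum_sub_fst_le (h : HasModulatedKernel Θ A T k) {a : Fin N → ℂ}
    (ha : ∀ j, ‖a j‖ ≤ 1) {x c y : Rn n} {ρ : ℝ} (hρ : 0 < ρ) (hx : dist x c ≤ ρ)
    (hy : 2 * ρ ≤ dist y c) :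
    ‖∑ j, a j * (k j (x, y) - k j (c, y))‖ ≤ A * 2 ^ (n + 1) * (ρ / dist y c ^ (n + 1)) := by
  have hd : 0 < dist y c := by linarith
  -- The first coordinate moves by at most ρ ≤ |y - c| / 2, so the segment stays at distance at
  -- least |y - c| / 2 from the diagonal.
  refine (h.norm_sum_sub_le ha (d := dist y c / 2) (by positivity) fun w hw => ?_).trans ?_
  · obtain ⟨t, s, ht, hs, hts, rfl⟩ := hw
    have e : (t • (c, y) + s • (x, y)).1 - (t • (c, y) + s • (x, y)).2 =
        (c - y) + s • (x - c) := by
      have : t = 1 - s := by linarith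
      subst this
      simp only [Prod.smul_mk, Prod.mk_add_mk]
      module
    rw [e]
    have h1 : ‖s • (x - c)‖ ≤ ρ := by
      rw [norm_smul, ← dist_eq_norm, Real.norm_of_nonneg hs]
      nlinarith [dist_nonneg (x := x) (y := c)]
    have h2 := norm_sub_le_norm_add (c - y) (s • (x - c))
    rw [← dist_eq_norm, dist_comm] at h2
    linarith
  · have h3 : ‖(x, y) - (c, y)‖ ≤ ρ := by
      simp only [Prod.mk_sub_mk, sub_self, Prod.norm_mk, norm_zero]
      rw [← dist_eq_norm]
      exact max_le hx hρ.le
    have := h.nonneg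
    calc A / (dist y c / 2) ^ (n + 1) * ‖(x, y) - (c, y)‖ ≤ A / (dist y c / 2) ^ (n + 1) * ρ := by
          gcongr
      _ = _ := by rw [div_pow]; field_simp

/-- Smoothness of the demodulated kernels in the second variable. -/
theorem norm_sum_sub_snd_le (h : HasModulatedKernel Θ A T k) {a : Fin N → ℂ}
    (ha : ∀ j, ‖a j‖ ≤ 1) {x c y : Rn n} {ρ : ℝ} (hρ : 0 < ρ) (hy : dist y c ≤ ρ)
    (hx : 2 * ρ ≤ dist x c) :
    ‖∑ j, a j * (k j (x, y) - k j (x, c))‖ ≤ A * 2 ^ (n + 1) * (ρ / dist x c ^ (n + 1)) := by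
  have hd : 0 < dist x c := by linarith
  refine (h.norm_sum_sub_le ha (d := dist x c / 2) (by positivity) fun w hw => ?_).trans ?_
  · obtain ⟨t, s, ht, hs, hts, rfl⟩ := hw
    have e : (t • (x, c) + s • (x, y)).1 - (t • (x, c) + s • (x, y)).2 =
        (x - c) - s • (y - c) := by
      have : t = 1 - s := by linarith
      subst this
      simp only [Prod.smul_mk, Prod.mk_add_mk]
      module
    rw [e]
    have h1 : ‖s • (y - c)‖ ≤ ρ := by
      rw [norm_smul, ← dist_eq_norm, Real.norm_of_nonneg hs]
      nlinarith [dist_nonneg (x := y) (y := c)]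
    have h2 := norm_sub_norm_le (x - c) (s • (y - c))
    rw [← dist_eq_norm] at h2
    linarith
  · have h3 : ‖(x, y) - (x, c)‖ ≤ ρ := by
      simp only [Prod.mk_sub_mk, sub_self, Prod.norm_mk, norm_zero]
      rw [← dist_eq_norm]
      exact max_le hρ.le hy
    have := h.nonneg
    calc A / (dist x c / 2) ^ (n + 1) * ‖(x, y) - (x, c)‖ ≤ A / (dist x c / 2) ^ (n + 1) * ρ := by
          gcongr
      _ = _ := by rw [div_pow]; field_simp

theorem continuousAt_combinedKernel (h : HasModulatedKernel Θ A T k) {z : Rn n × Rn n}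
    (hz : z.1 ≠ z.2) : ContinuousAt (fun z : Rn n × Rn n => combinedKernel Θ k z.1 z.2) z := by
  unfold combinedKernel
  refine tendsto_finsetSum _ fun j _ => ContinuousAt.mul ?_ ?_
  · exact ((continuous_character _).comp (continuous_fst.sub continuous_snd)).continuousAt
  · exact (h.differentiableAt j z.1 z.2 hz).continuousAt

theorem enorm_apply_le (h : HasModulatedKernel Θ A T k) (f : L2 n) :
    eLpNorm (T f) 2 volume ≤ ENNReal.ofReal A * eLpNorm f 2 volume := by
  rw [← Lp.enorm_def, ← Lp.enorm_def, ← ofReal_norm, ← ofReal_norm,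
    ← ENNReal.ofReal_mul h.nonneg]
  exact ENNReal.ofReal_le_ofReal (T.le_of_opNorm_le h.norm_le f)

/-- The adjoint of an operator with a modulated kernel. -/
theorem adjoint (h : HasModulatedKernel Θ A T k) :
    HasModulatedKernel Θ A (ContinuousLinearMap.adjoint T)
      (fun j z => (starRingEnd ℂ) (k j z.swap)) := by
  have hK : ∀ x y, combinedKernel Θ (fun j z => (starRingEnd ℂ) (k j z.swap)) x y =
      (starRingEnd ℂ) (combinedKernel Θ k y x) := by
    intro x y
    simp only [combinedKernel, map_sum, map_mul, Prod.swap_prod_mk]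
    refine Finset.sum_congr rfl fun j _ => ?_
    rw [← character_neg, neg_sub]
  have hfd : ∀ (j : Fin N) (x y : Rn n), x ≠ y →
      HasFDerivAt (fun z => (starRingEnd ℂ) (k j z.swap))
        ((Complex.conjCLE : ℂ →L[ℝ] ℂ).comp ((fderiv ℝ (k j) (y, x)).comp
          (ContinuousLinearEquiv.prodComm ℝ (Rn n) (Rn n) : Rn n × Rn n →L[ℝ] Rn n × Rn n)))
        (x, y) := by
    intro j x y hxy
    have h1 : HasFDerivAt (Prod.swap : Rn n × Rn n → Rn n × Rn n)
        (ContinuousLinearEquiv.prodComm ℝ (Rn n) (Rn n) : Rn n × Rn n →L[ℝ] Rn n × Rn n) (x, y) :=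
      (ContinuousLinearEquiv.prodComm ℝ (Rn n) (Rn n)).hasFDerivAt
    have h2 : HasFDerivAt (k j) (fderiv ℝ (k j) (y, x)) (Prod.swap (x, y)) :=
      (h.differentiableAt j y x hxy.symm).hasFDerivAt
    exact Complex.conjCLE.hasFDerivAt.comp _ (h2.comp _ h1)
  refine ⟨?_, fun j x y hxy => (hfd j x y hxy).differentiableAt, fun x y hxy => ?_, ?_⟩
  · rw [LinearIsometryEquiv.norm_map]; exact h.norm_le
  · rw [norm_sub_rev]
    refine le_trans (Finset.sum_le_sum fun j _ => ?_) (h.fderiv_le y x hxy.symm)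
    rw [(hfd j x y hxy).fderiv]
    -- Exchanging the two variables is an isometry for the sup norm of the product, so the gradient
    -- bound keeps its constant.
    refine ContinuousLinearMap.opNorm_le_bound _ (norm_nonneg _) fun v => ?_
    have e : ‖v.swap‖ = ‖v‖ := by
      rw [Prod.norm_def, Prod.norm_def, max_comm]; rfl
    rw [← e]
    calc _ = ‖fderiv ℝ (k j) (y, x) v.swap‖ := by
          simp [Prod.swap]
      _ ≤ _ := ContinuousLinearMap.le_opNorm _ _
  · intro g hg hc
    simp only [hK]
    set S := tsupport g with hS
    set H : Rn n → ℂ := fun x => ∫ y, (starRingEnd ℂ) (combinedKernel Θ k y x) * g y with hH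
    have hSm : MeasurableSet S := (isClosed_tsupport g).measurableSet
    have hgint := integrable_of_hasCompactSupport hg hc
    have hHS : ∀ x, H x = ∫ y in S, (starRingEnd ℂ) (combinedKernel Θ k y x) * g y := fun x =>
      (setIntegral_eq_integral_of_forall_compl_eq_zero fun y hy => by
        rw [image_eq_zero_of_notMem_tsupport hy, mul_zero]).symm
    have hint : ∀ F ⊆ Sᶜ, IsCompact F →
        Integrable (fun z : Rn n × Rn n => (starRingEnd ℂ) (combinedKernel Θ k z.2 z.1) * g z.2)
          ((volume.restrict F).prod (volume.restrict S)) := by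
      intro F hF hFc
      have : IsFiniteMeasure (volume.restrict F) := isFiniteMeasure_restrict.2 hFc.measure_ne_top
      have h1 : IntegrableOn (fun z : Rn n × Rn n => g z.2) (F ×ˢ S) (volume.prod volume) := by
        rw [IntegrableOn, ← Measure.prod_restrict]
        exact hgint.restrict.comp_snd _
      have h2 : ContinuousOn
          (fun z : Rn n × Rn n => (starRingEnd ℂ) (combinedKernel Θ k z.2 z.1)) (F ×ˢ S) := by
        intro z hz
        have hne : z.2 ≠ z.1 := fun e => hF hz.1 (e ▸ hz.2)
        have h3 := h.continuousAt_combinedKernel (z := z.swap) hne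
        exact (Complex.continuous_conj.continuousAt.comp
          (h3.comp (f := Prod.swap) continuous_swap.continuousAt)).continuousWithinAt
      rw [Measure.prod_restrict]
      exact h1.continuousOn_mul h2 (hFc.prod hc)
    have hHint : ∀ F ⊆ Sᶜ, IsCompact F → IntegrableOn H F := by
      intro F hF hFc
      rw [show H = fun x => ∫ y in S, (starRingEnd ℂ) (combinedKernel Θ k y x) * g y from
        funext hHS]
      exact (hint F hF hFc).integral_prod_left
    have hTint : ∀ F, IsCompact F →
        IntegrableOn (ContinuousLinearMap.adjoint T (hg.toLp g)) F := fun F hFc =>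
      ((Lp.memLp _).locallyIntegrable one_le_two).integrableOn_isCompact hFc
    -- The adjoint is tested on indicators of compact sets off the support of g: the representation
    -- of T on these indicators and Fubini identify its integrals with those of the conjugate
    -- transposed kernel.
    have key : ∀ F ⊆ Sᶜ, IsCompact F →
        ∫ x in F, ContinuousLinearMap.adjoint T (hg.toLp g) x = ∫ x in F, H x := by
      intro F hF hFc
      have hm := hFc.measurableSet
      have hsupp : tsupport (F.indicator fun _ => (1 : ℂ)) ⊆ F :=
        closure_minimal Set.support_indicator_subset hFc.isClosed
      have hcF : HasCompactSupport (F.indicator fun _ => (1 : ℂ)) :=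
        hFc.of_isClosed_subset (isClosed_tsupport _) hsupp
      have hT := h.off_diag _ (memLp_indicator_const 2 hm (1 : ℂ) (Or.inr hFc.measure_ne_top)) hcF
      rw [← L2.inner_indicatorConstLp_one hm hFc.measure_ne_top,
        ContinuousLinearMap.adjoint_inner_right, L2.inner_def]
      calc _ = ∫ y, (starRingEnd ℂ) (∫ x in F, combinedKernel Θ k y x) * g y := by
            refine integral_congr_ae ?_
            filter_upwards [hT, hg.coeFn_toLp] with y h1 h2
            rw [h2, RCLike.inner_apply, mul_comm]
            by_cases hy : y ∈ S
            · have h3 := h1 fun hy' => hF (hsupp hy') hy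
              have h4 : ∫ x, combinedKernel Θ k y x * F.indicator (fun _ => (1 : ℂ)) x =
                  ∫ x in F, combinedKernel Θ k y x := by
                rw [← integral_indicator hm]
                congr 1
                ext x
                by_cases hx : x ∈ F <;> simp [hx]
              rw [← h4, ← h3]
              rfl
            · rw [image_eq_zero_of_notMem_tsupport hy, mul_zero, mul_zero]
        _ = ∫ y in S, (starRingEnd ℂ) (∫ x in F, combinedKernel Θ k y x) * g y :=
            (setIntegral_eq_integral_of_forall_compl_eq_zero fun y hy => by
              rw [image_eq_zero_of_notMem_tsupport hy, mul_zero]).symm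
        _ = ∫ y in S, ∫ x in F, (starRingEnd ℂ) (combinedKernel Θ k y x) * g y := by
            congr 1
            ext y
            rw [integral_mul_const, integral_conj]
        _ = ∫ x in F, ∫ y in S, (starRingEnd ℂ) (combinedKernel Θ k y x) * g y :=
            (integral_integral_swap (hint F hF hFc)).symm
        _ = ∫ x in F, H x := by simp only [← hHS]
    have h0 := ae_eq_zero_of_setIntegral_isCompact (isClosed_tsupport g).isOpen_compl
      (f := fun x => ContinuousLinearMap.adjoint T (hg.toLp g) x - H x) fun F hF hFc =>
        ⟨(hTint F hFc).sub (hHint F hF hFc), by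
          rw [integral_sub (hTint F hFc) (hHint F hF hFc), key F hF hFc, sub_self]⟩
    filter_upwards [h0] with x hx hxS
    exact sub_eq_zero.1 (hx hxS)

end HasModulatedKernel

end Kernels

/-! ### The weak type estimate -/

section WeakType

variable {n N : ℕ} {Θ : Fin N → Rn n} {A : ℝ} {T : L2 n →L[ℂ] L2 n}
  {k : Fin N → Rn n × Rn n → ℂ}

theorem coeFn_sum_L2 {ι : Type*} (s : Finset ι) (F : ι → L2 n) :
    ⇑(∑ j ∈ s, F j) =ᵐ[volume] fun x => ∑ j ∈ s, F j x := by
  have h := coeFn_sum_aeEqFun s fun j => (F j : Rn n →ₘ[volume] ℂ)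
  have e : ((∑ j ∈ s, F j : L2 n) : Rn n →ₘ[volume] ℂ) =
      ∑ j ∈ s, (F j : Rn n →ₘ[volume] ℂ) := by
    rw [AddSubmonoidClass.coe_finsetSum]
  rw [← e] at h
  exact h

theorem hasCompactSupport_of_forall_notMem_ball {f : Rn n → ℂ} {c : Rn n} {ρ : ℝ}
    (hf : ∀ y ∉ ball c ρ, f y = 0) : HasCompactSupport f ∧ tsupport f ⊆ closedBall c ρ := by
  have h : tsupport f ⊆ closedBall c ρ :=
    closure_minimal (fun y hy => ball_subset_closedBall (by
      by_contra hy'; exact hy (hf y hy'))) isClosed_closedBall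
  exact ⟨(isCompact_closedBall c ρ).of_isClosed_subset (isClosed_tsupport f) h, h⟩

/-- Pointwise decay of the image of a function orthogonal to all the exponentials. -/
theorem HasModulatedKernel.enorm_apply_le_of_orthogonal (h : HasModulatedKernel Θ A T k)
    {c : Rn n} {ρ : ℝ} (hρ : 0 < ρ) {b : Rn n → ℂ} (hb : MemLp b 2 volume)
    (hsupp : ∀ y ∉ ball c ρ, b y = 0)
    (horth : ∀ ψ ∈ expSpan Θ, ∫ y, (starRingEnd ℂ) (ψ y) * b y = 0) :
    ∀ᵐ x ∂(volume : Measure (Rn n)), 2 * ρ ≤ dist x c →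
      ‖T (hb.toLp b) x‖ₑ ≤
        ENNReal.ofReal (A * 2 ^ (n + 1) * (ρ / dist x c ^ (n + 1))) * ∫⁻ y, ‖b y‖ₑ := by
  obtain ⟨hc, hts⟩ := hasCompactSupport_of_forall_notMem_ball hsupp
  filter_upwards [h.off_diag b hb hc] with x hx hxc
  have hxs : x ∉ tsupport b := fun hmem => by
    have := mem_closedBall.1 (hts hmem); linarith
  -- The kernel with its demodulated part frozen at y = c is the conjugate of an exponential sum in
  -- y, so it integrates to zero against b and can be subtracted.
  set ψ : Rn n → ℂ :=
    ∑ j, (starRingEnd ℂ) (character (Θ j) x * k j (x, c)) • character (Θ j) with hψ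
  have hψE : ψ ∈ expSpan Θ :=
    Submodule.sum_mem _ fun j _ => Submodule.smul_mem _ _ (character_mem_expSpan Θ j)
  have hψe : ∀ y, (starRingEnd ℂ) (ψ y) = ∑ j, character (Θ j) (x - y) * k j (x, c) := by
    intro y
    rw [hψ, Finset.sum_apply, map_sum]
    refine Finset.sum_congr rfl fun j _ => ?_
    rw [Pi.smul_apply, smul_eq_mul, map_mul, Complex.conj_conj, sub_eq_add_neg, character_add,
      character_neg]
    ring
  have hint1 : Integrable fun y => combinedKernel Θ k x y * b y := by
    refine integrable_mul_of_continuousOn hb hc fun y hy => ?_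
    have hxy : x ≠ y := fun e => hxs (e ▸ hy)
    exact ((h.continuousAt_combinedKernel (z := (x, y)) hxy).comp
      (f := fun y => (x, y)) (by fun_prop)).continuousWithinAt
  have hint2 : Integrable fun y => (starRingEnd ℂ) (ψ y) * b y :=
    integrable_mul_of_continuousOn hb hc
      (Complex.continuous_conj.comp (continuous_of_mem_expSpan hψE)).continuousOn
  have e : T (hb.toLp b) x =
      ∫ y, (∑ j, character (Θ j) (x - y) * (k j (x, y) - k j (x, c))) * b y := by
    rw [hx hxs, ← sub_zero (∫ y, combinedKernel Θ k x y * b y), ← horth ψ hψE,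
      ← integral_sub hint1 hint2]
    congr 1
    ext y
    rw [hψe, combinedKernel, ← sub_mul, ← Finset.sum_sub_distrib]
    simp only [mul_sub]
  rw [e, ← lintegral_const_mul' _ _ ENNReal.ofReal_ne_top]
  refine (enorm_integral_le_lintegral_enorm _).trans (lintegral_mono fun y => ?_)
  rw [enorm_mul]
  by_cases hy : y ∈ ball c ρ
  · gcongr
    rw [← ofReal_norm]
    exact ENNReal.ofReal_le_ofReal (h.norm_sum_sub_snd_le (fun j => (norm_character _ _).le) hρ
      (mem_ball.1 hy).le hxc)
  · simp [hsupp y hy]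

/-- Integrated form of the pointwise decay, by the dyadic tail bound for the constant function 1. No
N enters: orthogonality to E plays the role of mean zero. -/
theorem HasModulatedKernel.lintegral_apply_le_of_orthogonal [NeZero n]
    (h : HasModulatedKernel Θ A T k)
    {c : Rn n} {ρ : ℝ} (hρ : 0 < ρ) {b : Rn n → ℂ} (hb : MemLp b 2 volume)
    (hsupp : ∀ y ∉ ball c ρ, b y = 0)
    (horth : ∀ ψ ∈ expSpan Θ, ∫ y, (starRingEnd ℂ) (ψ y) * b y = 0) :
    ∫⁻ x in (ball c (2 * ρ))ᶜ, ‖T (hb.toLp b) x‖ₑ ≤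
      ENNReal.ofReal (A * 4 ^ (n + 1)) * unitVol n * ∫⁻ y, ‖b y‖ₑ := by
  have hA := h.nonneg
  have htail := lintegral_tail_le (fun _ => 1) c (ρ := 2 * ρ) (by positivity) (M := 1)
    (fun R _ => by simp)
  have hbt : ∫⁻ y, ‖b y‖ₑ ≠ ∞ :=
    (integrable_of_hasCompactSupport hb (hasCompactSupport_of_forall_notMem_ball hsupp).1).2.ne
  calc ∫⁻ x in (ball c (2 * ρ))ᶜ, ‖T (hb.toLp b) x‖ₑ
      ≤ ∫⁻ x in (ball c (2 * ρ))ᶜ, (ENNReal.ofReal (A * 2 ^ (n + 1)) * ∫⁻ y, ‖b y‖ₑ) *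
          (ENNReal.ofReal (2 * ρ / dist x c ^ (n + 1)) * 1) := by
        refine setLIntegral_mono_ae' measurableSet_ball.compl ?_
        filter_upwards [h.enorm_apply_le_of_orthogonal hρ hb hsupp horth] with x hx hxc
        refine (hx (by simpa using hxc)).trans ?_
        rw [ENNReal.ofReal_mul (by positivity), mul_one, mul_right_comm]
        gcongr
        linarith
    _ = (ENNReal.ofReal (A * 2 ^ (n + 1)) * ∫⁻ y, ‖b y‖ₑ) *
          ∫⁻ x in (ball c (2 * ρ))ᶜ, ENNReal.ofReal (2 * ρ / dist x c ^ (n + 1)) * 1 :=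
        lintegral_const_mul' _ _ (ENNReal.mul_ne_top ENNReal.ofReal_ne_top hbt)
    _ ≤ (ENNReal.ofReal (A * 2 ^ (n + 1)) * ∫⁻ y, ‖b y‖ₑ) *
          (ENNReal.ofReal (2 ^ (n + 1)) * unitVol n * 1) := by gcongr
    _ = _ := by
        rw [show A * 4 ^ (n + 1) = A * 2 ^ (n + 1) * 2 ^ (n + 1) by
          rw [mul_assoc, ← mul_pow]; norm_num, ENNReal.ofReal_mul (p := A * 2 ^ (n + 1)) (by positivity)]
        ring

/-- The square root of a natural number, as an extended nonnegative real. -/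
noncomputable def sqrtN (N : ℕ) : ℝ≥0∞ := (NNReal.sqrt N : ℝ≥0)

theorem sqrtN_mul_self (N : ℕ) : sqrtN N * sqrtN N = N := by
  rw [sqrtN, ← ENNReal.coe_mul, NNReal.mul_self_sqrt]; simp

theorem sqrtN_ne_top (N : ℕ) : sqrtN N ≠ ∞ := ENNReal.coe_ne_top

theorem one_le_sqrtN {N : ℕ} (hN : 1 ≤ N) : 1 ≤ sqrtN N := by
  rw [sqrtN, ENNReal.one_le_coe_iff, ← NNReal.sqrt_one]
  exact NNReal.sqrt_le_sqrt.2 (by exact_mod_cast hN)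

theorem sqrtN_eq_rpow (N : ℕ) : sqrtN N = (N : ℝ≥0∞) ^ (1 / 2 : ℝ) := by
  rw [← sqrtN_mul_self N, ← sq, ← ENNReal.rpow_natCast, ← ENNReal.rpow_mul]; simp

/-- A function supported in a ball can be replaced by a function with the same moments against the
exponentials and with a better square function norm. -/
theorem HasModulatedKernel.exists_replacement [NeZero n] (h : HasModulatedKernel Θ A T k)
    (hN : 1 ≤ N) {c : Rn n} {r : ℝ} (hr : 0 ≤ r) {f : Rn n → ℂ} (hf : MemLp f 2 volume)
    (hsupp : ∀ y ∉ ball c r, f y = 0) {β : ℝ≥0∞}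
    (hβ : ∫⁻ y, ‖f y‖ₑ ≤ β * volume (ball c r)) :
    ∃ (g : Rn n → ℂ) (hg : MemLp g 2 volume), (∀ y ∉ ball c (3 * r), g y = 0) ∧
      ∫⁻ y, ‖g y‖ₑ ^ 2 ≤ N * β * ∫⁻ y, ‖f y‖ₑ ∧
      ∫⁻ x in (ball c (6 * r))ᶜ, ‖T (hf.toLp f - hg.toLp g) x‖ₑ ≤
        ENNReal.ofReal (A * 4 ^ (n + 1)) * unitVol n * (4 ^ n * sqrtN N) * ∫⁻ y, ‖f y‖ₑ := by
  rcases hr.eq_or_lt with rfl | hr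
  · have hf0 : f = 0 := by
      ext y; exact hsupp y (by simp)
    subst hf0
    refine ⟨0, MemLp.zero, fun _ _ => rfl, by simp, ?_⟩
    have : ∀ᵐ x, T (hf.toLp 0 - (MemLp.zero : MemLp (0 : Rn n → ℂ) 2 volume).toLp 0) x = 0 := by
      rw [sub_self, map_zero]
      exact Lp.coeFn_zero _ _ _
    refine le_of_eq_of_le ?_ zero_le
    rw [lintegral_eq_zero_iff' ((Lp.aestronglyMeasurable _).enorm.restrict)]
    filter_upwards [ae_restrict_of_ae this] with x hx
    rw [hx]; simp
  obtain ⟨φ, hφ, horth, hle⟩ := exists_expSpan_orthogonal Θ hr hf hsupp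
  set F := ∫⁻ y, ‖f y‖ₑ with hF
  set B := ball c (3 * r) with hB
  have hBm : MeasurableSet B := measurableSet_ball
  have hV0 : volume (ball c r) ≠ 0 := volume_ball_ne_zero c hr
  have hVt : volume (ball c r) ≠ ∞ := volume_ball_ne_top c r
  have hφc := continuous_of_mem_expSpan hφ
  have hg : MemLp (B.indicator φ) 2 volume :=
    (memLp_indicator_iff_restrict hBm).2 (memLp_of_mem_expSpan hφ 2 c (3 * r))
  have hgs : ∀ y ∉ B, B.indicator φ y = 0 := fun y hy => Set.indicator_of_notMem hy _
  have hfB : ∀ y ∉ B, f y = 0 := fun y hy =>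
    hsupp y fun hy' => hy (ball_subset_ball (by linarith) hy')
  refine ⟨B.indicator φ, hg, hgs, ?_, ?_⟩
  · have e : ∫⁻ y, ‖B.indicator φ y‖ₑ ^ 2 = ∫⁻ y in B, ‖φ y‖ₑ ^ 2 := by
      rw [← lintegral_indicator hBm]
      refine lintegral_congr fun y => ?_
      by_cases hy : y ∈ B <;> simp [hy]
    rw [e, ← ENNReal.mul_le_mul_iff_left hV0 hVt]
    calc _ ≤ N * F ^ 2 := hle
      _ = N * F * F := by ring
      _ ≤ N * F * (β * volume (ball c r)) := by gcongr
      _ = _ := by ring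
  · have hb : MemLp (f - B.indicator φ) 2 volume := hf.sub hg
    have hbs : ∀ y ∉ B, (f - B.indicator φ) y = 0 := fun y hy => by
      rw [Pi.sub_apply, hfB y hy, hgs y hy, sub_zero]
    have hb0 : ∀ ψ ∈ expSpan Θ, ∫ y, (starRingEnd ℂ) (ψ y) * (f - B.indicator φ) y = 0 := by
      intro ψ hψ
      rw [← horth ψ hψ, ← integral_indicator hBm]
      congr 1
      ext y
      by_cases hy : y ∈ B
      · simp [hy]
      · simp [hy, hfB y hy]
    have key := h.lintegral_apply_le_of_orthogonal (ρ := 3 * r) (by positivity) hb hbs hb0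
    rw [show 2 * (3 * r) = 6 * r by ring] at key
    rw [← MemLp.toLp_sub hf hg]
    refine key.trans ?_
    rw [mul_assoc _ (4 ^ n * sqrtN N)]
    gcongr
    -- Cauchy–Schwarz on the triple ball turns the bound N F² / |Q| for the squared L² norm into √N
    -- F, up to the ratio of volumes, which is bounded crudely.
    have h1 : ∫⁻ y, ‖B.indicator φ y‖ₑ ≤ 3 ^ n * sqrtN N * F := by
      have e : ∫⁻ y, ‖B.indicator φ y‖ₑ = ∫⁻ y in B, ‖φ y‖ₑ * 1 := by
        rw [← lintegral_indicator hBm]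
        refine lintegral_congr fun y => ?_
        by_cases hy : y ∈ B <;> simp [hy]
      have hcs := ENNReal.lintegral_mul_le_Lp_mul_Lq (volume.restrict B) Real.HolderConjugate.two_two
        (f := fun y => ‖φ y‖ₑ) (g := fun _ => 1) hφc.measurable.enorm.aemeasurable
        aemeasurable_const
      have h3 : volume B = 3 ^ n * volume (ball c r) := by
        rw [hB, volume_ball_mul c c (by norm_num) hr.le, ENNReal.ofReal_pow (by norm_num)]; simp
      rw [e]
      refine hcs.trans ?_
      simp only [ENNReal.one_rpow, lintegral_const, Measure.restrict_apply_univ,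
        one_mul]
      rw [← ENNReal.mul_rpow_of_nonneg _ _ (by norm_num), h3]
      calc _ ≤ ((3 ^ n * sqrtN N * F) ^ (2 : ℕ)) ^ (1 / 2 : ℝ) := by
            gcongr
            simp only [ENNReal.rpow_ofNat]
            calc (∫⁻ y in B, ‖φ y‖ₑ ^ 2) * (3 ^ n * volume (ball c r))
                = 3 ^ n * ((∫⁻ y in B, ‖φ y‖ₑ ^ 2) * volume (ball c r)) := by ring
              _ ≤ (3 ^ n * 3 ^ n) * (N * F ^ 2) := by
                  gcongr
                  exact le_mul_of_one_le_right zero_le (one_le_pow₀ (by norm_num))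
              _ = _ := by rw [← sqrtN_mul_self]; ring
        _ = _ := by
            rw [← ENNReal.rpow_natCast, ← ENNReal.rpow_mul]; simp
    calc ∫⁻ y, ‖(f - B.indicator φ) y‖ₑ ≤ ∫⁻ y, (‖f y‖ₑ + ‖B.indicator φ y‖ₑ) :=
          lintegral_mono fun y => enorm_sub_le
      _ = F + ∫⁻ y, ‖B.indicator φ y‖ₑ := lintegral_add_right' _ hg.aestronglyMeasurable.enorm
      _ ≤ 1 * sqrtN N * F + 3 ^ n * sqrtN N * F := by
          gcongr
          rw [one_mul]
          exact le_mul_of_one_le_left zero_le (one_le_sqrtN hN)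
      _ = (1 ^ n + 3 ^ n) * (sqrtN N * F) := by ring
      _ ≤ 4 ^ n * (sqrtN N * F) := by
          gcongr
          have : (1 : ℕ) ^ n + 3 ^ n ≤ 4 ^ n := by
            simpa using pow_add_pow_le (zero_le_one' ℕ) (Nat.zero_le 3) (NeZero.ne n)
          exact_mod_cast this
      _ = _ := by ring

theorem enorm_add_sq_le (a b : ℂ) : ‖a + b‖ₑ ^ 2 ≤ 2 * ‖a‖ₑ ^ 2 + 2 * ‖b‖ₑ ^ 2 := by
  have h := ENNReal.rpow_add_le_mul_rpow_add_rpow ‖a‖ₑ ‖b‖ₑ one_le_two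
  norm_num at h
  rw [← mul_add]
  exact (pow_le_pow_left₀ zero_le (enorm_add_le a b) 2).trans h

/-- Cauchy–Schwarz restricted to the nonzero terms: bounded overlap makes the pieces almost
orthogonal. -/
theorem enorm_sum_sq_le {ι : Type*} (s : Finset ι) (F : ι → ℂ) {M : ℕ}
    (hM : ∀ t ⊆ s, (∀ i ∈ t, F i ≠ 0) → t.card ≤ M) :
    ‖∑ i ∈ s, F i‖ₑ ^ 2 ≤ M * ∑ i ∈ s, ‖F i‖ₑ ^ 2 := by
  classical
  have h1 : ‖∑ i ∈ s, F i‖ₑ ≤ ∑ i ∈ s with F i ≠ 0, ‖F i‖ₑ := by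
    rw [← Finset.sum_filter_ne_zero]
    exact enorm_sum_le _ _
  have h2 := ENNReal.rpow_sum_le_const_mul_sum_rpow (s.filter fun i => F i ≠ 0)
    (fun i => ‖F i‖ₑ) one_le_two
  norm_num at h2
  have h3 := hM _ (Finset.filter_subset (fun i => F i ≠ 0) s) fun i hi => (Finset.mem_filter.1 hi).2
  calc ‖∑ i ∈ s, F i‖ₑ ^ 2 ≤ (∑ i ∈ s with F i ≠ 0, ‖F i‖ₑ) ^ 2 :=
        pow_le_pow_left₀ zero_le h1 2
    _ ≤ ((s.filter fun i => F i ≠ 0).card : ℝ≥0∞) * ∑ i ∈ s with F i ≠ 0, ‖F i‖ₑ ^ 2 := h2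
    _ ≤ M * ∑ i ∈ s, ‖F i‖ₑ ^ 2 := by
        gcongr
        exact Finset.filter_subset _ _

/-- The weak type constant. -/
noncomputable def weakConst (n : ℕ) (A : ℝ) : ℝ≥0∞ :=
  5 ^ n + ENNReal.ofReal A ^ 2 * (2 + 2 * 22 ^ n * 21 ^ n) +
    ENNReal.ofReal (A * 4 ^ (n + 1)) * unitVol n * 4 ^ n

/-- Chebyshev's inequality combined with the L² bound. It serves the good part, the tail of the
decomposition and the low part in the interpolation. -/
theorem HasModulatedKernel.mul_sq_volume_le (h : HasModulatedKernel Θ A T k) (u : L2 n)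
    (l : ℝ≥0∞) : l ^ 2 * volume {x | l ≤ ‖T u x‖ₑ} ≤
      ENNReal.ofReal A ^ 2 * ∫⁻ x, ‖u x‖ₑ ^ 2 := by
  calc l ^ 2 * volume {x | l ≤ ‖T u x‖ₑ}
      ≤ l ^ 2 * volume {x | l ^ 2 ≤ ‖T u x‖ₑ ^ 2} := by
        refine mul_le_mul_right (measure_mono fun x hx => ?_) _
        exact pow_le_pow_left₀ zero_le (show l ≤ ‖T u x‖ₑ from hx) 2
    _ ≤ ∫⁻ x, ‖T u x‖ₑ ^ 2 :=
        mul_meas_ge_le_lintegral₀ ((Lp.aestronglyMeasurable _).enorm.pow_const 2) _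
    _ ≤ _ := by
        rw [← eLpNorm_two_sq, ← eLpNorm_two_sq, ← mul_pow]
        exact pow_le_pow_left₀ zero_le (h.enorm_apply_le u) 2

/-- The weak type `(1, 1)` inequality, with constant `√N`. -/
theorem HasModulatedKernel.weak_type [NeZero n] (h : HasModulatedKernel Θ A T k) (hN : 1 ≤ N)
    (f : L2 n) (hf1 : ∫⁻ x, ‖f x‖ₑ ≠ ∞) {l : ℝ≥0∞} (hl : l ≠ 0) (hl' : l ≠ ∞) :
    l * volume {x | 3 * l < ‖T f x‖ₑ} ≤ weakConst n A * sqrtN N * ∫⁻ x, ‖f x‖ₑ := by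
  have hq1 := one_le_sqrtN hN
  have hq0 : sqrtN N ≠ 0 := (zero_lt_one.trans_le hq1).ne'
  have hqt := sqrtN_ne_top N
  set q := sqrtN N with hq
  set F := ∫⁻ x, ‖f x‖ₑ with hF
  -- At this height the good part has squared L² norm of order N α F = √N l F, so Chebyshev at level
  -- l costs only √N; the exceptional set also costs √N.
  set α := l / q with hα
  have hαq : α * q = l := ENNReal.div_mul_cancel hq0 hqt
  have hα0 : α ≠ 0 := (ENNReal.div_pos hl hqt).ne'
  have hαt : α ≠ ∞ := ENNReal.div_ne_top hl' hq0
  have hfm : MemLp f 2 volume := Lp.memLp f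
  have hfe : AEMeasurable (fun x => ‖f x‖ₑ) volume := hfm.1.enorm
  set Ω := largeAverage (fun x => ‖f x‖ₑ) α with hΩ
  have hΩo : IsOpen Ω := isOpen_largeAverage _ _
  have hΩm := hΩo.measurableSet
  have hΩvol : α * volume Ω ≤ ENNReal.ofReal (5 ^ n) * F := mul_volume_largeAverage_le hα0 hαt hf1
  have hΩfin : volume Ω ≠ ∞ := fun e => by
    rw [e, ENNReal.mul_top hα0, top_le_iff] at hΩvol
    exact ENNReal.mul_ne_top ENNReal.ofReal_ne_top hf1 hΩvol
  have hsmall : ∀ᵐ x, x ∉ Ω → ‖f x‖ₑ ≤ α := ae_le_of_notMem_largeAverage hfe hf1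
  obtain ⟨x, r, hr, hrΩ, hrz, hcov, hov⟩ := exists_whitney_balls hΩo hΩfin
  set D : ℕ → Set (Rn n) := disjointed fun i => ball (x i) (5 * r i) with hD
  have hDm : ∀ i, MeasurableSet (D i) :=
    fun i => MeasurableSet.disjointed (fun _ => measurableSet_ball) i
  have hDb : ∀ i, D i ⊆ ball (x i) (5 * r i) := fun i => disjointed_subset _ i
  have hDd : Pairwise (Function.onFun Disjoint D) := disjoint_disjointed _
  have hDΩ : ⋃ i, D i = Ω := by
    rw [hD, iUnion_disjointed]
    refine Set.Subset.antisymm (Set.iUnion_subset fun i => ?_) hcov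
    rcases (hr i).eq_or_lt with h0 | h0
    · simp [← h0]
    · exact (ball_subset_ball (by linarith)).trans (hrΩ i h0)
  have hfD : ∀ i, MemLp ((D i).indicator f) 2 volume := fun i => hfm.indicator (hDm i)
  have hFi : ∀ i, ∫⁻ y, ‖(D i).indicator f y‖ₑ = ∫⁻ y in D i, ‖f y‖ₑ := fun i => by
    rw [← lintegral_indicator (hDm i)]
    simp only [enorm_indicator_eq_indicator_enorm]
  -- The ball of radius 105 r_i = 21 · 5 r_i about x_i reaches the point outside Ω at distance 100
  -- r_i, so its average is at most α.
  have hβ : ∀ i, ∫⁻ y, ‖(D i).indicator f y‖ₑ ≤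
      (21 ^ n * α) * volume (ball (x i) (5 * r i)) := by
    intro i
    rw [hFi]
    rcases (hr i).eq_or_lt with h0 | h0
    · have : D i = ∅ := Set.subset_empty_iff.1 ((hDb i).trans (by simp [← h0]))
      simp [this]
    · obtain ⟨z, hz, hzd⟩ := hrz i h0
      calc ∫⁻ y in D i, ‖f y‖ₑ ≤ ∫⁻ y in ball (x i) (21 * (5 * r i)), ‖f y‖ₑ :=
            lintegral_mono_set ((hDb i).trans (ball_subset_ball (by linarith)))
        _ ≤ α * volume (ball (x i) (21 * (5 * r i))) :=
            lintegral_ball_le_of_notMem hz (by rw [mem_ball, hzd]; linarith)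
        _ = _ := by
            rw [volume_ball_mul (x i) (x i) (by norm_num) (by linarith),
              ENNReal.ofReal_pow (by norm_num)]
            simp; ring
  have hDs : ∀ i, ∀ y ∉ ball (x i) (5 * r i), (D i).indicator f y = 0 := fun i y hy =>
    Set.indicator_of_notMem (fun hy' => hy (hDb i hy')) _
  choose g hg hgs hg2 hgT using fun i =>
    h.exists_replacement hN (by have := hr i; positivity) (hfD i) (hDs i) (hβ i)
  have hΩc : MemLp (Ωᶜ.indicator f) 2 volume := hfm.indicator hΩm.compl
  have hsum : ∀ m, ∑ i ∈ Finset.range m, ∫⁻ y, ‖(D i).indicator f y‖ₑ ≤ F := by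
    intro m
    simp only [hFi]
    rw [← lintegral_biUnion_finset (fun i _ j _ hij => hDd hij) fun i _ => hDm i]
    exact setLIntegral_le_lintegral _ _
  have htail : Tendsto (fun m => ∫⁻ y in ⋃ i, D (i + m), ‖f y‖ₑ ^ 2) atTop (𝓝 0) := by
    have e : ∀ m, ∫⁻ y in ⋃ i, D (i + m), ‖f y‖ₑ ^ 2 = ∑' i, ∫⁻ y in D (i + m), ‖f y‖ₑ ^ 2 :=
      fun m => lintegral_iUnion (s := fun i => D (i + m)) (fun i => hDm _)
        (fun i j hij => hDd (by omega)) _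
    simp only [e]
    refine ENNReal.tendsto_sum_nat_add (fun i => ∫⁻ y in D i, ‖f y‖ₑ ^ 2) ?_
    rw [← lintegral_iUnion hDm hDd, ← eLpNorm_two_sq]
    exact ENNReal.pow_ne_top (hfm.restrict _).2.ne
  -- Only the first m pieces are replaced; the others are kept together as a function whose L² norm
  -- tends to 0. Thus no convergence of an infinite sum of bad functions is needed.
  have main : ∀ m, l * volume {x | 3 * l < ‖T f x‖ₑ} ≤ weakConst n A * q * F +
      l⁻¹ * (ENNReal.ofReal A ^ 2 * ∫⁻ y in ⋃ i, D (i + m), ‖f y‖ₑ ^ 2) := by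
    intro m
    set R := ⋃ i, D (i + m) with hR
    have hRm : MeasurableSet R := MeasurableSet.iUnion fun i => hDm _
    have hfR : MemLp (R.indicator f) 2 volume := hfm.indicator hRm
    set G : L2 n := hΩc.toLp _ + ∑ i ∈ Finset.range m, (hg i).toLp _ with hG
    set b : ℕ → L2 n := fun i => (hfD i).toLp _ - (hg i).toLp _ with hb
    set H : L2 n := hfR.toLp _ with hH
    have hdec : f = G + ∑ i ∈ Finset.range m, b i + H := by
      have e1 : G + ∑ i ∈ Finset.range m, b i + H =
          hΩc.toLp _ + ∑ i ∈ Finset.range m, (hfD i).toLp _ + H := by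
        rw [hG, hb, Finset.sum_sub_distrib]; abel
      rw [e1]
      refine Lp.ext ?_
      filter_upwards [Lp.coeFn_add (hΩc.toLp _ + ∑ i ∈ Finset.range m, (hfD i).toLp _) H,
        Lp.coeFn_add (hΩc.toLp _) (∑ i ∈ Finset.range m, (hfD i).toLp _),
        coeFn_sum_L2 (Finset.range m) (fun i => (hfD i).toLp _), hΩc.coeFn_toLp, hfR.coeFn_toLp,
        ae_all_iff.2 fun i => (hfD i).coeFn_toLp] with y h1 h2 h3 h4 h5 h6
      rw [h1, Pi.add_apply, h2, Pi.add_apply, h3, h4, hH, h5]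
      simp only [h6]
      by_cases hy : y ∈ Ω
      · obtain ⟨j, hj⟩ := Set.mem_iUnion.1 (hDΩ ▸ hy)
        have hj' : ∀ i, i ≠ j → y ∉ D i := fun i hij hi =>
          Set.disjoint_left.1 (hDd hij) hi hj
        rw [Set.indicator_of_notMem (by simpa using hy), zero_add]
        by_cases hjm : j < m
        · rw [Finset.sum_eq_single j (fun i _ hij => Set.indicator_of_notMem (hj' i hij) _)
            (fun hj'' => absurd (Finset.mem_range.2 hjm) hj''), Set.indicator_of_mem hj,
            Set.indicator_of_notMem, add_zero]
          intro hyR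
          obtain ⟨i, hi⟩ := Set.mem_iUnion.1 hyR
          exact hj' (i + m) (by omega) hi
        · rw [Finset.sum_eq_zero fun i hi => Set.indicator_of_notMem (hj' i (by
            have := Finset.mem_range.1 hi; omega)) _, zero_add, Set.indicator_of_mem]
          exact Set.mem_iUnion.2 ⟨j - m, by rwa [Nat.sub_add_cancel (not_lt.1 hjm)]⟩
      · have hyD : ∀ i, y ∉ D i := fun i hi => hy (hDΩ ▸ Set.mem_iUnion.2 ⟨i, hi⟩)
        rw [Set.indicator_of_mem (by simpa using hy),
          Finset.sum_eq_zero fun i _ => Set.indicator_of_notMem (hyD i) _,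
          Set.indicator_of_notMem, add_zero, add_zero]
        intro hyR
        obtain ⟨i, hi⟩ := Set.mem_iUnion.1 hyR
        exact hyD _ hi
    have hTdec : ∀ᵐ y, T f y = T G y + ∑ i ∈ Finset.range m, T (b i) y + T H y := by
      have e : T f = T G + ∑ i ∈ Finset.range m, T (b i) + T H := by
        conv_lhs => rw [hdec]
        rw [map_add, map_add, map_sum]
      rw [e]
      filter_upwards [Lp.coeFn_add (T G + ∑ i ∈ Finset.range m, T (b i)) (T H),
        Lp.coeFn_add (T G) (∑ i ∈ Finset.range m, T (b i)),
        coeFn_sum_L2 (Finset.range m) (fun i => T (b i))] with y h1 h2 h3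
      rw [h1, Pi.add_apply, h2, Pi.add_apply, h3]
    -- the good part
    have hGint : ∫⁻ y, ‖G y‖ₑ ^ 2 ≤ (2 + 2 * 22 ^ n * 21 ^ n) * (q * l * F) := by
      have hpt : ∀ᵐ y, ‖G y‖ₑ ^ 2 ≤ 2 * (α * ‖f y‖ₑ) +
          2 * (22 ^ n * ∑ i ∈ Finset.range m, ‖g i y‖ₑ ^ 2) := by
        filter_upwards [Lp.coeFn_add (hΩc.toLp _) (∑ i ∈ Finset.range m, (hg i).toLp _),
          coeFn_sum_L2 (Finset.range m) (fun i => (hg i).toLp _), hΩc.coeFn_toLp,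
          ae_all_iff.2 fun i => (hg i).coeFn_toLp, hsmall] with y h1 h2 h3 h4 h5
        rw [hG, h1, Pi.add_apply, h2, h3]
        simp only [h4]
        refine (enorm_add_sq_le _ _).trans ?_
        gcongr
        · by_cases hy : y ∈ Ω
          · simp [hy]
          · rw [Set.indicator_of_mem (by simpa using hy), sq]
            gcongr
            exact h5 hy
        · have := enorm_sum_sq_le (Finset.range m) (fun i => g i y) (M := 22 ^ n)
            fun t _ ht => hov y t fun i hi => by
              by_contra hy
              exact ht i hi (hgs i y (by
                rwa [show 3 * (5 * r i) = 15 * r i by ring]))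
          simpa using this
      have hgm : ∀ i, AEMeasurable (fun y => ‖g i y‖ₑ ^ 2) volume := fun i =>
        (hg i).1.enorm.pow_const 2
      calc ∫⁻ y, ‖G y‖ₑ ^ 2 ≤ ∫⁻ y, (2 * (α * ‖f y‖ₑ) +
            2 * (22 ^ n * ∑ i ∈ Finset.range m, ‖g i y‖ₑ ^ 2)) := lintegral_mono_ae hpt
        _ = 2 * (α * F) + 2 * (22 ^ n * ∑ i ∈ Finset.range m, ∫⁻ y, ‖g i y‖ₑ ^ 2) := by
            rw [lintegral_add_left' ((hfe.const_mul α).const_mul 2),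
              lintegral_const_mul' _ _ (by simp), lintegral_const_mul' _ _ hαt,
              lintegral_const_mul' _ _ (by simp),
              lintegral_const_mul' _ _ (ENNReal.pow_ne_top (by simp)),
              lintegral_finsetSum' _ fun i _ => hgm i]
        _ ≤ 2 * ((q * q * α) * F) + 2 * (22 ^ n * ∑ i ∈ Finset.range m,
              N * (21 ^ n * α) * ∫⁻ y, ‖(D i).indicator f y‖ₑ) := by
            gcongr with i hi
            · exact le_mul_of_one_le_left zero_le (one_le_mul hq1 hq1)
            · exact hg2 i
        _ ≤ 2 * ((q * q * α) * F) + 2 * (22 ^ n * (N * (21 ^ n * α) * F)) := by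
            rw [← Finset.mul_sum]
            gcongr
            exact hsum m
        _ = (2 + 2 * 22 ^ n * 21 ^ n) * (q * (α * q) * F) := by
            rw [← sqrtN_mul_self N, ← hq]; ring
        _ = _ := by rw [hαq]
    have hgood : l * volume {y | l ≤ ‖T G y‖ₑ} ≤
        ENNReal.ofReal A ^ 2 * (2 + 2 * 22 ^ n * 21 ^ n) * (q * F) := by
      rw [← ENNReal.mul_le_mul_iff_right hl hl', ← mul_assoc, ← sq]
      refine (h.mul_sq_volume_le G l).trans ?_
      calc _ ≤ ENNReal.ofReal A ^ 2 * ((2 + 2 * 22 ^ n * 21 ^ n) * (q * l * F)) := by gcongr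
        _ = _ := by ring
    -- the bad part
    have hbad : l * volume (Ωᶜ ∩ {y | l ≤ ‖∑ i ∈ Finset.range m, T (b i) y‖ₑ}) ≤
        ENNReal.ofReal (A * 4 ^ (n + 1)) * unitVol n * 4 ^ n * (q * F) := by
      have hm : ∀ i, AEMeasurable (fun y => ‖T (b i) y‖ₑ) (volume.restrict Ωᶜ) := fun i =>
        (Lp.aestronglyMeasurable _).enorm.restrict
      calc l * volume (Ωᶜ ∩ {y | l ≤ ‖∑ i ∈ Finset.range m, T (b i) y‖ₑ})
          ≤ l * (volume.restrict Ωᶜ) {y | l ≤ ∑ i ∈ Finset.range m, ‖T (b i) y‖ₑ} := by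
            refine mul_le_mul_right ?_ _
            rw [Measure.restrict_apply' hΩm.compl, Set.inter_comm]
            refine measure_mono (Set.inter_subset_inter_left _ fun y hy => ?_)
            exact le_trans (show l ≤ ‖_‖ₑ from hy) (enorm_sum_le _ _)
        _ ≤ ∫⁻ y in Ωᶜ, ∑ i ∈ Finset.range m, ‖T (b i) y‖ₑ :=
            mul_meas_ge_le_lintegral₀ (Finset.aemeasurable_fun_sum _ fun i _ => hm i) _
        _ = ∑ i ∈ Finset.range m, ∫⁻ y in Ωᶜ, ‖T (b i) y‖ₑ :=
            lintegral_finsetSum' _ fun i _ => hm i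
        _ ≤ ∑ i ∈ Finset.range m, ENNReal.ofReal (A * 4 ^ (n + 1)) * unitVol n * (4 ^ n * q) *
              ∫⁻ y, ‖(D i).indicator f y‖ₑ := by
            refine Finset.sum_le_sum fun i _ => (lintegral_mono_set ?_).trans (hgT i)
            rw [Set.compl_subset_compl]
            rcases (hr i).eq_or_lt with h0 | h0
            · simp [← h0]
            · exact (ball_subset_ball (by linarith)).trans (hrΩ i h0)
        _ ≤ ENNReal.ofReal (A * 4 ^ (n + 1)) * unitVol n * (4 ^ n * q) * F := by
            rw [← Finset.mul_sum]
            gcongr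
            exact hsum m
        _ = _ := by ring
    -- the tail
    have hrest : l * volume {y | l ≤ ‖T H y‖ₑ} ≤
        l⁻¹ * (ENNReal.ofReal A ^ 2 * ∫⁻ y in R, ‖f y‖ₑ ^ 2) := by
      have e : ∫⁻ y in R, ‖f y‖ₑ ^ 2 = ∫⁻ y, ‖H y‖ₑ ^ 2 := by
        rw [← eLpNorm_two_sq, ← eLpNorm_two_sq, ← eLpNorm_indicator_eq_eLpNorm_restrict hRm,
          eLpNorm_congr_ae hfR.coeFn_toLp]
      rw [e, ← ENNReal.mul_le_mul_iff_right hl hl', ← mul_assoc, ← mul_assoc, ← sq,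
        ENNReal.mul_inv_cancel hl hl', one_mul]
      exact h.mul_sq_volume_le H l
    have hexc : l * volume Ω ≤ 5 ^ n * (q * F) := by
      calc l * volume Ω = q * (α * volume Ω) := by rw [← hαq]; ring
        _ ≤ q * (ENNReal.ofReal (5 ^ n) * F) := by gcongr
        _ = _ := by
          rw [ENNReal.ofReal_pow (by norm_num)]; simp; ring
    have hset : volume {y | 3 * l < ‖T f y‖ₑ} ≤ volume Ω + volume {y | l ≤ ‖T G y‖ₑ} +
        volume (Ωᶜ ∩ {y | l ≤ ‖∑ i ∈ Finset.range m, T (b i) y‖ₑ}) +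
        volume {y | l ≤ ‖T H y‖ₑ} := by
      refine (measure_mono_ae (t := Ω ∪ {y | l ≤ ‖T G y‖ₑ} ∪
        (Ωᶜ ∩ {y | l ≤ ‖∑ i ∈ Finset.range m, T (b i) y‖ₑ}) ∪ {y | l ≤ ‖T H y‖ₑ}) ?_).trans ?_
      · filter_upwards [hTdec] with y hy hy3
        by_contra hcon
        have hy3 : 3 * l < ‖T f y‖ₑ := hy3
        have hcon : ¬ (((y ∈ Ω ∨ l ≤ ‖T G y‖ₑ) ∨
          (y ∈ Ωᶜ ∧ l ≤ ‖∑ i ∈ Finset.range m, T (b i) y‖ₑ)) ∨ l ≤ ‖T H y‖ₑ) := hcon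
        push Not at hcon
        obtain ⟨⟨⟨h1, h2⟩, h3⟩, h4⟩ := hcon
        refine absurd hy3 (not_lt.2 ?_)
        rw [hy]
        calc _ ≤ ‖T G y‖ₑ + ‖∑ i ∈ Finset.range m, T (b i) y‖ₑ + ‖T H y‖ₑ :=
              (enorm_add_le _ _).trans (by gcongr; exact enorm_add_le _ _)
          _ ≤ l + l + l := add_le_add (add_le_add h2.le (h3 h1).le) h4.le
          _ = 3 * l := by ring
      · refine (measure_union_le _ _).trans ?_
        gcongr
        refine (measure_union_le _ _).trans ?_
        gcongr
        exact measure_union_le _ _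
    calc l * volume {y | 3 * l < ‖T f y‖ₑ} ≤ l * (volume Ω + volume {y | l ≤ ‖T G y‖ₑ} +
        volume (Ωᶜ ∩ {y | l ≤ ‖∑ i ∈ Finset.range m, T (b i) y‖ₑ}) +
        volume {y | l ≤ ‖T H y‖ₑ}) := by gcongr
      _ ≤ 5 ^ n * (q * F) + ENNReal.ofReal A ^ 2 * (2 + 2 * 22 ^ n * 21 ^ n) * (q * F) +
          ENNReal.ofReal (A * 4 ^ (n + 1)) * unitVol n * 4 ^ n * (q * F) +
          l⁻¹ * (ENNReal.ofReal A ^ 2 * ∫⁻ y in R, ‖f y‖ₑ ^ 2) := by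
        rw [mul_add, mul_add, mul_add]
        exact add_le_add (add_le_add (add_le_add hexc hgood) hbad) hrest
      _ = _ := by rw [weakConst]; ring
  refine ge_of_tendsto' (x := atTop) (f := fun m => weakConst n A * q * F +
      l⁻¹ * (ENNReal.ofReal A ^ 2 * ∫⁻ y in ⋃ i, D (i + m), ‖f y‖ₑ ^ 2)) ?_ main
  have h2 := ENNReal.Tendsto.const_mul (a := l⁻¹) (ENNReal.Tendsto.const_mul
    (a := ENNReal.ofReal A ^ 2) htail (Or.inr (by simp))) (Or.inr (by simpa using hl))
  simpa using h2.const_add (weakConst n A * q * F)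

end WeakType

/-! ### Interpolation between the weak type estimate and the `L²` bound -/

section Interpolation

variable {n N : ℕ} {Θ : Fin N → Rn n} {A : ℝ} {T : L2 n →L[ℂ] L2 n}
  {k : Fin N → Rn n × Rn n → ℂ}

theorem sqrtN_eq_ofReal (N : ℕ) : sqrtN N = ENNReal.ofReal (Real.sqrt N) := by
  rw [sqrtN, ENNReal.ofReal, Real.sqrt, Real.toNNReal_coe, Real.toNNReal_natCast]

theorem weakConst_ne_top (n : ℕ) (A : ℝ) : weakConst n A ≠ ∞ := by
  unfold weakConst
  have := unitVol_ne_top (n := n)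
  finiteness

/-- The integral over the level t, after Fubini, of the L² contribution of the small values; it
converges at infinity because s < 2. -/
theorem lintegral_rpow_tail {s a w : ℝ} (hs : s < 2) (ha : 0 < a) (hw : 0 ≤ w) :
    ∫⁻ t in Set.Ioi (0 : ℝ), (if a * w < t then
      ENNReal.ofReal (t ^ (s - 3)) * ENNReal.ofReal (w ^ 2) else 0) ≤
      ENNReal.ofReal (a ^ (s - 2) / (2 - s)) * ENNReal.ofReal (w ^ s) := by
  rcases hw.eq_or_lt with rfl | hw
  · simp
  have haw : 0 < a * w := by positivity
  calc ∫⁻ t in Set.Ioi (0 : ℝ), (if a * w < t then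
      ENNReal.ofReal (t ^ (s - 3)) * ENNReal.ofReal (w ^ 2) else 0)
      = ∫⁻ t in Set.Ioi (0 : ℝ), (Set.Ioi (a * w)).indicator
          (fun t => ENNReal.ofReal (t ^ (s - 3)) * ENNReal.ofReal (w ^ 2)) t := by
        refine lintegral_congr fun t => ?_
        simp [Set.indicator_apply]
    _ ≤ ∫⁻ t in Set.Ioi (a * w), ENNReal.ofReal (t ^ (s - 3)) * ENNReal.ofReal (w ^ 2) :=
        (setLIntegral_le_lintegral _ _).trans (lintegral_indicator measurableSet_Ioi _).le
    _ = ENNReal.ofReal (∫ t in Set.Ioi (a * w), t ^ (s - 3)) * ENNReal.ofReal (w ^ 2) := by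
        rw [lintegral_mul_const' _ _ ENNReal.ofReal_ne_top,
          ofReal_integral_eq_lintegral_ofReal (integrableOn_Ioi_rpow_of_lt (by linarith) haw)]
        filter_upwards [ae_restrict_mem measurableSet_Ioi] with t ht
        exact Real.rpow_nonneg (haw.trans ht).le _
    _ = _ := by
        rw [integral_Ioi_rpow_of_lt (by linarith) haw, show s - 3 + 1 = s - 2 by ring,
          ← ENNReal.ofReal_mul (by
            rw [neg_div, ← div_neg]; exact div_nonneg (by positivity) (by linarith)),
          ← ENNReal.ofReal_mul (div_nonneg (by positivity) (by linarith)),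
          Real.mul_rpow ha.le hw.le]
        congr 1
        rw [show w ^ s = w ^ (s - 2) * w ^ 2 by
          rw [← Real.rpow_natCast w 2, ← Real.rpow_add hw]; norm_num]
        have h1 : s - 2 ≠ 0 := by linarith
        have h2 : 2 - s ≠ 0 := by linarith
        rw [show s - 2 = -(2 - s) by ring]
        field_simp

/-- The companion for the L¹ contribution of the large values; it converges at 0 because s > 1. -/
theorem lintegral_rpow_head {s a w : ℝ} (hs : 1 < s) (ha : 0 < a) (hw : 0 ≤ w) :
    ∫⁻ t in Set.Ioi (0 : ℝ), (if t ≤ a * w then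
      ENNReal.ofReal (t ^ (s - 2)) * ENNReal.ofReal w else 0) ≤
      ENNReal.ofReal (a ^ (s - 1) / (s - 1)) * ENNReal.ofReal (w ^ s) := by
  rcases hw.eq_or_lt with rfl | hw
  · simp
  have haw : 0 < a * w := by positivity
  have hint : IntegrableOn (fun t : ℝ => t ^ (s - 2)) (Set.Ioc 0 (a * w)) :=
    (intervalIntegrable_iff_integrableOn_Ioc_of_le haw.le).1
      (intervalIntegral.intervalIntegrable_rpow' (by linarith))
  refine le_of_eq ?_
  calc ∫⁻ t in Set.Ioi (0 : ℝ), (if t ≤ a * w then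
      ENNReal.ofReal (t ^ (s - 2)) * ENNReal.ofReal w else 0)
      = ∫⁻ t in Set.Ioi (0 : ℝ), (Set.Iic (a * w)).indicator
          (fun t => ENNReal.ofReal (t ^ (s - 2)) * ENNReal.ofReal w) t := by
        refine lintegral_congr fun t => ?_
        simp [Set.indicator_apply]
    _ = ∫⁻ t in Set.Ioc 0 (a * w), ENNReal.ofReal (t ^ (s - 2)) * ENNReal.ofReal w := by
        rw [lintegral_indicator measurableSet_Iic, Measure.restrict_restrict measurableSet_Iic,
          Set.Iic_inter_Ioi]
    _ = ENNReal.ofReal (∫ t in Set.Ioc 0 (a * w), t ^ (s - 2)) * ENNReal.ofReal w := by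
        rw [lintegral_mul_const' _ _ ENNReal.ofReal_ne_top,
          ofReal_integral_eq_lintegral_ofReal hint]
        filter_upwards [ae_restrict_mem measurableSet_Ioc] with t ht
        exact Real.rpow_nonneg ht.1.le _
    _ = ENNReal.ofReal (a ^ (s - 1) / (s - 1)) * ENNReal.ofReal (w ^ s) := by
        rw [← intervalIntegral.integral_of_le haw.le, integral_rpow (Or.inl (by linarith)),
          show s - 2 + 1 = s - 1 by ring, Real.zero_rpow (by linarith), sub_zero,
          ← ENNReal.ofReal_mul (div_nonneg (by positivity) (by linarith)),
          ← ENNReal.ofReal_mul (div_nonneg (by positivity) (by linarith)),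
          Real.mul_rpow ha.le hw.le]
        congr 1
        rw [show w ^ s = w ^ (s - 1) * w by
          rw [← Real.rpow_add_one hw.ne']; norm_num]
        ring

/-- The constant in the strong type estimate below `L²`. -/
noncomputable def strongConst (n : ℕ) (A s : ℝ) : ℝ≥0∞ :=
  ENNReal.ofReal s * (4 * ENNReal.ofReal A ^ 2 * ENNReal.ofReal (6 ^ (s - 2) / (2 - s)) +
    6 * weakConst n A * ENNReal.ofReal (6 ^ (s - 1) / (s - 1)))

theorem strongConst_ne_top (n : ℕ) (A s : ℝ) : strongConst n A s ≠ ∞ := by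
  have := weakConst_ne_top n A
  unfold strongConst
  finiteness

/-- Marcinkiewicz splitting of u at height t √N / 6, with the L² bound below and the weak type bound
above. The factor √N in the height makes both contributions grow like √N^(2-s) after integration in
t. -/
theorem HasModulatedKernel.distribution_le [NeZero n] (h : HasModulatedKernel Θ A T k)
    (hN : 1 ≤ N) {s : ℝ} (hs : 1 < s) (u : L2 n)
    (hu : ∫⁻ x, ‖u x‖ₑ ^ s ≠ ∞) {t : ℝ} (ht : 0 < t) :
    volume {x | t < ‖T u x‖} * ENNReal.ofReal (t ^ (s - 1)) ≤
      ∫⁻ x, (4 * ENNReal.ofReal A ^ 2 * (if 6 / √N * ‖u x‖ < t then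
          ENNReal.ofReal (t ^ (s - 3)) * ENNReal.ofReal (‖u x‖ ^ 2) else 0) +
        6 * weakConst n A * sqrtN N * (if t ≤ 6 / √N * ‖u x‖ then
          ENNReal.ofReal (t ^ (s - 2)) * ENNReal.ofReal ‖u x‖ else 0)) := by
  have hN' : (0 : ℝ) < N := by exact_mod_cast hN
  have hm : Measurable u := (Lp.stronglyMeasurable u).measurable
  have hum : MemLp u 2 volume := Lp.memLp u
  set S : Set (Rn n) := {x | 6 / √N * ‖u x‖ < t} with hS
  have hSm : MeasurableSet S := measurableSet_lt (by fun_prop) measurable_const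
  have hS1 : MemLp (S.indicator u) 2 volume := hum.indicator hSm
  have hS2 : MemLp (Sᶜ.indicator u) 2 volume := hum.indicator hSm.compl
  have hdec : ∀ᵐ x, T u x = T (hS1.toLp _) x + T (hS2.toLp _) x := by
    have e : u = hS1.toLp _ + hS2.toLp _ := by
      refine Lp.ext ?_
      filter_upwards [Lp.coeFn_add (hS1.toLp _) (hS2.toLp _), hS1.coeFn_toLp, hS2.coeFn_toLp]
        with x h1 h2 h3
      rw [h1, Pi.add_apply, h2, h3, ← Pi.add_apply, Set.indicator_self_add_compl]
    have e2 : T u = T (hS1.toLp _) + T (hS2.toLp _) := by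
      conv_lhs => rw [e]
      rw [map_add]
    rw [e2]
    exact Lp.coeFn_add _ _
  have hlarge : ∫⁻ x, ‖hS2.toLp _ x‖ₑ = ∫⁻ x in Sᶜ, ‖u x‖ₑ := by
    rw [← lintegral_indicator hSm.compl]
    refine lintegral_congr_ae ?_
    filter_upwards [hS2.coeFn_toLp] with x hx
    rw [hx, enorm_indicator_eq_indicator_enorm]
  have hsmall : ∫⁻ x, ‖hS1.toLp _ x‖ₑ ^ 2 = ∫⁻ x in S, ‖u x‖ₑ ^ 2 := by
    rw [← eLpNorm_two_sq, ← eLpNorm_two_sq, ← eLpNorm_indicator_eq_eLpNorm_restrict hSm,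
      eLpNorm_congr_ae hS1.coeFn_toLp]
  have hlarge' : ∫⁻ x, ‖hS2.toLp _ x‖ₑ ≠ ∞ := by
    rw [hlarge]
    -- Above the cut |u| is at most a constant times |u|^s, so the large part is integrable.
    have hc : 0 < t * √N / 6 := by positivity
    refine ne_top_of_le_ne_top (ENNReal.mul_ne_top (ENNReal.ofReal_ne_top
      (r := (t * √N / 6) ^ (1 - s))) hu) ?_
    rw [← lintegral_const_mul' _ _ ENNReal.ofReal_ne_top]
    refine (setLIntegral_mono' hSm.compl fun x hx => ?_).trans (setLIntegral_le_lintegral _ _)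
    have hx : ¬ (6 / √N * ‖u x‖ < t) := hx
    have hx' : t * √N / 6 ≤ ‖u x‖ := by
      rw [not_lt, div_mul_eq_mul_div, le_div_iff₀ (by positivity)] at hx
      linarith
    have hux : 0 < ‖u x‖ := hc.trans_le hx'
    rw [← ofReal_norm, ENNReal.ofReal_rpow_of_pos hux, ← ENNReal.ofReal_mul (by positivity)]
    refine ENNReal.ofReal_le_ofReal ?_
    calc ‖u x‖ = ‖u x‖ ^ (1 - s) * ‖u x‖ ^ s := by rw [← Real.rpow_add hux]; simp
      _ ≤ (t * √N / 6) ^ (1 - s) * ‖u x‖ ^ s := by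
        gcongr ?_ * _
        exact Real.rpow_le_rpow_of_nonpos hc hx' (by linarith)
  -- The weak type bound concerns the level 3l, so l = t/6 gives the level t/2.
  have hw := h.weak_type hN (hS2.toLp _) hlarge' (l := ENNReal.ofReal (t / 6))
    (by simpa using ht) ENNReal.ofReal_ne_top
  have hl2 := h.mul_sq_volume_le (hS1.toLp _) (ENNReal.ofReal (t / 2))
  rw [hlarge, show 3 * ENNReal.ofReal (t / 6) = ENNReal.ofReal (t / 2) by
    rw [show (3 : ℝ≥0∞) = ENNReal.ofReal 3 by simp, ← ENNReal.ofReal_mul (by norm_num)]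
    ring_nf] at hw
  rw [hsmall] at hl2
  have hset : volume {x | t < ‖T u x‖} ≤ volume {x | ENNReal.ofReal (t / 2) ≤ ‖T (hS1.toLp _) x‖ₑ} +
      volume {x | ENNReal.ofReal (t / 2) < ‖T (hS2.toLp _) x‖ₑ} := by
    refine (measure_mono_ae ?_).trans (measure_union_le _ _)
    filter_upwards [hdec] with x hx hxt
    have hxt : t < ‖T u x‖ := hxt
    by_contra hcon
    have hcon : ¬ (ENNReal.ofReal (t / 2) ≤ ‖T (hS1.toLp _) x‖ₑ ∨
      ENNReal.ofReal (t / 2) < ‖T (hS2.toLp _) x‖ₑ) := hcon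
    simp only [← ofReal_norm] at hcon
    rw [ENNReal.ofReal_le_ofReal_iff (norm_nonneg _),
      ENNReal.ofReal_lt_ofReal_iff_of_nonneg (by positivity)] at hcon
    push Not at hcon
    have := norm_add_le (T (hS1.toLp _) x) (T (hS2.toLp _) x)
    rw [← hx] at this
    linarith
  have e1 : ENNReal.ofReal (t ^ (s - 1)) =
      ENNReal.ofReal (t ^ (s - 3)) * (4 * ENNReal.ofReal (t / 2) ^ 2) := by
    rw [show (4 : ℝ≥0∞) = ENNReal.ofReal 4 by simp, ← ENNReal.ofReal_pow (by positivity),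
      ← ENNReal.ofReal_mul (by positivity), ← ENNReal.ofReal_mul (by positivity)]
    congr 1
    rw [show s - 1 = (s - 3) + 2 by ring, Real.rpow_add ht, Real.rpow_two]
    ring
  have e2 : ENNReal.ofReal (t ^ (s - 1)) =
      ENNReal.ofReal (t ^ (s - 2)) * (6 * ENNReal.ofReal (t / 6)) := by
    rw [show (6 : ℝ≥0∞) = ENNReal.ofReal 6 by simp,
      ← ENNReal.ofReal_mul (by positivity), ← ENNReal.ofReal_mul (by positivity)]
    congr 1
    rw [show s - 1 = (s - 2) + 1 by ring, Real.rpow_add ht, Real.rpow_one]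
    ring
  have i1 : ∫⁻ x, (if 6 / √N * ‖u x‖ < t then
      ENNReal.ofReal (t ^ (s - 3)) * ENNReal.ofReal (‖u x‖ ^ 2) else 0) =
      ENNReal.ofReal (t ^ (s - 3)) * ∫⁻ x in S, ‖u x‖ₑ ^ 2 := by
    rw [← lintegral_const_mul' _ _ ENNReal.ofReal_ne_top, ← lintegral_indicator hSm]
    refine lintegral_congr fun x => ?_
    simp [Set.indicator_apply, hS, ENNReal.ofReal_pow]
  have i2 : ∫⁻ x, (if t ≤ 6 / √N * ‖u x‖ then
      ENNReal.ofReal (t ^ (s - 2)) * ENNReal.ofReal ‖u x‖ else 0) =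
      ENNReal.ofReal (t ^ (s - 2)) * ∫⁻ x in Sᶜ, ‖u x‖ₑ := by
    rw [← lintegral_const_mul' _ _ ENNReal.ofReal_ne_top, ← lintegral_indicator hSm.compl]
    refine lintegral_congr fun x => ?_
    simp [Set.indicator_apply, hS]
  have hW := weakConst_ne_top n A
  have hq := sqrtN_ne_top N
  rw [lintegral_add_left' (by
      refine (Measurable.ite (measurableSet_lt (by fun_prop) measurable_const) (by fun_prop)
        measurable_const).aemeasurable.const_mul _), lintegral_const_mul' _ _ (by finiteness),
    lintegral_const_mul' _ _ (by finiteness), i1, i2]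
  calc _ ≤ (volume {x | ENNReal.ofReal (t / 2) ≤ ‖T (hS1.toLp _) x‖ₑ} +
      volume {x | ENNReal.ofReal (t / 2) < ‖T (hS2.toLp _) x‖ₑ}) * ENNReal.ofReal (t ^ (s - 1)) := by
        gcongr
    _ = 4 * ENNReal.ofReal (t ^ (s - 3)) * (ENNReal.ofReal (t / 2) ^ 2 *
          volume {x | ENNReal.ofReal (t / 2) ≤ ‖T (hS1.toLp _) x‖ₑ}) +
        6 * ENNReal.ofReal (t ^ (s - 2)) * (ENNReal.ofReal (t / 6) *
          volume {x | ENNReal.ofReal (t / 2) < ‖T (hS2.toLp _) x‖ₑ}) := by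
        rw [add_mul]
        nth_rewrite 1 [e1]
        rw [e2]
        ring
    _ ≤ 4 * ENNReal.ofReal (t ^ (s - 3)) * (ENNReal.ofReal A ^ 2 * ∫⁻ x in S, ‖u x‖ₑ ^ 2) +
        6 * ENNReal.ofReal (t ^ (s - 2)) *
          (weakConst n A * sqrtN N * ∫⁻ x in Sᶜ, ‖u x‖ₑ) := by gcongr
    _ = _ := by ring

/-- The strong type estimate for exponents between `1` and `2`. -/
theorem HasModulatedKernel.lintegral_rpow_le [NeZero n] (h : HasModulatedKernel Θ A T k)
    (hN : 1 ≤ N) {s : ℝ} (hs : 1 < s) (hs2 : s < 2) (u : L2 n)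
    (hu : ∫⁻ x, ‖u x‖ₑ ^ s ≠ ∞) :
    ∫⁻ x, ‖T u x‖ₑ ^ s ≤ strongConst n A s * sqrtN N ^ (2 - s) * ∫⁻ x, ‖u x‖ₑ ^ s := by
  have hN' : (0 : ℝ) < N := by exact_mod_cast hN
  have hq : 0 < √(N : ℝ) := by positivity
  have hm : Measurable u := (Lp.stronglyMeasurable u).measurable
  have hTm : Measurable (T u) := (Lp.stronglyMeasurable (T u)).measurable
  have hW := weakConst_ne_top n A
  have hqt := sqrtN_ne_top N
  set W := weakConst n A with hWdef
  let I₁ : ℝ → Rn n → ℝ≥0∞ := fun t x => if 6 / √N * ‖u x‖ < t then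
    ENNReal.ofReal (t ^ (s - 3)) * ENNReal.ofReal (‖u x‖ ^ 2) else 0
  let I₂ : ℝ → Rn n → ℝ≥0∞ := fun t x => if t ≤ 6 / √N * ‖u x‖ then
    ENNReal.ofReal (t ^ (s - 2)) * ENNReal.ofReal ‖u x‖ else 0
  have hI₁ : Measurable (Function.uncurry I₁) := by
    refine Measurable.ite (measurableSet_lt (by fun_prop) measurable_fst) ?_ measurable_const
    fun_prop
  have hI₂ : Measurable (Function.uncurry I₂) := by
    refine Measurable.ite (measurableSet_le measurable_fst (by fun_prop)) ?_ measurable_const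
    fun_prop
  have hpow : ∀ z : ℂ, ENNReal.ofReal (‖z‖ ^ s) = ‖z‖ₑ ^ s := fun z => by
    rw [← ENNReal.ofReal_rpow_of_nonneg (norm_nonneg _) (by linarith), ofReal_norm]
  have hcake := lintegral_rpow_eq_lintegral_meas_lt_mul volume (f := fun x => ‖T u x‖)
    (ae_of_all _ fun _ => norm_nonneg _) (by fun_prop) (p := s) (by linarith)
  simp only [hpow] at hcake
  rw [hcake]
  calc _ ≤ ENNReal.ofReal s * ∫⁻ t in Set.Ioi (0 : ℝ), ∫⁻ x,
        (4 * ENNReal.ofReal A ^ 2 * I₁ t x + 6 * W * sqrtN N * I₂ t x) := by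
        refine mul_le_mul_right (setLIntegral_mono' measurableSet_Ioi fun t ht => ?_) _
        exact h.distribution_le hN hs u hu ht
    _ = ENNReal.ofReal s * ∫⁻ x, ∫⁻ t in Set.Ioi (0 : ℝ),
        (4 * ENNReal.ofReal A ^ 2 * I₁ t x + 6 * W * sqrtN N * I₂ t x) := by
        rw [lintegral_lintegral_swap]
        exact ((hI₁.const_mul _).add (hI₂.const_mul _)).aemeasurable
    _ ≤ ENNReal.ofReal s * ∫⁻ x,
        (4 * ENNReal.ofReal A ^ 2 * (ENNReal.ofReal ((6 / √N) ^ (s - 2) / (2 - s)) * ‖u x‖ₑ ^ s) +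
          6 * W * sqrtN N * (ENNReal.ofReal ((6 / √N) ^ (s - 1) / (s - 1)) * ‖u x‖ₑ ^ s)) := by
        gcongr with x
        have m1 : Measurable fun t => I₁ t x := hI₁.comp measurable_prodMk_right
        rw [lintegral_add_left (m1.const_mul _), lintegral_const_mul' _ _ (by finiteness),
          lintegral_const_mul' _ _ (by finiteness)]
        rw [← hpow]
        gcongr
        · exact lintegral_rpow_tail hs2 (by positivity) (norm_nonneg _)
        · exact lintegral_rpow_head hs (by positivity) (norm_nonneg _)
    _ = ENNReal.ofReal s * (4 * ENNReal.ofReal A ^ 2 * ENNReal.ofReal ((6 / √N) ^ (s - 2) / (2 - s)) +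
          6 * W * sqrtN N * ENNReal.ofReal ((6 / √N) ^ (s - 1) / (s - 1))) *
          ∫⁻ x, ‖u x‖ₑ ^ s := by
        simp only [← mul_assoc, ← add_mul]
        rw [lintegral_const_mul' _ _ (by finiteness)]
        ring
    _ = _ := by
        congr 1
        have e0 : sqrtN N ^ (2 - s) = ENNReal.ofReal (√N ^ (2 - s)) := by
          rw [sqrtN_eq_ofReal, ENNReal.ofReal_rpow_of_pos hq]
        have e1 : ENNReal.ofReal ((6 / √N) ^ (s - 2) / (2 - s)) =
            ENNReal.ofReal (6 ^ (s - 2) / (2 - s)) * sqrtN N ^ (2 - s) := by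
          rw [e0, ← ENNReal.ofReal_mul (div_nonneg (by positivity) (by linarith))]
          congr 1
          rw [Real.div_rpow (by norm_num) hq.le, show 2 - s = -(s - 2) by ring,
            Real.rpow_neg hq.le]
          ring
        have e2 : sqrtN N * ENNReal.ofReal ((6 / √N) ^ (s - 1) / (s - 1)) =
            ENNReal.ofReal (6 ^ (s - 1) / (s - 1)) * sqrtN N ^ (2 - s) := by
          rw [e0, sqrtN_eq_ofReal, ← ENNReal.ofReal_mul hq.le,
            ← ENNReal.ofReal_mul (div_nonneg (by positivity) (by linarith))]
          congr 1
          rw [Real.div_rpow (by norm_num) hq.le, show 2 - s = 1 + -(s - 1) by ring,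
            Real.rpow_add hq, Real.rpow_one, Real.rpow_neg hq.le]
          ring
        rw [strongConst, ← hWdef, e1, mul_assoc (6 * W), e2]
        ring

end Interpolation

/-! ### Boundedness on `L^s` -/

section StrongType

variable {n N : ℕ} {Θ : Fin N → Rn n} {A : ℝ} {T : L2 n →L[ℂ] L2 n}
  {k : Fin N → Rn n × Rn n → ℂ}

theorem eLpNorm_ofReal {α : Type*} [MeasurableSpace α] {s : ℝ} (hs : 0 < s) (f : α → ℂ)
    (μ : Measure α) :
    eLpNorm f (ENNReal.ofReal s) μ = (∫⁻ x, ‖f x‖ₑ ^ s ∂μ) ^ (1 / s) := by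
  rw [eLpNorm_eq_lintegral_rpow_enorm_toReal (by simpa using hs) ENNReal.ofReal_ne_top,
    ENNReal.toReal_ofReal hs.le]

theorem eLpNorm_ofReal_rpow {α : Type*} [MeasurableSpace α] {s : ℝ} (hs : 0 < s) (f : α → ℂ)
    (μ : Measure α) :
    eLpNorm f (ENNReal.ofReal s) μ ^ s = ∫⁻ x, ‖f x‖ₑ ^ s ∂μ := by
  rw [eLpNorm_ofReal hs, ← ENNReal.rpow_mul, one_div_mul_cancel hs.ne', ENNReal.rpow_one]

theorem one_le_natCast_rpow {N : ℕ} (hN : 1 ≤ N) {e : ℝ} (he : 0 ≤ e) :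
    1 ≤ (N : ℝ≥0∞) ^ e := by
  simpa using ENNReal.rpow_le_rpow (show (1 : ℝ≥0∞) ≤ N by exact_mod_cast hN) he

theorem natCast_rpow_ne_top {N : ℕ} {e : ℝ} (he : 0 ≤ e) : (N : ℝ≥0∞) ^ e ≠ ∞ :=
  ENNReal.rpow_ne_top_of_nonneg he (ENNReal.natCast_ne_top N)

/-- Bounds on `L^s` for `1 < s < 2`. -/
theorem HasModulatedKernel.eLpNorm_apply_le_of_lt_two [NeZero n] (h : HasModulatedKernel Θ A T k)
    (hN : 1 ≤ N) {s : ℝ} (hs : 1 < s) (hs2 : s < 2) (u : L2 n) :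
    eLpNorm (T u) (ENNReal.ofReal s) volume ≤
      max 1 (strongConst n A s ^ (1 / s)) * (N : ℝ≥0∞) ^ (1 / s - 1 / 2) *
        eLpNorm u (ENNReal.ofReal s) volume := by
  have hs0 : 0 < s := by linarith
  have he : 0 ≤ 1 / s - 1 / 2 := by
    rw [sub_nonneg]; exact one_div_le_one_div_of_le hs0 hs2.le
  rcases eq_or_ne (eLpNorm u (ENNReal.ofReal s) volume) ∞ with htop | htop
  · rw [htop, ENNReal.mul_top]
    · exact le_top
    · refine mul_ne_zero (zero_lt_one.trans_le (le_max_left _ _)).ne' ?_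
      exact (zero_lt_one.trans_le (one_le_natCast_rpow hN he)).ne'
  have hu : ∫⁻ x, ‖u x‖ₑ ^ s ≠ ∞ := by
    rw [← eLpNorm_ofReal_rpow hs0]
    exact ENNReal.rpow_ne_top_of_nonneg hs0.le htop
  rw [eLpNorm_ofReal hs0, eLpNorm_ofReal hs0]
  calc (∫⁻ x, ‖T u x‖ₑ ^ s) ^ (1 / s)
      ≤ (strongConst n A s * sqrtN N ^ (2 - s) * ∫⁻ x, ‖u x‖ₑ ^ s) ^ (1 / s) := by
        gcongr; exact h.lintegral_rpow_le hN hs hs2 u hu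
    _ = strongConst n A s ^ (1 / s) * (N : ℝ≥0∞) ^ (1 / s - 1 / 2) *
          (∫⁻ x, ‖u x‖ₑ ^ s) ^ (1 / s) := by
        rw [ENNReal.mul_rpow_of_nonneg _ _ (by positivity),
          ENNReal.mul_rpow_of_nonneg _ _ (by positivity), sqrtN_eq_rpow, ← ENNReal.rpow_mul,
          ← ENNReal.rpow_mul]
        congr 3
        field_simp
    _ ≤ _ := by gcongr; exact le_max_right _ _

/-- Bounds on `L^s` for `2 < s`, by duality. -/
theorem HasModulatedKernel.eLpNorm_apply_le_of_two_lt [NeZero n] (h : HasModulatedKernel Θ A T k)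
    (hN : 1 ≤ N) {s p : ℝ} (hs2 : 2 < s) (hp : s.HolderConjugate p) (u : L2 n) :
    eLpNorm (T u) (ENNReal.ofReal s) volume ≤
      max 1 (strongConst n A p ^ (1 / p)) * (N : ℝ≥0∞) ^ (1 / p - 1 / 2) *
        eLpNorm u (ENNReal.ofReal s) volume := by
  have hs0 : 0 < s := by linarith
  have hp1 : 1 < p := hp.symm.lt
  have hp0 : 0 < p := by linarith
  have hsp : s⁻¹ + p⁻¹ = 1 := hp.inv_add_inv_eq_one
  have hp2 : p < 2 := by
    have h1 : s⁻¹ < 2⁻¹ := inv_strictAnti₀ two_pos hs2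
    have h2 : (2 : ℝ)⁻¹ < p⁻¹ := by linarith
    exact (inv_lt_inv₀ two_pos hp0).1 h2
  set M := max 1 (strongConst n A p ^ (1 / p)) * (N : ℝ≥0∞) ^ (1 / p - 1 / 2) *
        eLpNorm u (ENNReal.ofReal s) volume with hM
  set v : L2 n := T u with hv
  have hvm : Measurable v := (Lp.stronglyMeasurable v).measurable
  let B : ℕ → Set (Rn n) := fun m => {x | ‖v x‖ ≤ m}
  have hBm : ∀ m, MeasurableSet (B m) := fun m => measurableSet_le (by fun_prop) measurable_const
  -- Truncating to {|v| ≤ m} makes J finite, since |v|^s ≤ m^(s-2) |v|² there; this permits dividing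
  -- by J^(1/p) at the end.
  have key : ∀ m, (∫⁻ x in B m, ‖v x‖ₑ ^ s) ≤ M ^ s := by
    intro m
    set J := ∫⁻ x in B m, ‖v x‖ₑ ^ s with hJ
    have hJt : J ≠ ∞ := by
      refine ne_top_of_le_ne_top (ENNReal.mul_ne_top (ENNReal.rpow_ne_top_of_nonneg
        (y := s - 2) (by linarith) (ENNReal.natCast_ne_top m))
        (ENNReal.pow_ne_top (n := 2) (Lp.memLp v).2.ne)) ?_
      rw [eLpNorm_two_sq, ← lintegral_const_mul' _ _ (ENNReal.rpow_ne_top_of_nonneg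
        (by linarith) (ENNReal.natCast_ne_top m))]
      refine (setLIntegral_mono' (hBm m) fun x hx => ?_).trans (setLIntegral_le_lintegral _ _)
      have hx : ‖v x‖ ≤ m := hx
      have hx' : ‖v x‖ₑ ≤ m := by
        rw [← ofReal_norm, ← ENNReal.ofReal_natCast]; exact ENNReal.ofReal_le_ofReal hx
      calc ‖v x‖ₑ ^ s = ‖v x‖ₑ ^ (s - 2) * ‖v x‖ₑ ^ (2 : ℝ) := by
            rw [← ENNReal.rpow_add_of_nonneg _ _ (by linarith) (by norm_num)]; norm_num
        _ ≤ _ := by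
            rw [ENNReal.rpow_two]
            gcongr
    -- The extremal function of Hölder's inequality: |g|^p = |v|^s on the truncation set, and the
    -- pairing of g with v is J. Moving T to the other side gives J ≤ M J^(1/p).
    let g : Rn n → ℂ := (B m).indicator fun x => ((‖v x‖ ^ (s - 2) : ℝ) : ℂ) * v x
    have hgm : Measurable g := Measurable.indicator (by fun_prop) (hBm m)
    have hg : MemLp g 2 volume := by
      refine MemLp.of_le_mul (c := (m : ℝ) ^ (s - 2)) (Lp.memLp v) hgm.aestronglyMeasurable
        (ae_of_all _ fun x => ?_)
      by_cases hx : x ∈ B m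
      · have hx' : ‖v x‖ ≤ m := hx
        simp only [g, Set.indicator_of_mem hx, norm_mul, Complex.norm_real]
        rw [Real.norm_of_nonneg (by positivity)]
        gcongr
      · simp only [g, Set.indicator_of_notMem hx, norm_zero]
        positivity
    have hgn : ∀ x, ‖g x‖ₑ ^ p = (B m).indicator (fun x => ‖v x‖ₑ ^ s) x := by
      intro x
      by_cases hx : x ∈ B m
      · simp only [g, Set.indicator_of_mem hx]
        rw [enorm_mul, ← ofReal_norm, Complex.norm_real, Real.norm_of_nonneg (by positivity),
          ← ENNReal.ofReal_rpow_of_nonneg (norm_nonneg _) (by linarith), ofReal_norm]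
        nth_rewrite 2 [← ENNReal.rpow_one ‖v x‖ₑ]
        rw [← ENNReal.rpow_add_of_nonneg _ _ (by linarith) (by norm_num), ← ENNReal.rpow_mul]
        congr 1
        have := hp.sub_one_mul_conj
        linarith
      · simp [g, hx, hp0]
    have hgJ : eLpNorm g (ENNReal.ofReal p) volume = J ^ (1 / p) := by
      rw [eLpNorm_ofReal hp0]
      simp only [hgn]
      rw [lintegral_indicator (hBm m)]
    have hpair : J ≤ M * J ^ (1 / p) := by
      have h1 : inner ℂ (hg.toLp g) v = ((∫ x in B m, ‖v x‖ ^ s : ℝ) : ℂ) := by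
        rw [L2.inner_def, ← integral_complex_ofReal, ← integral_indicator (hBm m)]
        refine integral_congr_ae ?_
        filter_upwards [hg.coeFn_toLp] with x hx
        rw [hx, RCLike.inner_apply]
        by_cases hxB : x ∈ B m
        · simp only [g, Set.indicator_of_mem hxB, map_mul, Complex.conj_ofReal]
          rw [mul_left_comm, Complex.mul_conj', ← Complex.ofReal_pow, ← Complex.ofReal_mul]
          congr 1
          rcases eq_or_ne (v x) 0 with h0 | h0
          · simp [h0, hs0.ne']
          · rw [← Real.rpow_two, ← Real.rpow_add (by positivity)]; norm_num
        · simp [g, hxB]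
      have h2 : J = ‖inner ℂ (hg.toLp g) v‖ₑ := by
        have hpow : ∀ x, ‖v x‖ₑ ^ s = ENNReal.ofReal (‖v x‖ ^ s) := fun x => by
          rw [← ENNReal.ofReal_rpow_of_nonneg (norm_nonneg _) (by linarith), ofReal_norm]
        rw [h1, ← ofReal_norm, Complex.norm_real, Real.norm_of_nonneg
          (integral_nonneg fun x => by positivity), integral_eq_lintegral_of_nonneg_ae
          (ae_of_all _ fun x => by positivity)
          (hvm.norm.pow_const s).aestronglyMeasurable, ENNReal.ofReal_toReal]
        · simp only [hJ, hpow]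
        · simpa only [hJ, hpow] using hJt
      have h3 : inner ℂ (hg.toLp g) v =
          inner ℂ (ContinuousLinearMap.adjoint T (hg.toLp g)) u := by
        rw [ContinuousLinearMap.adjoint_inner_left]
      set w := ContinuousLinearMap.adjoint T (hg.toLp g) with hw
      have h4 : ‖inner ℂ w u‖ₑ ≤ ∫⁻ x, ‖w x‖ₑ * ‖u x‖ₑ := by
        rw [L2.inner_def]
        refine (enorm_integral_le_lintegral_enorm _).trans (lintegral_mono fun x => ?_)
        rw [RCLike.inner_apply, enorm_mul, RCLike.enorm_conj, mul_comm]
      have h5 : ∫⁻ x, ‖w x‖ₑ * ‖u x‖ₑ ≤ eLpNorm w (ENNReal.ofReal p) volume *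
          eLpNorm u (ENNReal.ofReal s) volume := by
        rw [eLpNorm_ofReal hp0, eLpNorm_ofReal hs0]
        exact ENNReal.lintegral_mul_le_Lp_mul_Lq volume hp.symm
          (Lp.aestronglyMeasurable w).enorm (Lp.aestronglyMeasurable u).enorm
      have h6 := h.adjoint.eLpNorm_apply_le_of_lt_two hN hp1 hp2 (hg.toLp g)
      rw [eLpNorm_congr_ae hg.coeFn_toLp, hgJ] at h6
      calc J = ‖inner ℂ w u‖ₑ := by rw [h2, h3]
        _ ≤ eLpNorm w (ENNReal.ofReal p) volume * eLpNorm u (ENNReal.ofReal s) volume :=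
          h4.trans h5
        _ ≤ (max 1 (strongConst n A p ^ (1 / p)) * (N : ℝ≥0∞) ^ (1 / p - 1 / 2) * J ^ (1 / p)) *
          eLpNorm u (ENNReal.ofReal s) volume := by gcongr
        _ = _ := by rw [hM]; ring
    rcases eq_or_ne J 0 with h0 | h0
    · rw [h0]; exact zero_le
    · have h7 : J ^ (1 / s) ≤ M := by
        have h8 : J ^ (1 / p) ≠ 0 := by simp [h0, hJt]
        have h9 : J ^ (1 / p) ≠ ∞ := ENNReal.rpow_ne_top_of_nonneg (by positivity) hJt
        rw [← ENNReal.mul_le_mul_iff_left h8 h9, ← ENNReal.rpow_add _ _ h0 hJt, one_div, one_div,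
          hsp, ENNReal.rpow_one, ← one_div]
        exact hpair
      calc J = (J ^ (1 / s)) ^ s := by
            rw [← ENNReal.rpow_mul, one_div_mul_cancel hs0.ne', ENNReal.rpow_one]
        _ ≤ M ^ s := by gcongr
  have hU : ⋃ m, B m = Set.univ := by
    refine Set.eq_univ_of_forall fun x => Set.mem_iUnion.2 ?_
    exact exists_nat_ge ‖v x‖
  have hlim : ∫⁻ x, ‖v x‖ₑ ^ s ≤ M ^ s := by
    rw [← setLIntegral_univ, ← hU, setLIntegral_iUnion_of_directed]
    · exact iSup_le key
    · refine directed_of_isDirected_le fun a b hab x hx => ?_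
      exact le_trans (show ‖v x‖ ≤ a from hx) (by exact_mod_cast hab)
  calc eLpNorm v (ENNReal.ofReal s) volume = (∫⁻ x, ‖v x‖ₑ ^ s) ^ (1 / s) := eLpNorm_ofReal hs0 _ _
    _ ≤ (M ^ s) ^ (1 / s) := by gcongr
    _ = M := by rw [← ENNReal.rpow_mul, mul_one_div_cancel hs0.ne', ENNReal.rpow_one]

/-- Operators with a modulated kernel are bounded on `L^s`, with the constant
`N ^ |1 / s - 1 / 2|`. -/
theorem exists_strong_type (n : ℕ) [NeZero n] (A : ℝ) {s : ℝ} (hs : 1 < s) :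
    ∃ C : ℝ≥0, 1 ≤ C ∧ ∀ (N : ℕ) (Θ : Fin N → Rn n) (T : L2 n →L[ℂ] L2 n)
      (k : Fin N → Rn n × Rn n → ℂ), 1 ≤ N → HasModulatedKernel Θ A T k → ∀ u : L2 n,
        eLpNorm (T u) (ENNReal.ofReal s) volume ≤
          C * (N : ℝ≥0∞) ^ |1 / s - 1 / 2| * eLpNorm u (ENNReal.ofReal s) volume := by
  have hs0 : 0 < s := by linarith
  have aux : ∀ p : ℝ, 1 < p → ∃ C : ℝ≥0, 1 ≤ C ∧
      (C : ℝ≥0∞) = max 1 (strongConst n A p ^ (1 / p)) := by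
    intro p hp
    have : max 1 (strongConst n A p ^ (1 / p)) ≠ ∞ :=
      (max_lt ENNReal.one_lt_top (ENNReal.rpow_ne_top_of_nonneg (by positivity)
        (strongConst_ne_top n A p)).lt_top).ne
    refine ⟨(max 1 (strongConst n A p ^ (1 / p))).toNNReal, ?_, ENNReal.coe_toNNReal this⟩
    rw [← ENNReal.one_le_coe_iff, ENNReal.coe_toNNReal this]
    exact le_max_left _ _
  rcases lt_trichotomy s 2 with h2 | rfl | h2
  · obtain ⟨C, hC, hCe⟩ := aux s hs
    refine ⟨C, hC, fun N Θ T k hN h u => ?_⟩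
    rw [hCe, abs_of_nonneg (by
      rw [sub_nonneg]; exact one_div_le_one_div_of_le hs0 h2.le)]
    exact h.eLpNorm_apply_le_of_lt_two hN hs h2 u
  · refine ⟨max 1 A.toNNReal, le_max_left _ _, fun N Θ T k hN h u => ?_⟩
    simp only [sub_self, abs_zero, ENNReal.rpow_zero, mul_one, ENNReal.ofReal_ofNat]
    refine (h.enorm_apply_le u).trans ?_
    gcongr
    exact ENNReal.coe_le_coe.2 (le_max_right _ _)
  · have hp := Real.HolderConjugate.conjExponent hs
    obtain ⟨C, hC, hCe⟩ := aux _ hp.symm.lt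
    refine ⟨C, hC, fun N Θ T k hN h u => ?_⟩
    -- The points 1/s and 1/p are symmetric about 1/2, so duality preserves the exponent of N.
    have e : |1 / s - 1 / 2| = 1 / s.conjExponent - 1 / 2 := by
      rw [abs_of_nonpos (by rw [sub_nonpos]; exact one_div_le_one_div_of_le two_pos h2.le)]
      have := hp.inv_add_inv_eq_one
      simp only [one_div]
      linarith
    rw [hCe, e]
    exact h.eLpNorm_apply_le_of_two_lt hN h2 hp u

end StrongType

/-! ### The pointwise estimate -/

section Pointwise

variable {n N : ℕ} {Θ : Fin N → Rn n} {A : ℝ} {T : L2 n →L[ℂ] L2 n}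
  {k : Fin N → Rn n × Rn n → ℂ}

theorem tendsto_eLpNorm_indicator_sub {α : Type*} [MeasurableSpace α] {μ : Measure α} {s : ℝ}
    (hs : 0 < s) {f : α → ℂ} (hf : MemLp f (ENNReal.ofReal s) μ) {S : ℕ → Set α}
    (hSm : ∀ m, MeasurableSet (S m)) (hS : ∀ x, ∀ᶠ m in atTop, x ∈ S m) :
    Tendsto (fun m => eLpNorm ((S m).indicator f - f) (ENNReal.ofReal s) μ) atTop (𝓝 0) := by
  have hlim : Tendsto (fun m => ∫⁻ x, ‖((S m).indicator f - f) x‖ₑ ^ s ∂μ) atTop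
      (𝓝 (∫⁻ _, 0 ∂μ)) := by
    refine tendsto_lintegral_of_dominated_convergence' (fun x => ‖f x‖ₑ ^ s) (fun m => ?_)
      (fun m => ae_of_all _ fun x => ?_) ?_ (ae_of_all _ fun x => ?_)
    · exact ((hf.1.indicator (hSm m)).sub hf.1).enorm.pow_const s
    · by_cases hx : x ∈ S m <;> simp [hx, hs]
    · rw [← eLpNorm_ofReal_rpow hs]
      exact ENNReal.rpow_ne_top_of_nonneg hs.le hf.2.ne
    · refine tendsto_const_nhds.congr' ?_
      filter_upwards [hS x] with m hm
      simp [hm, hs]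
  rw [lintegral_zero] at hlim
  simp only [eLpNorm_ofReal hs]
  have := ((ENNReal.continuous_rpow_const (y := 1 / s)).tendsto 0).comp hlim
  simpa [Function.comp_def, hs] using this

theorem eventually_mem_ball_natCast (c x : Rn n) : ∀ᶠ m : ℕ in atTop, x ∈ ball c m := by
  filter_upwards [eventually_gt_atTop ⌈dist x c⌉₊] with m hm
  exact mem_ball.2 ((Nat.le_ceil _).trans_lt (by exact_mod_cast hm))

/-- Uniform approximation on a ball by exponential sums is preserved under `L²` limits. -/
theorem exists_expSpan_enorm_sub_le_of_tendsto {c : Rn n} {r : ℝ} {D : ℝ≥0∞} (hD : D ≠ ∞)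
    {v : ℕ → L2 n} {v₀ : L2 n} (hv : Tendsto v atTop (𝓝 v₀)) {φ : ℕ → Rn n → ℂ}
    (hφ : ∀ m, φ m ∈ expSpan Θ)
    (hle : ∀ m, ∀ᵐ z ∂volume.restrict (ball c r), ‖v m z - φ m z‖ₑ ≤ D) :
    ∃ φ₀ ∈ expSpan Θ, ∀ᵐ z ∂volume.restrict (ball c r), ‖v₀ z - φ₀ z‖ₑ ≤ D := by
  set μ := volume.restrict (ball c r) with hμ
  have hfin : IsFiniteMeasure μ := isFiniteMeasure_restrict.2 (volume_ball_ne_top c r)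
  let W := LinearMap.range (restrictL2 Θ c r)
  -- The approximating exponential sums stay bounded in a finite dimensional space, so a subsequence
  -- of their restrictions converges to an element of the same range.
  have : ProperSpace W := FiniteDimensional.proper ℂ W
  let ψ : ℕ → W := fun m => ⟨restrictL2 Θ c r ⟨φ m, hφ m⟩, ⟨_, rfl⟩⟩
  have hψae : ∀ m, ((ψ m : W) : Lp ℂ 2 μ) =ᵐ[μ] φ m := fun m =>
    coeFn_restrictL2 Θ c r ⟨φ m, hφ m⟩
  obtain ⟨B, hB⟩ := (Metric.isBounded_range_of_tendsto v hv).exists_norm_le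
  have hbd : ∃ B' : ℝ, ∀ m, ‖ψ m‖ ≤ B' := by
    set E : ℝ≥0∞ := ENNReal.ofReal B + D • μ Set.univ ^ (2 : ℝ≥0∞).toReal⁻¹ with hE
    have hEt : E ≠ ∞ := by
      refine ENNReal.add_ne_top.2 ⟨ENNReal.ofReal_ne_top, ENNReal.mul_ne_top hD ?_⟩
      exact ENNReal.rpow_ne_top_of_nonneg (by positivity) (measure_ne_top μ _)
    refine ⟨E.toReal, fun m => ?_⟩
    have h1 : ‖ψ m‖ₑ ≤ E := by
      have e : ‖ψ m‖ₑ = eLpNorm (φ m) 2 μ := by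
        rw [← eLpNorm_congr_ae (hψae m), ← Lp.enorm_def]; rfl
      have h2 : φ m = ⇑(v m) - (⇑(v m) - φ m) := by simp
      have hm1 : AEStronglyMeasurable (v m) μ := (Lp.aestronglyMeasurable (v m)).restrict
      rw [e, h2]
      refine (eLpNorm_sub_le hm1 (hm1.sub
        (continuous_of_mem_expSpan (hφ m)).aestronglyMeasurable) one_le_two).trans ?_
      refine add_le_add ?_ (eLpNorm_le_of_ae_enorm_bound (hle m))
      refine (eLpNorm_mono_measure _ Measure.restrict_le_self).trans ?_
      rw [← Lp.enorm_def, ← ofReal_norm]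
      exact ENNReal.ofReal_le_ofReal (hB _ ⟨m, rfl⟩)
    rw [← toReal_enorm]
    exact ENNReal.toReal_mono hEt h1
  obtain ⟨B', hB'⟩ := hbd
  obtain ⟨a, -, σ, hσ, hlim⟩ := tendsto_subseq_of_bounded (s := closedBall (0 : W) B')
    isBounded_closedBall (x := ψ) fun m => by simpa using hB' m
  obtain ⟨φ₀, hφ₀⟩ := a.2
  have haae : ((a : W) : Lp ℂ 2 μ) =ᵐ[μ] φ₀.1 := by
    rw [← hφ₀]; exact coeFn_restrictL2 Θ c r φ₀
  refine ⟨φ₀.1, φ₀.2, ?_⟩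
  have h1 : Tendsto (fun j => eLpNorm (⇑(v (σ j)) - ⇑v₀) 2 μ) atTop (𝓝 0) := by
    have h2 := (Lp.tendsto_Lp_iff_tendsto_eLpNorm' _ _).1 (hv.comp hσ.tendsto_atTop)
    exact tendsto_of_tendsto_of_tendsto_of_le_of_le tendsto_const_nhds h2 (fun _ => zero_le)
      fun j => eLpNorm_mono_measure _ Measure.restrict_le_self
  have h2 : Tendsto (fun j => eLpNorm (φ (σ j) - φ₀.1) 2 μ) atTop (𝓝 0) := by
    have h3 : Tendsto (fun j => ((ψ (σ j) : W) : Lp ℂ 2 μ)) atTop (𝓝 (a : Lp ℂ 2 μ)) :=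
      (continuous_subtype_val.tendsto a).comp hlim
    have h4 := (Lp.tendsto_Lp_iff_tendsto_eLpNorm' _ _).1 h3
    refine h4.congr fun j => eLpNorm_congr_ae ?_
    exact (hψae (σ j)).sub haae
  have h3 : Tendsto (fun j => eLpNorm ((⇑(v (σ j)) - φ (σ j)) - (⇑v₀ - φ₀.1)) 2 μ) atTop (𝓝 0) := by
    have h4 := h1.add h2
    rw [add_zero] at h4
    refine tendsto_of_tendsto_of_tendsto_of_le_of_le tendsto_const_nhds h4 (fun _ => zero_le)
      fun j => ?_
    rw [sub_sub_sub_comm]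
    refine eLpNorm_sub_le ?_ ?_ one_le_two
    · exact ((Lp.aestronglyMeasurable _).sub (Lp.aestronglyMeasurable _)).restrict
    · exact ((continuous_of_mem_expSpan (hφ _)).sub
        (continuous_of_mem_expSpan φ₀.2)).aestronglyMeasurable
  have hmeas : ∀ w : L2 n, ∀ ψ ∈ expSpan Θ, AEStronglyMeasurable (⇑w - ψ) μ :=
    fun w ψ hψ => (Lp.aestronglyMeasurable w).restrict.sub
      (continuous_of_mem_expSpan hψ).aestronglyMeasurable
  obtain ⟨τ, -, hτ⟩ := (tendstoInMeasure_of_tendsto_eLpNorm two_ne_zero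
    (fun j => hmeas _ _ (hφ _)) (hmeas _ _ φ₀.2) h3).exists_seq_tendsto_ae
  filter_upwards [hτ, ae_all_iff.2 hle] with z hz hz'
  exact le_of_tendsto' hz.enorm fun j => hz' _

/-- The image of a function supported far from a ball is close to an exponential sum on it. -/
theorem HasModulatedKernel.exists_expSpan_enorm_sub_le (h : HasModulatedKernel Θ A T k)
    {c : Rn n} {ρ : ℝ} (hρ : 0 < ρ) {w : Rn n → ℂ} (hw : MemLp w 2 volume)
    (hc : HasCompactSupport w) (hw0 : ∀ y ∈ ball c (2 * ρ), w y = 0) :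
    ∃ φ ∈ expSpan Θ, ∀ᵐ z ∂volume.restrict (ball c ρ), ‖T (hw.toLp w) z - φ z‖ₑ ≤
      ENNReal.ofReal (A * 2 ^ (n + 1)) *
        ∫⁻ y in (ball c (2 * ρ))ᶜ, ENNReal.ofReal (2 * ρ / dist y c ^ (n + 1)) * ‖w y‖ₑ := by
  have hA := h.nonneg
  have hts : tsupport w ⊆ (ball c (2 * ρ))ᶜ :=
    closure_minimal (fun y hy hy' => hy (hw0 y hy')) isOpen_ball.isClosed_compl
  -- The value of T w with the demodulated kernels frozen at the centre c in the first variable.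
  set φ : Rn n → ℂ := ∑ j, (∫ y, character (Θ j) (-y) * k j (c, y) * w y) • character (Θ j)
    with hφ
  have hcont : ∀ z ∈ ball c (2 * ρ), ∀ j, ContinuousOn (fun y => k j (z, y)) (tsupport w) := by
    intro z hz j y hy
    have hne : z ≠ y := fun e => hts hy (e ▸ hz)
    exact ((h.differentiableAt j z y hne).continuousAt.comp (f := fun y => (z, y))
      (by fun_prop)).continuousWithinAt
  refine ⟨φ, Submodule.sum_mem _ fun j _ => Submodule.smul_mem _ _ (character_mem_expSpan Θ j), ?_⟩
  rw [ae_restrict_iff' measurableSet_ball]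
  filter_upwards [h.off_diag w hw hc] with z hz hzb
  have hz2 : z ∈ ball c (2 * ρ) := ball_subset_ball (by linarith) hzb
  rw [hz fun hzt => hts hzt hz2]
  have hchar : ∀ (ξ x : Rn n), Continuous fun y => character ξ (x - y) := fun ξ x =>
    (continuous_character ξ).comp (continuous_const.sub continuous_id)
  have hint1 : Integrable fun y => combinedKernel Θ k z y * w y :=
    integrable_mul_of_continuousOn hw hc (continuousOn_finsetSum _ fun j _ =>
      (hchar _ _).continuousOn.mul (hcont z hz2 j))
  have hint2 : ∀ j, Integrable fun y => character (Θ j) (z - y) * k j (c, y) * w y := fun j =>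
    integrable_mul_of_continuousOn hw hc
      ((hchar _ _).continuousOn.mul (hcont c (mem_ball_self (by positivity)) j))
  have e1 : φ z = ∫ y, ∑ j, character (Θ j) (z - y) * k j (c, y) * w y := by
    rw [integral_finsetSum _ fun j _ => hint2 j, hφ, Finset.sum_apply]
    refine Finset.sum_congr rfl fun j _ => ?_
    rw [Pi.smul_apply, smul_eq_mul, ← integral_mul_const]
    congr 1
    ext y
    rw [sub_eq_add_neg, character_add]
    ring
  have e2 : (∫ y, combinedKernel Θ k z y * w y) - φ z =
      ∫ y, (∑ j, character (Θ j) (z - y) * (k j (z, y) - k j (c, y))) * w y := by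
    rw [e1, ← integral_sub hint1 (integrable_finsetSum _ fun j _ => hint2 j)]
    congr 1
    ext y
    rw [combinedKernel, ← Finset.sum_mul, ← sub_mul, ← Finset.sum_sub_distrib]
    simp only [mul_sub]
  rw [e2, ← lintegral_const_mul' _ _ ENNReal.ofReal_ne_top,
    ← lintegral_indicator measurableSet_ball.compl]
  refine (enorm_integral_le_lintegral_enorm _).trans (lintegral_mono fun y => ?_)
  by_cases hy : y ∈ ball c (2 * ρ)
  · simp [hw0 y hy]
  · rw [Set.indicator_of_mem (by simpa using hy), enorm_mul, ← mul_assoc]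
    gcongr
    have hy' : 2 * ρ ≤ dist y c := by simpa using hy
    rw [← ofReal_norm, ← ENNReal.ofReal_mul (by positivity)]
    refine ENNReal.ofReal_le_ofReal ((h.norm_sum_sub_fst_le (fun j => (norm_character _ _).le) hρ
      (mem_ball.1 hzb).le hy').trans ?_)
    gcongr
    linarith

theorem lintegral_ball_rpow_le_maximal {s : ℝ} (hs : 0 < s) {f : Rn n → ℂ} {x c : Rn n} {R : ℝ}
    (hx : x ∈ ball c R) :
    ∫⁻ y in ball c R, ‖f y‖ₑ ^ s ≤ maximal s f x ^ s * volume (ball c R) := by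
  have hR := pos_of_mem_ball hx
  rw [maximal, ← ENNReal.rpow_mul, one_div_mul_cancel hs.ne', ENNReal.rpow_one,
    ← ENNReal.div_le_iff_le_mul (Or.inl (volume_ball_ne_zero c hR))
      (Or.inl (volume_ball_ne_top c R)), ← setLAverage_eq]
  exact le_iSup₂_of_le c R (le_iSup₂_of_le hR hx le_rfl)

theorem eLpNorm_ball_le_maximal {s : ℝ} (hs : 0 < s) {f : Rn n → ℂ} {x c : Rn n} {R : ℝ}
    (hx : x ∈ ball c R) :
    eLpNorm f (ENNReal.ofReal s) (volume.restrict (ball c R)) ≤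
      maximal s f x * volume (ball c R) ^ (1 / s) := by
  rw [eLpNorm_ofReal hs]
  calc _ ≤ (maximal s f x ^ s * volume (ball c R)) ^ (1 / s) := by
        gcongr; exact lintegral_ball_rpow_le_maximal hs hx
    _ = _ := by
        rw [ENNReal.mul_rpow_of_nonneg _ _ (by positivity), ← ENNReal.rpow_mul,
          mul_one_div_cancel hs.ne', ENNReal.rpow_one]

theorem lintegral_ball_le_maximal {s : ℝ} (hs : 1 < s) {f : Rn n → ℂ}
    (hf : AEStronglyMeasurable f volume) {x c : Rn n} {R : ℝ} (hx : x ∈ ball c R) :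
    ∫⁻ y in ball c R, ‖f y‖ₑ ≤ maximal s f x * volume (ball c R) := by
  have hs0 : 0 < s := by linarith
  have hV0 := volume_ball_ne_zero c (pos_of_mem_ball hx)
  have hVt := volume_ball_ne_top c R
  have h1 := eLpNorm_le_eLpNorm_mul_rpow_measure_univ (p := 1) (q := ENNReal.ofReal s)
    (μ := volume.restrict (ball c R)) (by simpa using hs.le) hf.restrict
  rw [eLpNorm_one_eq_lintegral_enorm, Measure.restrict_apply_univ, ENNReal.toReal_ofReal hs0.le,
    ENNReal.toReal_one] at h1
  calc _ ≤ _ := h1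
    _ ≤ maximal s f x * volume (ball c R) ^ (1 / s) * volume (ball c R) ^ ((1 : ℝ) / 1 - 1 / s) := by
        gcongr; exact eLpNorm_ball_le_maximal hs0 hx
    _ = _ := by
        rw [mul_assoc, ← ENNReal.rpow_add _ _ hV0 hVt]; simp

/-- The sharp factor a^(n/s) is weakened to a^n, so that the dilation constant does not involve s.
-/
theorem rpow_volume_ball_mul_le [NeZero n] {s : ℝ} (hs : 1 < s) (c : Rn n) {a : ℕ} (ha : 1 ≤ a)
    {r : ℝ} (hr : 0 ≤ r) :
    volume (ball c (a * r)) ^ (1 / s) ≤ a ^ n * volume (ball c r) ^ (1 / s) := by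
  have hs0 : 0 < s := by linarith
  rw [volume_ball_mul c c (by positivity) hr, ENNReal.ofReal_pow (by positivity),
    ENNReal.ofReal_natCast, ENNReal.mul_rpow_of_nonneg _ _ (by positivity)]
  gcongr
  have h1 : (1 : ℝ≥0∞) ≤ (a : ℝ≥0∞) ^ n := one_le_pow₀ (by exact_mod_cast ha)
  calc ((a : ℝ≥0∞) ^ n) ^ (1 / s) ≤ ((a : ℝ≥0∞) ^ n) ^ (1 : ℝ) :=
        ENNReal.rpow_le_rpow_of_exponent_le h1 ((div_le_one hs0).2 hs.le)
    _ = _ := ENNReal.rpow_one _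

/-- The bound for the part of the function away from the ball. -/
theorem HasModulatedKernel.exists_expSpan_far [NeZero n] (h : HasModulatedKernel Θ A T k)
    {s : ℝ} (hs : 1 < s) (u : L2 n) {x c : Rn n} {r : ℝ} (hx : x ∈ ball c r)
    (hM : maximal s u x ≠ ∞) :
    ∃ (φ : Rn n → ℂ) (hw : MemLp ((ball c (6 * r))ᶜ.indicator u) 2 volume), φ ∈ expSpan Θ ∧
      ∀ᵐ z ∂volume.restrict (ball c (3 * r)), ‖T (hw.toLp _) z - φ z‖ₑ ≤
        ENNReal.ofReal (A * 2 ^ (n + 1)) * (ENNReal.ofReal (2 ^ (n + 1)) * unitVol n *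
          maximal s u x) := by
  have hr := pos_of_mem_ball hx
  have hum : MemLp u 2 volume := Lp.memLp u
  have hw : MemLp ((ball c (6 * r))ᶜ.indicator u) 2 volume := hum.indicator measurableSet_ball.compl
  have hwm : ∀ m : ℕ, MemLp ((ball c m).indicator ((ball c (6 * r))ᶜ.indicator u)) 2 volume :=
    fun m => hw.indicator measurableSet_ball
  have h6 : 2 * (3 * r) = 6 * r := by ring
  -- The kernel representation is only available for compact support, so the far part is first cut
  -- off to the balls of radius m about c. The bound is uniform in m and survives the limit.
  have step : ∀ m : ℕ, ∃ φ ∈ expSpan Θ, ∀ᵐ z ∂volume.restrict (ball c (3 * r)),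
      ‖T ((hwm m).toLp _) z - φ z‖ₑ ≤
        ENNReal.ofReal (A * 2 ^ (n + 1)) * (ENNReal.ofReal (2 ^ (n + 1)) * unitVol n *
          maximal s u x) := by
    intro m
    obtain ⟨φ, hφ, hle⟩ := h.exists_expSpan_enorm_sub_le (c := c) (ρ := 3 * r) (by positivity)
      (hwm m) (hasCompactSupport_of_forall_notMem_ball
        (fun y hy => Set.indicator_of_notMem hy _)).1 (fun y hy => by
          rw [h6] at hy
          by_cases hy' : y ∈ ball c (m : ℝ)
          · rw [Set.indicator_of_mem hy', Set.indicator_of_notMem (by simpa using hy)]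
          · rw [Set.indicator_of_notMem hy'])
    refine ⟨φ, hφ, hle.mono fun z hz => hz.trans ?_⟩
    gcongr
    rw [h6]
    refine le_trans (lintegral_mono fun y => ?_) (lintegral_tail_le (fun y => ‖u y‖ₑ) c
      (by positivity) fun R hR => lintegral_ball_le_maximal hs hum.1
        (ball_subset_ball (by linarith) hx))
    gcongr
    exact (enorm_indicator_le_enorm_self _ _).trans (enorm_indicator_le_enorm_self _ _)
  choose φ hφ hle using step
  have hlim : Tendsto (fun m => T ((hwm m).toLp _)) atTop (𝓝 (T (hw.toLp _))) := by
    refine (T.continuous.tendsto _).comp ?_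
    rw [Lp.tendsto_Lp_iff_tendsto_eLpNorm']
    have h1 := tendsto_eLpNorm_indicator_sub (s := 2) two_pos (by simpa using hw)
      (S := fun m : ℕ => ball c (m : ℝ)) (fun _ => measurableSet_ball)
      (eventually_mem_ball_natCast c)
    rw [ENNReal.ofReal_ofNat] at h1
    exact h1.congr fun m => eLpNorm_congr_ae ((hwm m).coeFn_toLp.symm.sub hw.coeFn_toLp.symm)
  have hv := unitVol_ne_top (n := n)
  obtain ⟨φ₀, hφ₀, h0⟩ := exists_expSpan_enorm_sub_le_of_tendsto (by finiteness) hlim hφ hle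
  exact ⟨φ₀, hw, hφ₀, h0⟩

/-- Constant in the pointwise estimate, in terms of the constant in the `L^s` bound. -/
noncomputable def pointwiseConst (n : ℕ) (A : ℝ) (C : ℝ≥0) : ℝ≥0∞ :=
  C * 6 ^ n + ENNReal.ofReal (A * 2 ^ (n + 1)) * (ENNReal.ofReal (2 ^ (n + 1)) * unitVol n) * 3 ^ n

/-- On the triple of a ball containing `x`, the image `T u` is at distance at most
`N ^ |1 / s - 1 / 2| M_s u (x)` from the span of the exponentials. -/
theorem HasModulatedKernel.exists_expSpan_eLpNorm_sub_le [NeZero n]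
    (h : HasModulatedKernel Θ A T k) (hN : 1 ≤ N) {s : ℝ} (hs : 1 < s) {C : ℝ≥0}
    (hC : ∀ u : L2 n, eLpNorm (T u) (ENNReal.ofReal s) volume ≤
      C * (N : ℝ≥0∞) ^ |1 / s - 1 / 2| * eLpNorm u (ENNReal.ofReal s) volume)
    (u : L2 n) {x c : Rn n} {r : ℝ} (hx : x ∈ ball c r) (hM : maximal s u x ≠ ∞) :
    ∃ φ ∈ expSpan Θ,
      eLpNorm (⇑(T u) - φ) (ENNReal.ofReal s) (volume.restrict (ball c (3 * r))) ≤
        pointwiseConst n A C * (N : ℝ≥0∞) ^ |1 / s - 1 / 2| * maximal s u x *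
          volume (ball c r) ^ (1 / s) := by
  have hr := pos_of_mem_ball hx
  have hs0 : 0 < s := by linarith
  obtain ⟨φ, hw, hφ, hfar⟩ := h.exists_expSpan_far hs u hx hM
  have hE := one_le_natCast_rpow hN (abs_nonneg (1 / s - 1 / 2))
  set E := (N : ℝ≥0∞) ^ |1 / s - 1 / 2| with hEdef
  set M := maximal s u x with hMdef
  set V := volume (ball c r) ^ (1 / s) with hV
  have hum : MemLp u 2 volume := Lp.memLp u
  have hu1 : MemLp ((ball c (6 * r)).indicator u) 2 volume := hum.indicator measurableSet_ball
  refine ⟨φ, hφ, ?_⟩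
  have hdec : ∀ᵐ z, T u z = T (hu1.toLp _) z + T (hw.toLp _) z := by
    have e : u = hu1.toLp _ + hw.toLp _ := by
      refine Lp.ext ?_
      filter_upwards [Lp.coeFn_add (hu1.toLp _) (hw.toLp _), hu1.coeFn_toLp, hw.coeFn_toLp]
        with y h1 h2 h3
      rw [h1, Pi.add_apply, h2, h3, ← Pi.add_apply, Set.indicator_self_add_compl]
    have e2 : T u = T (hu1.toLp _) + T (hw.toLp _) := by
      conv_lhs => rw [e]
      rw [map_add]
    rw [e2]
    exact Lp.coeFn_add _ _
  have hnear : eLpNorm (T (hu1.toLp _)) (ENNReal.ofReal s) (volume.restrict (ball c (3 * r))) ≤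
      C * E * (M * (6 ^ n * V)) := by
    refine (eLpNorm_mono_measure _ Measure.restrict_le_self).trans ((hC _).trans ?_)
    rw [eLpNorm_congr_ae hu1.coeFn_toLp, eLpNorm_indicator_eq_eLpNorm_restrict measurableSet_ball]
    gcongr
    refine (eLpNorm_ball_le_maximal hs0 (ball_subset_ball (by linarith) hx)).trans ?_
    gcongr
    exact_mod_cast rpow_volume_ball_mul_le hs c (a := 6) (by norm_num) hr.le
  have hfar' : eLpNorm (⇑(T (hw.toLp _)) - φ) (ENNReal.ofReal s)
      (volume.restrict (ball c (3 * r))) ≤ ENNReal.ofReal (A * 2 ^ (n + 1)) *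
        (ENNReal.ofReal (2 ^ (n + 1)) * unitVol n * M) * (3 ^ n * V) := by
    refine (eLpNorm_le_of_ae_enorm_bound hfar).trans ?_
    rw [smul_eq_mul, Measure.restrict_apply_univ, ENNReal.toReal_ofReal hs0.le, ← one_div]
    gcongr
    exact_mod_cast rpow_volume_ball_mul_le hs c (a := 3) (by norm_num) hr.le
  calc _ = eLpNorm (⇑(T (hu1.toLp _)) + (⇑(T (hw.toLp _)) - φ)) (ENNReal.ofReal s)
        (volume.restrict (ball c (3 * r))) := by
        refine eLpNorm_congr_ae (ae_restrict_of_ae ?_)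
        filter_upwards [hdec] with z hz
        simp only [Pi.sub_apply, Pi.add_apply, hz, add_sub_assoc]
    _ ≤ _ := eLpNorm_add_le (Lp.aestronglyMeasurable _).restrict
        ((Lp.aestronglyMeasurable _).restrict.sub
          (continuous_of_mem_expSpan hφ).aestronglyMeasurable) (by simpa using hs.le)
    -- The far error carries no power of N; the factor 1 is raised to E ≥ 1 only to merge the two
    -- terms.
    _ ≤ C * E * (M * (6 ^ n * V)) + 1 * (ENNReal.ofReal (A * 2 ^ (n + 1)) *
        (ENNReal.ofReal (2 ^ (n + 1)) * unitVol n * M) * (3 ^ n * V)) := by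
        rw [one_mul]; exact add_le_add hnear hfar'
    _ ≤ C * E * (M * (6 ^ n * V)) + E * (ENNReal.ofReal (A * 2 ^ (n + 1)) *
        (ENNReal.ofReal (2 ^ (n + 1)) * unitVol n * M) * (3 ^ n * V)) := by gcongr
    _ = _ := by rw [pointwiseConst]; ring

/-- The average is over Q while the minimisation is over 3Q; the L^s norm over Q is simply bounded
by the one over 3Q, with normalisation by |Q| throughout. -/
theorem sharpMaximal_le {s : ℝ} (hs : 0 < s) {g : Rn n → ℂ} {x : Rn n} {B : ℝ≥0∞}
    (hB : ∀ (c : Rn n) (r : ℝ), x ∈ ball c r → ∀ v, IsProjection s Θ c r g v →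
      eLpNorm (g - v) (ENNReal.ofReal s) (volume.restrict (ball c (3 * r))) ≤
        B * volume (ball c r) ^ (1 / s)) :
    sharpMaximal s Θ g x ≤ B := by
  refine iSup₂_le fun c r => iSup₂_le fun hr hx => iSup₂_le fun v hv => ?_
  have h0 := volume_ball_ne_zero c hr
  have ht := volume_ball_ne_top c r
  rw [setLAverage_eq, ENNReal.div_rpow_of_nonneg _ _ (by positivity)]
  refine ENNReal.div_le_of_le_mul ?_
  refine le_trans ?_ (hB c r hx v hv)
  rw [eLpNorm_ofReal hs]
  refine ENNReal.rpow_le_rpow (lintegral_mono_set (ball_subset_ball (by linarith))) (by positivity)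

end Pointwise

/-! ### Extension to `L^s` and conclusion -/

section Conclusion

variable {n N : ℕ} {Θ : Fin N → Rn n} {A : ℝ} {T : L2 n →L[ℂ] L2 n}
  {k : Fin N → Rn n × Rn n → ℂ}

theorem maximal_mono {s : ℝ} (hs : 0 < s) {f g : Rn n → ℂ} (h : ∀ᵐ y, ‖f y‖ₑ ≤ ‖g y‖ₑ)
    (x : Rn n) : maximal s f x ≤ maximal s g x := by
  refine ENNReal.rpow_le_rpow ?_ (by positivity)
  refine iSup₂_mono fun c r => iSup₂_mono fun _ _ => ?_
  rw [setLAverage_eq, setLAverage_eq]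
  refine ENNReal.div_le_div_right (lintegral_mono_ae (ae_restrict_of_ae ?_)) _
  filter_upwards [h] with y hy
  exact ENNReal.rpow_le_rpow hy hs.le

/-- Functions of `L^s` are limits of dominated functions of `L²`. -/
theorem exists_L2_approx {s : ℝ} (hs : 0 < s) {f : Rn n → ℂ}
    (hf : MemLp f (ENNReal.ofReal s) volume) :
    ∃ u : ℕ → L2 n, (∀ m, ∀ᵐ y, ‖u m y‖ₑ ≤ ‖f y‖ₑ) ∧
      Tendsto (fun m => eLpNorm (⇑(u m) - f) (ENNReal.ofReal s) volume) atTop (𝓝 0) := by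
  set f₀ := hf.1.mk f with hf₀
  have hf₀m : Measurable f₀ := hf.1.stronglyMeasurable_mk.measurable
  -- Cutting both the height and the support puts f in L² for every s. A measurable representative
  -- makes the sublevel sets measurable.
  let S : ℕ → Set (Rn n) := fun m => {y | ‖f₀ y‖ ≤ m} ∩ ball 0 m
  have hSm : ∀ m, MeasurableSet (S m) := fun m =>
    (measurableSet_le (by fun_prop) measurable_const).inter measurableSet_ball
  have hmem : ∀ m, MemLp ((S m).indicator f) 2 volume := by
    intro m
    have : IsFiniteMeasure (volume.restrict (S m)) := isFiniteMeasure_restrict.2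
      (measure_ne_top_of_subset Set.inter_subset_right (volume_ball_ne_top 0 m))
    refine (memLp_indicator_iff_restrict (hSm m)).2 (MemLp.of_bound hf.1.restrict m ?_)
    filter_upwards [ae_restrict_of_ae hf.1.ae_eq_mk, ae_restrict_mem (hSm m)] with y hy hyS
    rw [hy]
    exact hyS.1
  refine ⟨fun m => (hmem m).toLp _, fun m => ?_, ?_⟩
  · filter_upwards [(hmem m).coeFn_toLp] with y hy
    rw [hy]
    exact enorm_indicator_le_enorm_self _ _
  · refine (tendsto_eLpNorm_indicator_sub hs hf hSm fun y => ?_).congr fun m =>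
      eLpNorm_congr_ae ((hmem m).coeFn_toLp.symm.sub (EventuallyEq.refl _ f))
    filter_upwards [eventually_mem_ball_natCast 0 y, eventually_ge_atTop ⌈‖f₀ y‖⌉₊] with m h1 h2
    exact ⟨show ‖f₀ y‖ ≤ m from (Nat.le_ceil _).trans (by exact_mod_cast h2), h1⟩

theorem eLpNorm_apply_sub_le {s : ℝ} {K : ℝ≥0∞}
    (hK : ∀ u : L2 n, eLpNorm (T u) (ENNReal.ofReal s) volume ≤
      K * eLpNorm u (ENNReal.ofReal s) volume) (hs : 1 < s) {f : Rn n → ℂ}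
    (hf : MemLp f (ENNReal.ofReal s) volume) (u v : L2 n) :
    eLpNorm (⇑(T u) - ⇑(T v)) (ENNReal.ofReal s) volume ≤
      K * (eLpNorm (⇑u - f) (ENNReal.ofReal s) volume +
        eLpNorm (⇑v - f) (ENNReal.ofReal s) volume) := by
  have e1 : eLpNorm (⇑(T u) - ⇑(T v)) (ENNReal.ofReal s) volume =
      eLpNorm (T (u - v)) (ENNReal.ofReal s) volume := by
    rw [map_sub]
    exact eLpNorm_congr_ae (Lp.coeFn_sub _ _).symm
  rw [e1]
  refine (hK _).trans ?_
  gcongr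
  calc eLpNorm (u - v : L2 n) (ENNReal.ofReal s) volume
      = eLpNorm ((⇑u - f) - (⇑v - f)) (ENNReal.ofReal s) volume := by
        refine eLpNorm_congr_ae ?_
        rw [sub_sub_sub_cancel_right]
        exact Lp.coeFn_sub _ _
    _ ≤ _ := eLpNorm_sub_le ((Lp.aestronglyMeasurable _).sub hf.1)
        ((Lp.aestronglyMeasurable _).sub hf.1) (by simpa using hs.le)

/-- A bounded operator for the norm of `L^s` has a continuous extension. -/
theorem exists_isExtensionValue {s : ℝ} {K : ℝ≥0∞} (hKt : K ≠ ∞)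
    (hK : ∀ u : L2 n, eLpNorm (T u) (ENNReal.ofReal s) volume ≤
      K * eLpNorm u (ENNReal.ofReal s) volume) (hs : 1 < s) {f : Rn n → ℂ}
    (hf : MemLp f (ENNReal.ofReal s) volume) : ∃ g, IsExtensionValue T s f g := by
  have hs0 : 0 < s := by linarith
  have hs1 : 1 ≤ ENNReal.ofReal s := by simpa using hs.le
  have : Fact (1 ≤ ENNReal.ofReal s) := ⟨hs1⟩
  obtain ⟨u, hdom, hu⟩ := exists_L2_approx hs0 hf
  have hus : ∀ m, MemLp (T (u m)) (ENNReal.ofReal s) volume := fun m =>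
    ⟨Lp.aestronglyMeasurable _, (hK _).trans_lt (ENNReal.mul_lt_top hKt.lt_top
      ((eLpNorm_mono_enorm_ae (hdom m)).trans_lt hf.2))⟩
  have hcauchy : CauchySeq fun m => (hus m).toLp _ := by
    rw [Lp.cauchySeq_Lp_iff_cauchySeq_eLpNorm]
    have h1 : Tendsto (fun p : ℕ × ℕ => K * (eLpNorm (⇑(u p.1) - f) (ENNReal.ofReal s) volume +
        eLpNorm (⇑(u p.2) - f) (ENNReal.ofReal s) volume)) atTop (𝓝 0) := by
      rw [← prod_atTop_atTop_eq]
      have h2 := ENNReal.Tendsto.const_mul (a := K)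
        ((hu.comp tendsto_fst).add (hu.comp (tendsto_snd (f := atTop) (g := atTop))))
        (Or.inr hKt)
      simpa using h2
    refine tendsto_of_tendsto_of_tendsto_of_le_of_le tendsto_const_nhds h1 (fun _ => zero_le)
      fun p => ?_
    rw [eLpNorm_congr_ae ((hus p.1).coeFn_toLp.sub (hus p.2).coeFn_toLp)]
    exact eLpNorm_apply_sub_le hK hs hf _ _
  obtain ⟨g, hg⟩ := cauchySeq_tendsto_of_complete hcauchy
  have hg' : Tendsto (fun m => eLpNorm (⇑(T (u m)) - ⇑g) (ENNReal.ofReal s) volume) atTop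
      (𝓝 0) :=
    ((Lp.tendsto_Lp_iff_tendsto_eLpNorm' _ _).1 hg).congr fun m =>
      eLpNorm_congr_ae ((hus m).coeFn_toLp.sub (EventuallyEq.refl _ _))
  refine ⟨g, Lp.memLp g, fun w hw => ?_⟩
  -- The limit does not depend on the sequence: any other approximating sequence is compared with
  -- the fixed one through the L^s bound.
  have h3 := (ENNReal.Tendsto.const_mul (a := K) (hw.add hu) (Or.inr hKt)).add hg'
  simp only [add_zero, mul_zero] at h3
  refine tendsto_of_tendsto_of_tendsto_of_le_of_le tendsto_const_nhds h3 (fun _ => zero_le)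
    fun m => ?_
  calc eLpNorm (⇑(T (w m)) - ⇑g) (ENNReal.ofReal s) volume
      = eLpNorm ((⇑(T (w m)) - ⇑(T (u m))) + (⇑(T (u m)) - ⇑g)) (ENNReal.ofReal s) volume := by
        rw [sub_add_sub_cancel]
    _ ≤ _ := eLpNorm_add_le ((Lp.aestronglyMeasurable _).sub (Lp.aestronglyMeasurable _))
        ((Lp.aestronglyMeasurable _).sub (Lp.aestronglyMeasurable _)) hs1
    _ ≤ _ := by
        gcongr
        exact eLpNorm_apply_sub_le hK hs hf _ _

theorem pointwiseConst_ne_top (n : ℕ) (A : ℝ) (C : ℝ≥0) : pointwiseConst n A C ≠ ∞ := by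
  have := unitVol_ne_top (n := n)
  unfold pointwiseConst
  finiteness

theorem one_le_pointwiseConst (n : ℕ) (A : ℝ) {C : ℝ≥0} (hC : 1 ≤ C) :
    1 ≤ pointwiseConst n A C := by
  refine le_add_right ?_
  exact one_le_mul (by exact_mod_cast hC) (one_le_pow₀ (by norm_num))

/-- The estimate of the sharp function for a limit of images of functions of `L²`. -/
theorem HasModulatedKernel.sharpMaximal_le_of_tendsto [NeZero n]
    (h : HasModulatedKernel Θ A T k) (hN : 1 ≤ N) {s : ℝ} (hs : 1 < s) {C : ℝ≥0} (hC1 : 1 ≤ C)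
    (hC : ∀ u : L2 n, eLpNorm (T u) (ENNReal.ofReal s) volume ≤
      C * (N : ℝ≥0∞) ^ |1 / s - 1 / 2| * eLpNorm u (ENNReal.ofReal s) volume)
    {f g : Rn n → ℂ} (hg : AEStronglyMeasurable g volume) {u : ℕ → L2 n}
    (hdom : ∀ m, ∀ᵐ y, ‖u m y‖ₑ ≤ ‖f y‖ₑ)
    (hlim : Tendsto (fun m => eLpNorm (⇑(T (u m)) - g) (ENNReal.ofReal s) volume) atTop (𝓝 0))
    (x : Rn n) :
    sharpMaximal s Θ g x ≤
      pointwiseConst n A C * (N : ℝ≥0∞) ^ |1 / s - 1 / 2| * maximal s f x := by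
  have hs0 : 0 < s := by linarith
  -- When M_s f(x) is infinite the right side must be infinite as well, which in `ℝ≥0∞` requires
  -- nonzero constants; hence the normalisation 1 ≤ C.
  rcases eq_or_ne (maximal s f x) ∞ with htop | htop
  · rw [htop, ENNReal.mul_top]
    · exact le_top
    · exact mul_ne_zero (zero_lt_one.trans_le (one_le_pointwiseConst n A hC1)).ne'
        (zero_lt_one.trans_le (one_le_natCast_rpow hN (abs_nonneg _))).ne'
  refine sharpMaximal_le hs0 fun c r hx v hv => ?_
  set B := pointwiseConst n A C * (N : ℝ≥0∞) ^ |1 / s - 1 / 2| * maximal s f x with hB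
  have hle : ∀ m, eLpNorm (g - v) (ENNReal.ofReal s) (volume.restrict (ball c (3 * r))) ≤
      eLpNorm (⇑(T (u m)) - g) (ENNReal.ofReal s) volume +
        B * volume (ball c r) ^ (1 / s) := by
    intro m
    have hmax := maximal_mono hs0 (hdom m) x
    obtain ⟨φ, hφ, hφle⟩ := h.exists_expSpan_eLpNorm_sub_le hN hs hC (u m) hx
      (ne_top_of_le_ne_top htop hmax)
    have hTm := Lp.aestronglyMeasurable (T (u m))
    -- Minimality of the projection of the limit g: it is compared with the exponential sum that
    -- approximates T (u m).
    calc _ ≤ eLpNorm (g - φ) (ENNReal.ofReal s) (volume.restrict (ball c (3 * r))) := hv.2 φ hφ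
      _ = eLpNorm ((g - ⇑(T (u m))) + (⇑(T (u m)) - φ)) (ENNReal.ofReal s)
            (volume.restrict (ball c (3 * r))) := by rw [sub_add_sub_cancel]
      _ ≤ _ := eLpNorm_add_le (hg.sub hTm).restrict
          (hTm.restrict.sub (continuous_of_mem_expSpan hφ).aestronglyMeasurable)
          (by simpa using hs.le)
      _ ≤ _ := by
          refine add_le_add ?_ (hφle.trans ?_)
          · rw [eLpNorm_sub_comm]
            exact eLpNorm_mono_measure _ Measure.restrict_le_self
          · rw [hB]; gcongr
  refine ge_of_tendsto' (x := atTop) ?_ hle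
  simpa using hlim.add_const (B * volume (ball c r) ^ (1 / s))

theorem sharpMaximal_eq_zero_of_ae_eq_zero {s : ℝ} (hs : 0 < s) {g : Rn n → ℂ}
    (hg : g =ᵐ[volume] 0) (x : Rn n) : sharpMaximal s Θ g x = 0 := by
  refine le_antisymm (sharpMaximal_le hs fun c r _ v hv => ?_) zero_le
  refine (hv.2 0 (Submodule.zero_mem _)).trans ?_
  rw [sub_zero, eLpNorm_congr_ae (ae_restrict_of_ae hg), eLpNorm_zero]
  exact zero_le

theorem IsCalderonZygmund.eq_zero_of_isEmpty {Θ : Fin 0 → Rn n} (h : IsCalderonZygmund Θ A T) :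
    T = 0 := by
  obtain ⟨-, S, K, hS, -⟩ := h
  ext1 f
  have := hS f
  rw [Finset.univ_eq_empty, Finset.sum_empty] at this
  exact Subtype.ext this

end Conclusion

end MultiFreq

theorem proposition2p4 (n : ℕ) (hn : 1 ≤ n) (s : ℝ) (hs : 1 < s) (A : ℝ) :
    ∃ C : ℝ≥0, ∀ (N : ℕ) (Θ : Fin N → MultiFreq.Rn n)
      (T : MultiFreq.L2 n →L[ℂ] MultiFreq.L2 n), MultiFreq.IsCalderonZygmund Θ A T →
      (∀ (f : MultiFreq.L2 n) (x : MultiFreq.Rn n),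
        MultiFreq.sharpMaximal s Θ (T f) x ≤
          C * (N : ℝ≥0∞) ^ |1 / s - 1 / 2| * MultiFreq.maximal s f x) ∧
      (∀ f : MultiFreq.Rn n → ℂ, MemLp f (ENNReal.ofReal s) volume →
        ∃ g : MultiFreq.Rn n → ℂ, MultiFreq.IsExtensionValue T s f g ∧
          ∀ x : MultiFreq.Rn n,
            MultiFreq.sharpMaximal s Θ g x ≤
              C * (N : ℝ≥0∞) ^ |1 / s - 1 / 2| * MultiFreq.maximal s f x) := by
  have : NeZero n := ⟨by omega⟩
  have hs0 : 0 < s := by linarith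
  obtain ⟨C, hC1, hC⟩ := MultiFreq.exists_strong_type n A hs
  refine ⟨(MultiFreq.pointwiseConst n A C).toNNReal, fun N Θ T hT => ?_⟩
  rw [ENNReal.coe_toNNReal (MultiFreq.pointwiseConst_ne_top n A C)]
  -- With no frequencies the factor N^|1/s-1/2| vanishes unless s = 2, so the left side has to be
  -- exactly zero. It is, because T is then an empty sum.
  rcases Nat.eq_zero_or_pos N with rfl | hN
  · obtain rfl := hT.eq_zero_of_isEmpty
    have h0 : ∀ f : MultiFreq.L2 n,
        ⇑((0 : MultiFreq.L2 n →L[ℂ] MultiFreq.L2 n) f) =ᵐ[volume] 0 :=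
      fun f => Lp.coeFn_zero ℂ 2 volume
    refine ⟨fun f x => ?_, fun f hf => ⟨0, ⟨MemLp.zero, fun u _ => ?_⟩, fun x => ?_⟩⟩
    · rw [MultiFreq.sharpMaximal_eq_zero_of_ae_eq_zero hs0 (h0 f)]; exact zero_le
    · simp only [sub_zero, eLpNorm_congr_ae (h0 _), eLpNorm_zero]
      exact tendsto_const_nhds
    · rw [MultiFreq.sharpMaximal_eq_zero_of_ae_eq_zero hs0 EventuallyEq.rfl]; exact zero_le
  · obtain ⟨k, hk⟩ := hT.exists_hasModulatedKernel
    have hCT := hC N Θ T k hN hk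
    refine ⟨fun f x => ?_, fun f hf => ?_⟩
    · refine hk.sharpMaximal_le_of_tendsto hN hs hC1 hCT (Lp.aestronglyMeasurable _)
        (u := fun _ => f) (fun _ => ae_of_all _ fun _ => le_rfl) ?_ x
      simp only [sub_self, eLpNorm_zero]
      exact tendsto_const_nhds
    · obtain ⟨g, hg⟩ := MultiFreq.exists_isExtensionValue (ENNReal.mul_ne_top ENNReal.coe_ne_top
        (MultiFreq.natCast_rpow_ne_top (abs_nonneg _))) hCT hs hf
      obtain ⟨u, hdom, hu⟩ := MultiFreq.exists_L2_approx hs0 hf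
      exact ⟨g, hg, hk.sharpMaximal_le_of_tendsto hN hs hC1 hCT hg.1.1 hdom (hg.2 u hu)⟩
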